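/- Conventions. Simplicial complexes are finite, and their realizations $|\Delta|$ are taken in the usual way. A triangulation of a topological space $M$ is a simplicial complex $\Delta$ with $|\Delta|$ homeomorphic to $M$. For a $(d-1)$-dimensional complex $\Delta$ let $f_{j}$ be the number of its $j$-dimensional faces ($f_{-1}=1$), $h_i=\sum_{j=0}^{i}(-1)^{i-j}\binom{d-j}{d-i}f_{j-1}$, and $g_i=h_i-h_{i-1}$ for $i\ge 1$; thus $g_1=f_0-d-1$ and $g_2=f_1-d f_0+\binom{d+1}{2}$. Let $k$ be a field. A $(d-1)$-dimensional complex $\Delta$ is a $k$-homology manifold if the link of every nonempty face $\rho$ has the simplicial homology over $k$ of the sphere $S^{d-|\rho|-1}$ or of the ball of that dimension; its boundary consists of the nonempty faces $\rho$ with $\tilde H_{d-|\rho|-1}(\operatorname{lk}\rho;k)=0$. A triangulable $k$-homology manifold without boundary of dimension $d-1$ is a topological space which has a triangulation by a $(d-1)$-dimensional $k$-homology manifold whose boundary has no face. A complex is $2$-neighborly if every two of its vertices span an edge. Theorem. Let $k$ be a field, let $d\ge 4$, and let $M$ be a connected triangulable $k$-homology manifold without boundary of dimension $d-1$. Then: (1)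 there is a natural number $\gamma(M)$ such that for all natural numbers $a,b$ with $\gamma(M)\le b\le\binom{a+1}{2}$ there is a triangulation $\Delta$ of $M$ with $g_1(\Delta)=a$ and $g_2(\Delta)=b$; (2) there is an $N$ such that for every $n\ge N$ the space $M$ has a $2$-neighborly triangulation with exactly $n$ vertices. (In particular this holds if $M$ is moreover orientable over $k$, that is, closed.) -/

import Mathlib

noncomputable section

namespace PreAbstractSimplicialComplex

variable {V : Type*}

/-- All faces of `K` together with the empty face (which Mathlib's complexes leave out). -/
def allFaces (K : PreAbstractSimplicialComplex V) : Set (Finset V) :=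
  insert ∅ K.faces

/-- All faces of `K` with exactly `j` vertices (including the empty face if `j = 0`), that is,
all faces of dimension `j - 1`. -/
def facesOfCard (K : PreAbstractSimplicialComplex V) (j : ℕ) : Set (Finset V) :=
  {σ | σ ∈ K.allFaces ∧ σ.card = j}

/-- The largest number `d` of vertices of a face of a complex on a finite vertex set: the complex
has dimension `d - 1`. -/
def rank (K : PreAbstractSimplicialComplex V) : ℕ :=
  sSup (Finset.card '' K.faces)

/-- `K.fNumber j` is the number `f_{j-1}` of faces with `j` vertices; so `K.fNumber 0 = 1`
counts the empty face, `K.fNumber 1` the vertices and `K.fNumber 2` the edges. -/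
def fNumber (K : PreAbstractSimplicialComplex V) (j : ℕ) : ℕ :=
  (K.facesOfCard j).ncard

/-- The entry `h_i` (`0 ≤ i ≤ d`) of the `h`-vector of a `(d-1)`-dimensional complex:
`h_i = ∑_{j ≤ i} (-1)^{i-j} (d-j choose d-i) f_{j-1}`. -/
def hNumber (K : PreAbstractSimplicialComplex V) (i : ℕ) : ℤ :=
  ∑ j ∈ Finset.range (i + 1),
    (-1) ^ (i - j) * ((K.rank - j).choose (K.rank - i) : ℤ) * (K.fNumber j : ℤ)

/-- The entries of the `g`-vector: `g_0 = h_0` and `g_i = h_i - h_{i-1}` for `i ≥ 1`. -/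
def gNumber (K : PreAbstractSimplicialComplex V) : ℕ → ℤ
  | 0 => K.hNumber 0
  | i + 1 => K.hNumber (i + 1) - K.hNumber i

/-- The geometric realization of a complex on a finite vertex set `V`: the union in `ℝ^V`, over
all faces, of the convex hulls of the corresponding standard basis vectors. -/
def realization [DecidableEq V] (K : PreAbstractSimplicialComplex V) : Set (V → ℝ) :=
  ⋃ σ ∈ K.faces, convexHull ℝ ((fun v : V => (Pi.single v 1 : V → ℝ)) '' (σ : Set V))

/-- The link of `ρ`: all faces `τ` disjoint from `ρ` such that `τ ∪ ρ` is a face. -/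
def link [DecidableEq V] (K : PreAbstractSimplicialComplex V) (ρ : Finset V) :
    PreAbstractSimplicialComplex V where
  faces := {τ | τ.Nonempty ∧ Disjoint τ ρ ∧ τ ∪ ρ ∈ K.faces}
  isRelLowerSet_faces := by
    rintro τ ⟨hne, hdis, hmem⟩
    refine ⟨hne, fun υ hυ hυne => ⟨hυne, Finset.disjoint_of_subset_left hυ hdis, ?_⟩⟩
    exact (K.isRelLowerSet_faces hmem).2 (Finset.union_subset_union_left hυ)
      (hυne.mono Finset.subset_union_left)

end PreAbstractSimplicialComplex

namespace SimplicialHomology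

/-- The quotient `Z / (B ∩ Z)` of submodules `Z`, `B` of `C`; this is `Z / B` if `B ≤ Z`. -/
def Subquotient {k C : Type*} [Field k] [AddCommGroup C] [Module k C] (Z B : Submodule k C) :
    Type _ :=
  Z ⧸ B.submoduleOf Z

instance {k C : Type*} [Field k] [AddCommGroup C] [Module k C] (Z B : Submodule k C) :
    AddCommGroup (Subquotient Z B) :=
  inferInstanceAs (AddCommGroup (Z ⧸ B.submoduleOf Z))

instance {k C : Type*} [Field k] [AddCommGroup C] [Module k C] (Z B : Submodule k C) :
    Module k (Subquotient Z B) :=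
  inferInstanceAs (Module k (Z ⧸ B.submoduleOf Z))

variable {V : Type*} [LinearOrder V]

/-- The simplicial boundary operator on the free module on all finite subsets of `V`:
`∂[v_0 < ⋯ < v_m] = ∑_i (-1)^i [v_0, …, v_i omitted, …, v_m]`. A vertex has boundary `[∅]`, so
restricted to the faces of a complex (with the empty face) this is the augmented chain complex. -/
def boundary (k : Type*) [Field k] (V : Type*) [LinearOrder V] :
    (Finset V →₀ k) →ₗ[k] (Finset V →₀ k) :=
  Finsupp.lift (Finset V →₀ k) k (Finset V) fun σ =>
    ∑ v ∈ σ, Finsupp.single (σ.erase v) ((-1) ^ (σ.filter (· < v)).card)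

/-- Chains of `K` in degree `j - 1`: combinations of faces with `j` vertices. -/
def chains (k : Type*) [Field k] (K : PreAbstractSimplicialComplex V) (j : ℕ) :
    Submodule k (Finset V →₀ k) :=
  Finsupp.supported k k (K.facesOfCard j)

/-- Reduced cycles of `K` in degree `j - 1`. -/
def cycles (k : Type*) [Field k] (K : PreAbstractSimplicialComplex V) (j : ℕ) :
    Submodule k (Finset V →₀ k) :=
  chains k K j ⊓ LinearMap.ker (boundary k V)

/-- Boundaries of `K` in degree `j - 1`. -/
def boundaries (k : Type*) [Field k] (K : PreAbstractSimplicialComplex V) (j : ℕ) :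
    Submodule k (Finset V →₀ k) :=
  (chains k K (j + 1)).map (boundary k V)

/-- The reduced simplicial homology of `K` over `k` in degree `j - 1` (cycles modulo boundaries).
The index is shifted by one so that degree `-1` is included: it is `k` for the complex whose only
face is the empty face, and `0` for all others. -/
abbrev reducedHomology (k : Type*) [Field k] (K : PreAbstractSimplicialComplex V) (j : ℕ) :
    Type _ :=
  Subquotient (cycles k K j) (boundaries k K j)

/-- `K` has the `k`-homology of the sphere `S^{r-1}` (where `S^{-1}` is empty): its reduced
homology is `k` in degree `r - 1` and zero in all other degrees. -/
def HasHomologyOfSphere (k : Type*) [Field k] (K : PreAbstractSimplicialComplex V) (r : ℕ) :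
    Prop :=
  Nonempty (reducedHomology k K r ≃ₗ[k] k) ∧ ∀ j, j ≠ r → Subsingleton (reducedHomology k K j)

/-- `K` has the `k`-homology of a ball: its reduced homology vanishes. -/
def HasHomologyOfBall (k : Type*) [Field k] (K : PreAbstractSimplicialComplex V) : Prop :=
  ∀ j, Subsingleton (reducedHomology k K j)

/-- A `(d-1)`-dimensional complex is a `k`-homology manifold if the link of every nonempty face
`ρ` has the `k`-homology of the sphere or of the ball of dimension `d - |ρ| - 1`. -/
def IsHomologyManifold (k : Type*) [Field k] (K : PreAbstractSimplicialComplex V) : Prop :=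
  ∀ ρ ∈ K.faces, HasHomologyOfSphere k (K.link ρ) (K.rank - ρ.card) ∨
    HasHomologyOfBall k (K.link ρ)

/-- The (nonempty) faces in the boundary of a `(d-1)`-dimensional `k`-homology manifold: those
faces `ρ` for which the reduced homology of the link vanishes in degree `d - |ρ| - 1`. -/
def boundaryFaces (k : Type*) [Field k] (K : PreAbstractSimplicialComplex V) :
    Set (Finset V) :=
  {ρ | ρ ∈ K.faces ∧ Subsingleton (reducedHomology k (K.link ρ) (K.rank - ρ.card))}

end SimplicialHomology

/-- A finite simplicial complex with vertex set `Fin n` is a triangulation of the topological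
space `M` if its geometric realization is homeomorphic to `M`. -/
def IsTriangulation {n : ℕ} (Δ : AbstractSimplicialComplex (Fin n))
    (M : Type*) [TopologicalSpace M] : Prop :=
  Nonempty (Δ.realization ≃ₜ M)

/-- `Δ` is `i`-neighborly if every set of `i` vertices is a face. -/
def IsNeighborly {n : ℕ} (Δ : AbstractSimplicialComplex (Fin n)) (i : ℕ) : Prop :=
  ∀ s : Finset (Fin n), s.card = i → s ∈ Δ.faces

/-- `M` is a triangulable `k`-homology manifold without boundary of dimension `d - 1`. -/
def IsTriangulableHomologyManifoldWithoutBoundary (k : Type*) [Field k]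
    (M : Type*) [TopologicalSpace M] (d : ℕ) : Prop :=
  ∃ (n : ℕ) (Δ : AbstractSimplicialComplex (Fin n)), IsTriangulation Δ M ∧ Δ.rank = d ∧
    SimplicialHomology.IsHomologyManifold k Δ.toPreAbstractSimplicialComplex ∧
    SimplicialHomology.boundaryFaces k Δ.toPreAbstractSimplicialComplex = ∅

end

namespace FacetComplex

/-- The relation of lying in a common facet; `Adj K p p` says that `p` is a vertex of `K`. -/
def Adj (K : Finset (Finset ℕ)) (p q : ℕ) : Prop := ∃ X ∈ K, p ∈ X ∧ q ∈ X

theorem Adj.symm {K : Finset (Finset ℕ)} {p q : ℕ} (h : Adj K p q) : Adj K q p := by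
  obtain ⟨X, hX, hp, hq⟩ := h
  exact ⟨X, hX, hq, hp⟩

theorem Adj.left {K : Finset (Finset ℕ)} {p q : ℕ} (h : Adj K p q) : Adj K p p := by
  obtain ⟨X, hX, hp, hq⟩ := h
  exact ⟨X, hX, hp, hp⟩

theorem Adj.right {K : Finset (Finset ℕ)} {p q : ℕ} (h : Adj K p q) : Adj K q q :=
  h.symm.left

/-- The vertices of `K`. -/
def vertices (K : Finset (Finset ℕ)) : Finset ℕ := K.biUnion id

theorem mem_vertices {K : Finset (Finset ℕ)} {p : ℕ} : p ∈ vertices K ↔ Adj K p p := by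
  simp [vertices, Adj]

theorem exists_not_adj_self (K : Finset (Finset ℕ)) : ∃ u, ¬ Adj K u u := by
  obtain ⟨u, hu⟩ := Infinite.exists_notMem_finset (vertices K)
  exact ⟨u, fun h => hu (mem_vertices.2 h)⟩

/-- A closed pseudomanifold whose facets have `d` vertices, given by its facets. -/
structure IsPseudomanifold (d : ℕ) (K : Finset (Finset ℕ)) : Prop where
  nonempty : K.Nonempty
  card_eq : ∀ X ∈ K, X.card = d
  exists_ne : ∀ X ∈ K, ∀ s ∈ X, ∃ Y ∈ K, Y ≠ X ∧ X.erase s ⊆ Y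
  eq_or_eq : ∀ S : Finset ℕ, S.card + 1 = d → ∀ X ∈ K, ∀ Y ∈ K, ∀ W ∈ K,
    S ⊆ X → S ⊆ Y → S ⊆ W → X = Y ∨ X = W ∨ Y = W

/-- The stellar subdivision of `K` at `σ` with the new vertex `u`. -/
def stellar (σ : Finset ℕ) (u : ℕ) (K : Finset (Finset ℕ)) : Finset (Finset ℕ) :=
  K.filter (fun X => ¬ σ ⊆ X) ∪
    (K.filter (fun X => σ ⊆ X)).biUnion fun X => σ.image fun f => insert u (X.erase f)

theorem mem_stellar {σ : Finset ℕ} {u : ℕ} {K : Finset (Finset ℕ)} {X : Finset ℕ} :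
    X ∈ stellar σ u K ↔
      (X ∈ K ∧ ¬ σ ⊆ X) ∨ ∃ Y ∈ K, σ ⊆ Y ∧ ∃ f ∈ σ, insert u (Y.erase f) = X := by
  simp [stellar, and_assoc]

/-- The bistellar flip of `K` that replaces the ridge `R` by the edge `xy`. -/
def flip (R : Finset ℕ) (x y : ℕ) (K : Finset (Finset ℕ)) : Finset (Finset ℕ) :=
  K.filter (fun X => ¬ (X = insert x R ∨ X = insert y R)) ∪
    R.image fun r => insert x (insert y (R.erase r))

theorem mem_flip {R : Finset ℕ} {x y : ℕ} {K : Finset (Finset ℕ)} {X : Finset ℕ} :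
    X ∈ flip R x y K ↔
      (X ∈ K ∧ X ≠ insert x R ∧ X ≠ insert y R) ∨
        ∃ r ∈ R, insert x (insert y (R.erase r)) = X := by
  simp [flip]

/-- The conditions under which the flip of `R` to `xy` is admissible. -/
structure CanFlip (R : Finset ℕ) (x y : ℕ) (K : Finset (Finset ℕ)) : Prop where
  left_notMem : x ∉ R
  right_notMem : y ∉ R
  left_mem : insert x R ∈ K
  right_mem : insert y R ∈ K
  not_adj : ¬ Adj K x y

theorem CanFlip.ne {R : Finset ℕ} {x y : ℕ} {K : Finset (Finset ℕ)} (h : CanFlip R x y K) :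
    x ≠ y := by
  rintro rfl
  exact h.not_adj ⟨_, h.left_mem, by simp, by simp⟩

theorem eq_insert_of_subset {S X : Finset ℕ} (h : S ⊆ X) (hc : X.card = S.card + 1) :
    ∃ a, a ∉ S ∧ X = insert a S := by
  have h1 : (X \ S).card = 1 := by
    rw [Finset.card_sdiff_of_subset h]; omega
  obtain ⟨a, ha⟩ := Finset.card_eq_one.1 h1
  have h2 : ∀ b, (b ∈ X ∧ b ∉ S) ↔ b = a := fun b => by
    rw [← Finset.mem_sdiff, ha, Finset.mem_singleton]
  exact ⟨a, ((h2 a).2 rfl).2, by ext b; have := h2 b; have := @h b; grind⟩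

theorem not_mem_of_not_adj {K : Finset (Finset ℕ)} {u : ℕ} (hu : ¬ Adj K u u) {X : Finset ℕ}
    (hX : X ∈ K) : u ∉ X := fun h => hu ⟨X, hX, h, h⟩

namespace IsPseudomanifold

variable {d : ℕ} {K : Finset (Finset ℕ)}

theorem eq_or_eq_of_insert (hK : IsPseudomanifold d K) {R : Finset ℕ} {x y : ℕ}
    (hx : x ∉ R) (hxy : x ≠ y) (hxR : insert x R ∈ K) (hyR : insert y R ∈ K)
    {X : Finset ℕ} (hX : X ∈ K) (hR : R ⊆ X) : X = insert x R ∨ X = insert y R := by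
  have hc : R.card + 1 = d := by
    rw [← hK.card_eq _ hxR, Finset.card_insert_of_notMem hx]
  rcases hK.eq_or_eq R hc _ hX _ hxR _ hyR hR (Finset.subset_insert _ _)
    (Finset.subset_insert _ _) with h | h | h
  · exact Or.inl h
  · exact Or.inr h
  · exfalso
    have : x ∈ insert y R := h ▸ Finset.mem_insert_self _ _
    grind

theorem stellar (hK : IsPseudomanifold d K) {σ : Finset ℕ} {u : ℕ}
    (hσ : σ.Nonempty) (hu : ¬ Adj K u u) : IsPseudomanifold d (stellar σ u K) where
  nonempty := by
    obtain ⟨X, hX⟩ := hK.nonempty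
    by_cases h : σ ⊆ X
    · obtain ⟨f, hf⟩ := hσ
      exact ⟨_, mem_stellar.2 (Or.inr ⟨X, hX, h, f, hf, rfl⟩)⟩
    · exact ⟨X, mem_stellar.2 (Or.inl ⟨hX, h⟩)⟩
  card_eq := by
    intro X hX
    rcases mem_stellar.1 hX with ⟨h, _⟩ | ⟨Y, hY, hs, f, hf, rfl⟩
    · exact hK.card_eq X h
    · have h1 := not_mem_of_not_adj hu hY
      have h2 := Finset.card_erase_add_one (hs hf)
      rw [Finset.card_insert_of_notMem (by grind), h2, hK.card_eq Y hY]
  exists_ne := by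
    intro X hX s hs
    rcases mem_stellar.1 hX with ⟨h, hσX⟩ | ⟨Y, hY, hsY, f, hf, rfl⟩
    · obtain ⟨Y, hY, hne, hsub⟩ := hK.exists_ne X h s hs
      by_cases hσY : σ ⊆ Y
      · obtain ⟨g, hg, hgX⟩ := Finset.not_subset.1 hσX
        refine ⟨_, mem_stellar.2 (Or.inr ⟨Y, hY, hσY, g, hg, rfl⟩), ?_, by grind⟩
        have := not_mem_of_not_adj hu h
        grind
      · exact ⟨Y, mem_stellar.2 (Or.inl ⟨hY, hσY⟩), hne, hsub⟩
    · have huY := not_mem_of_not_adj hu hY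
      have hfY := hsY hf
      by_cases hsu : s = u
      · subst hsu
        obtain ⟨W, hW, hne, hsub⟩ := hK.exists_ne Y hY f hfY
        have huW := not_mem_of_not_adj hu hW
        refine ⟨W, mem_stellar.2 (Or.inl ⟨hW, fun hc => hne ?_⟩), by grind, by grind⟩
        have : Y ⊆ W := by grind
        exact (Finset.eq_of_subset_of_card_le this (by rw [hK.card_eq _ hW, hK.card_eq _ hY])).symm
      · have hsY' : s ∈ Y := by grind
        by_cases hsσ : s ∈ σ
        · refine ⟨_, mem_stellar.2 (Or.inr ⟨Y, hY, hsY, s, hsσ, rfl⟩), ?_, by grind⟩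
          intro hc
          have : s ∈ insert u (Y.erase s) := hc ▸ hs
          grind
        · obtain ⟨W, hW, hne, hsub⟩ := hK.exists_ne Y hY s hsY'
          refine ⟨_, mem_stellar.2 (Or.inr ⟨W, hW, by grind, f, hf, rfl⟩), ?_, by grind⟩
          intro hc
          apply hne
          have huW := not_mem_of_not_adj hu hW
          have hfW : f ∈ W := by grind
          have : W.erase f = Y.erase f := by
            have := congrArg (fun A => A.erase u) hc
            simpa [Finset.erase_insert, huW, huY] using this
          rw [← Finset.insert_erase hfW, this, Finset.insert_erase hfY]
  eq_or_eq := by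
    intro S hS
    by_cases huS : u ∈ S
    · -- every facet containing `S` is new
      have key : ∀ X ∈ FacetComplex.stellar σ u K, S ⊆ X → ∃ Y ∈ K, σ ⊆ Y ∧ S.erase u ⊆ Y ∧
          ∃ f ∈ σ, f ∉ S ∧ insert u (Y.erase f) = X := by
        intro X hX hSX
        rcases mem_stellar.1 hX with ⟨h, hσX⟩ | ⟨Y, hY, hsY, f, hf, rfl⟩
        · exact absurd (hSX huS) (not_mem_of_not_adj hu h)
        · have := not_mem_of_not_adj hu hY
          have := hsY hf
          exact ⟨Y, hY, hsY, by grind, f, hf, by grind, rfl⟩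
      intro X₀ hX Y₀ hY W₀ hW hSX hSY hSW
      obtain ⟨X, hX1, hσX, hSX', f, hf, hfS, rfl⟩ := key _ hX hSX
      obtain ⟨Y, hY1, hσY, hSY', g, hg, hgS, rfl⟩ := key _ hY hSY
      obtain ⟨W, hW1, hσW, hSW', e, he, heS, rfl⟩ := key _ hW hSW
      have hcT : (S.erase u).card + 2 = d := by
        have := Finset.card_erase_add_one huS; omega
      by_cases hall : f = g ∧ f = e
      · obtain ⟨rfl, rfl⟩ := hall
        have hc : (insert f (S.erase u)).card + 1 = d := by
          rw [Finset.card_insert_of_notMem (by grind)]; omega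
        rcases hK.eq_or_eq _ hc X hX1 Y hY1 W hW1 (by grind) (by grind) (by grind) with h | h | h <;>
          simp [h]
      · have key2 : ∃ a b, a ≠ b ∧ a ∈ σ ∧ b ∈ σ ∧ a ∉ S ∧ b ∉ S ∧ (f = a ∨ f = b) := by
          by_cases h : f = g
          · exact ⟨f, e, by grind, hf, he, hfS, heS, by simp⟩
          · exact ⟨f, g, by grind, hf, hg, hfS, hgS, by simp⟩
        obtain ⟨a, b, hab, ha, hb, haS, hbS, hfab⟩ := key2
        have hcab : (insert a (insert b (S.erase u))).card = d := by
          rw [Finset.card_insert_of_notMem (by grind), Finset.card_insert_of_notMem (by grind)]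
          omega
        have hall : ∀ Z ∈ K, σ ⊆ Z → S.erase u ⊆ Z → insert a (insert b (S.erase u)) = Z := by
          intro Z hZ h1 h2
          exact Finset.eq_of_subset_of_card_le (by grind) (by rw [hcab, hK.card_eq Z hZ])
        have e1 := hall X hX1 hσX hSX'
        have e2 := hall Y hY1 hσY hSY'
        have e3 := hall W hW1 hσW hSW'
        have hg' : g = a ∨ g = b := by grind
        have he' : e = a ∨ e = b := by grind
        rw [← e1, ← e2, ← e3]
        rcases hfab with rfl | rfl <;> rcases hg' with rfl | rfl <;> rcases he' with rfl | rfl <;>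
          simp
    · -- facets containing `S` come from different facets containing `S`
      have key : ∀ X ∈ FacetComplex.stellar σ u K, S ⊆ X → ∃ Y ∈ K, S ⊆ Y ∧
          ((¬ σ ⊆ Y ∧ X = Y) ∨ (σ ⊆ Y ∧ X = insert u S)) := by
        intro X hX hSX
        rcases mem_stellar.1 hX with ⟨h, hσX⟩ | ⟨Y, hY, hsY, f, hf, rfl⟩
        · exact ⟨X, h, hSX, Or.inl ⟨hσX, rfl⟩⟩
        · have h1 := not_mem_of_not_adj hu hY
          have h2 := Finset.card_erase_add_one (hsY hf)
          have h3 : S = Y.erase f := Finset.eq_of_subset_of_card_le (by grind)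
            (by have := hK.card_eq Y hY; omega)
          exact ⟨Y, hY, by grind, Or.inr ⟨hsY, by rw [h3]⟩⟩
      intro X hX Y hY W hW hSX hSY hSW
      obtain ⟨X', hX', hSX', hX2⟩ := key X hX hSX
      obtain ⟨Y', hY', hSY', hY2⟩ := key Y hY hSY
      obtain ⟨W', hW', hSW', hW2⟩ := key W hW hSW
      rcases hK.eq_or_eq S hS X' hX' Y' hY' W' hW' hSX' hSY' hSW' with h | h | h <;> grind

theorem flip_exists_ne (hK : IsPseudomanifold d K) {R : Finset ℕ} {x y : ℕ}
    (h : CanFlip R x y K) : ∀ X ∈ FacetComplex.flip R x y K, ∀ s ∈ X,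
      ∃ Y ∈ FacetComplex.flip R x y K, Y ≠ X ∧ X.erase s ⊆ Y := by
  have hxy := h.ne
  have hxR := h.left_notMem
  have hyR := h.right_notMem
  have hnot : ∀ X ∈ K, x ∈ X → y ∉ X := fun X hX h1 h2 => h.not_adj ⟨X, hX, h1, h2⟩
  have hnew : ∀ r ∈ R, insert x (insert y (R.erase r)) ∈ FacetComplex.flip R x y K :=
    fun r hr => mem_flip.2 (Or.inr ⟨r, hr, rfl⟩)
  intro X hX s hs
  rcases mem_flip.1 hX with ⟨hXK, hX1, hX2⟩ | ⟨r, hr, rfl⟩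
  · obtain ⟨Y, hY, hne, hsub⟩ := hK.exists_ne X hXK s hs
    by_cases hY' : Y = insert x R ∨ Y = insert y R
    · have hcX := hK.card_eq X hXK
      have hcs := Finset.card_erase_add_one hs
      obtain ⟨a, ha, hYa⟩ := eq_insert_of_subset hsub (by rw [hK.card_eq Y hY]; omega)
      have haR : a ∈ R := by
        by_contra haR
        have : R ⊆ X := by
          intro b hb
          have hb' : b ∈ Y := by rcases hY' with rfl | rfl <;> simp [hb]
          rw [hYa, Finset.mem_insert] at hb'
          rcases hb' with rfl | hb'
          · exact absurd hb haR
          · exact Finset.mem_of_mem_erase hb'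
        rcases hK.eq_or_eq_of_insert hxR hxy h.left_mem h.right_mem hXK this <;> contradiction
      refine ⟨_, hnew a haR, ?_, ?_⟩
      · intro hc
        exact hnot X hXK (hc ▸ by simp) (hc ▸ by simp)
      · clear hnew hnot hK h hX
        rcases hY' with rfl | rfl <;> grind
    · exact ⟨Y, mem_flip.2 (Or.inl ⟨hY, fun h => hY' (Or.inl h), fun h => hY' (Or.inr h)⟩),
        hne, hsub⟩
  · by_cases hsy : s = y
    · subst hsy
      obtain ⟨Y, hY, hne, hsub⟩ := hK.exists_ne _ h.left_mem r (by simp [hr])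
      have hxY : x ∈ Y := hsub (by clear hnew hnot hK h; grind)
      have hsY := hnot Y hY hxY
      clear hnew hnot hK h
      refine ⟨Y, mem_flip.2 (Or.inl ⟨hY, hne, ?_⟩), ?_, ?_⟩
      · rintro rfl; simp at hsY
      · rintro rfl; simp at hsY
      · intro b hb
        apply hsub
        grind
    by_cases hsx : s = x
    · subst hsx
      obtain ⟨Y, hY, hne, hsub⟩ := hK.exists_ne _ h.right_mem r (by simp [hr])
      have hyY : y ∈ Y := hsub (by clear hnew hnot hK h; grind)
      have hsY : s ∉ Y := fun h => hnot Y hY h hyY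
      clear hnew hnot hK h
      refine ⟨Y, mem_flip.2 (Or.inl ⟨hY, ?_, hne⟩), ?_, ?_⟩
      · rintro rfl; simp at hsY
      · rintro rfl; simp at hsY
      · intro b hb
        apply hsub
        grind
    · have hsR : s ∈ R ∧ s ≠ r := by clear hnew hnot hK h; grind
      refine ⟨_, hnew s hsR.1, ?_, ?_⟩
      · intro hc
        have : s ∈ insert x (insert y (R.erase s)) := hc ▸ hs
        clear hnew hnot hK h
        grind
      · clear hnew hnot hK h
        intro b hb
        grind

theorem flip_eq_or_eq (hK : IsPseudomanifold d K) {R : Finset ℕ} {x y : ℕ}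
    (h : CanFlip R x y K) (S : Finset ℕ) (hS : S.card + 1 = d) :
    ∀ X ∈ FacetComplex.flip R x y K, ∀ Y ∈ FacetComplex.flip R x y K,
      ∀ W ∈ FacetComplex.flip R x y K, S ⊆ X → S ⊆ Y → S ⊆ W → X = Y ∨ X = W ∨ Y = W := by
  have hxy := h.ne
  have hxR := h.left_notMem
  have hyR := h.right_notMem
  have hnot : ∀ X ∈ K, x ∈ X → y ∉ X := fun X hX h1 h2 => h.not_adj ⟨X, hX, h1, h2⟩
  have hcR : R.card + 1 = d := by
    rw [← hK.card_eq _ h.left_mem, Finset.card_insert_of_notMem hxR]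
  intro X hX Y hY W hW hSX hSY hSW
  by_cases hxyS : x ∈ S ∧ y ∈ S
  · have key : ∀ X ∈ FacetComplex.flip R x y K, S ⊆ X →
        ∃ r ∈ R, r ∉ S ∧ (S.erase x).erase y ⊆ R ∧ insert x (insert y (R.erase r)) = X := by
      intro X hX hSX
      rcases mem_flip.1 hX with ⟨hXK, -⟩ | ⟨r, hr, rfl⟩
      · exact absurd (hSX hxyS.2) (hnot X hXK (hSX hxyS.1))
      · clear hnot hK h hX hY hW hSY hSW hcR hS
        refine ⟨r, hr, fun hrS => ?_, fun b hb => ?_, rfl⟩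
        · have := hSX hrS
          grind
        · have := @hSX b
          grind
    obtain ⟨f, hf, hfS, hsub, rfl⟩ := key X hX hSX
    obtain ⟨g, hg, hgS, -, rfl⟩ := key Y hY hSY
    obtain ⟨e, he, heS, -, rfl⟩ := key W hW hSW
    by_contra! hcon
    have hfg : f ≠ g := by rintro rfl; simp at hcon
    have hfe : f ≠ e := by rintro rfl; simp at hcon
    have hge : g ≠ e := by rintro rfl; simp at hcon
    have h3 := Finset.card_erase_add_one hxyS.1
    have h4 := Finset.card_erase_add_one (s := S.erase x) (a := y) (by simp [hxyS.2, hxy.symm])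
    clear hnot hK h key hcon hSX hSY hSW hX hY hW
    have h1 : insert f (insert g (insert e ((S.erase x).erase y))) ⊆ R := by
      intro b hb
      have := @hsub b
      simp only [Finset.mem_insert] at hb
      rcases hb with rfl | rfl | rfl | hb <;> tauto
    have h2 := Finset.card_le_card h1
    rw [Finset.card_insert_of_notMem (by simp [hfS, hfg, hfe]),
      Finset.card_insert_of_notMem (by simp [hgS, hge]),
      Finset.card_insert_of_notMem (by simp [heS])] at h2
    omega
  · have key : ∀ X ∈ FacetComplex.flip R x y K, S ⊆ X → ∃ Y ∈ K, S ⊆ Y ∧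
        ((X = Y ∧ Y ≠ insert x R ∧ Y ≠ insert y R) ∨
         (Y = insert x R ∧ X = insert y S) ∨ (Y = insert y R ∧ X = insert x S)) := by
      intro X hX hSX
      rcases mem_flip.1 hX with ⟨hXK, h1, h2⟩ | ⟨r, hr, rfl⟩
      · exact ⟨X, hXK, hSX, Or.inl ⟨rfl, h1, h2⟩⟩
      · have hc := Finset.card_erase_add_one hr
        have hxm := h.left_mem
        have hym := h.right_mem
        clear hnot hK h hX hY hW hSY hSW
        by_cases hyS : y ∈ S
        · have hS' : S = insert y (R.erase r) := Finset.eq_of_subset_of_card_le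
            (by intro b hb; have := hSX hb; grind)
            (by rw [Finset.card_insert_of_notMem (by simp [hyR])]; omega)
          refine ⟨_, hym, ?_, Or.inr (Or.inr ⟨rfl, by rw [hS']⟩)⟩
          rw [hS']; exact Finset.insert_subset_insert _ (Finset.erase_subset _ _)
        · have hS' : S = insert x (R.erase r) := Finset.eq_of_subset_of_card_le
            (by intro b hb; have := hSX hb; grind)
            (by rw [Finset.card_insert_of_notMem (by simp [hxR])]; omega)
          refine ⟨_, hxm, ?_, Or.inr (Or.inl ⟨rfl, ?_⟩)⟩
          · rw [hS']; exact Finset.insert_subset_insert _ (Finset.erase_subset _ _)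
          · rw [hS', Finset.insert_comm]
    obtain ⟨X', hX', hSX', hX2⟩ := key X hX hSX
    obtain ⟨Y', hY', hSY', hY2⟩ := key Y hY hSY
    obtain ⟨W', hW', hSW', hW2⟩ := key W hW hSW
    have hins : insert x R ≠ insert y R := by
      intro hc
      have : x ∈ insert y R := hc ▸ Finset.mem_insert_self _ _
      simp [hxy, hxR] at this
    have h3 := hK.eq_or_eq S hS X' hX' Y' hY' W' hW' hSX' hSY' hSW'
    have hS1 : S ⊆ insert x R → S ⊆ insert y R → S = R := fun h1 h2 =>
      Finset.eq_of_subset_of_card_le (by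
        intro b hb
        have h3 := h1 hb
        have h4 := h2 hb
        simp only [Finset.mem_insert] at h3 h4
        rcases h3 with rfl | h3
        · exact h4.resolve_left hxy
        · exact h3) (by omega)
    generalize insert x R = A at *
    generalize insert y R = B at *
    generalize insert x S = C at *
    generalize insert y S = D at *
    clear hS1 key hxyS hnot hcR hxR hyR hS hSX hSY hSW hSX' hSY' hSW' hX hY hW hX' hY' hW'
    clear h hK
    grind

theorem flip (hK : IsPseudomanifold d K) (hd : 2 ≤ d) {R : Finset ℕ} {x y : ℕ}
    (h : CanFlip R x y K) : IsPseudomanifold d (flip R x y K) := by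
  have hxy := h.ne
  have hxR := h.left_notMem
  have hyR := h.right_notMem
  have hcR : R.card + 1 = d := by
    rw [← hK.card_eq _ h.left_mem, Finset.card_insert_of_notMem hxR]
  refine ⟨?_, ?_, hK.flip_exists_ne h, hK.flip_eq_or_eq h⟩
  · obtain ⟨r, hr⟩ : R.Nonempty := Finset.card_pos.1 (by omega)
    exact ⟨_, mem_flip.2 (Or.inr ⟨r, hr, rfl⟩)⟩
  · intro X hX
    rcases mem_flip.1 hX with ⟨h, _⟩ | ⟨r, hr, rfl⟩
    · exact hK.card_eq X h
    · have := Finset.card_erase_add_one hr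
      rw [Finset.card_insert_of_notMem (by simp [hxR, hxy]),
        Finset.card_insert_of_notMem (by simp [hyR])]
      omega

end IsPseudomanifold

/-- If `R` lies in exactly two facets, then subdividing `R` in `K` and subdividing the new edge
in the flip of `K` give the same complex. -/
theorem stellar_flip {d : ℕ} {K : Finset (Finset ℕ)} (hK : IsPseudomanifold d K)
    {R : Finset ℕ} {x y : ℕ} (h : CanFlip R x y K) (u : ℕ) :
    stellar {x, y} u (flip R x y K) = stellar R u K := by
  have hxy := h.ne
  have hxR := h.left_notMem
  have hyR := h.right_notMem
  have hstar : ∀ X ∈ K, R ⊆ X → X = insert x R ∨ X = insert y R := fun X hX hR =>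
    hK.eq_or_eq_of_insert hxR hxy h.left_mem h.right_mem hX hR
  have hnot : ∀ X ∈ K, x ∈ X → y ∉ X := fun X hX h1 h2 => h.not_adj ⟨X, hX, h1, h2⟩
  ext X
  simp only [mem_stellar, mem_flip]
  constructor
  · rintro (⟨⟨hX, h1, h2⟩ | ⟨r, hr, rfl⟩, h3⟩ | ⟨Y, ⟨hY, -⟩ | ⟨r, hr, rfl⟩, hs, f, hf, rfl⟩)
    · exact Or.inl ⟨hX, fun hc => by rcases hstar X hX hc <;> contradiction⟩
    · exact absurd (by grind) h3
    · exact absurd (hs (by simp)) (hnot Y hY (hs (by simp)))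
    · right
      rcases (by simpa using hf : f = x ∨ f = y) with rfl | rfl
      · exact ⟨_, h.right_mem, by simp, r, hr, by grind⟩
      · exact ⟨_, h.left_mem, by simp, r, hr, by grind⟩
  · rintro (⟨hX, h1⟩ | ⟨Y, hY, hs, f, hf, rfl⟩)
    · refine Or.inl ⟨Or.inl ⟨hX, by grind, by grind⟩, ?_⟩
      intro hc
      exact hnot X hX (hc (by simp)) (hc (by simp))
    · right
      rcases hstar Y hY hs with rfl | rfl
      · exact ⟨_, Or.inr ⟨f, hf, rfl⟩, by grind, y, by simp, by grind⟩
      · exact ⟨_, Or.inr ⟨f, hf, rfl⟩, by grind, x, by simp, by grind⟩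

end FacetComplex

namespace FacetComplex

/-- The geometric realization of the complex with facets `K`, in barycentric coordinates. -/
def geometric (K : Finset (Finset ℕ)) : Set (ℕ → ℝ) :=
  {p | (∀ v, 0 ≤ p v) ∧ ∃ X ∈ K, (∀ v, v ∉ X → p v = 0) ∧ ∑ v ∈ X, p v = 1}

/-- The complexes `K` and `L` have homeomorphic realizations. -/
def Homeomorphic (K L : Finset (Finset ℕ)) : Prop := Nonempty (geometric K ≃ₜ geometric L)

theorem Homeomorphic.refl (K : Finset (Finset ℕ)) : Homeomorphic K K := ⟨Homeomorph.refl _⟩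

theorem Homeomorphic.symm {K L : Finset (Finset ℕ)} (h : Homeomorphic K L) : Homeomorphic L K :=
  ⟨h.some.symm⟩

theorem Homeomorphic.trans {K L M : Finset (Finset ℕ)} (h : Homeomorphic K L)
    (h' : Homeomorphic L M) : Homeomorphic K M := ⟨h.some.trans h'.some⟩

/-- The map from the realization of a complex to that of its stellar subdivision. -/
noncomputable def subdivide (σ : Finset ℕ) (hσ : σ.Nonempty) (u : ℕ) (p : ℕ → ℝ) (v : ℕ) : ℝ :=
  p v - (if v ∈ σ then σ.inf' hσ p else 0) + (if v = u then σ.card * σ.inf' hσ p else 0)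

/-- The map from the realization of a stellar subdivision to that of the original complex. -/
noncomputable def unsubdivide (σ : Finset ℕ) (u : ℕ) (q : ℕ → ℝ) (v : ℕ) : ℝ :=
  (if v = u then 0 else q v) + (if v ∈ σ then q u / σ.card else 0)

theorem continuous_subdivide (σ : Finset ℕ) (hσ : σ.Nonempty) (u : ℕ) :
    Continuous (subdivide σ hσ u) := by
  have h : Continuous fun p : ℕ → ℝ => σ.inf' hσ p :=
    Continuous.finset_inf'_apply hσ fun i _ => continuous_apply i
  refine continuous_pi fun v => ?_
  unfold subdivide
  refine ((continuous_apply v).sub ?_).add ?_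
  · split_ifs
    · exact h
    · exact continuous_const
  · split_ifs
    · exact continuous_const.mul h
    · exact continuous_const

theorem continuous_unsubdivide (σ : Finset ℕ) (u : ℕ) : Continuous (unsubdivide σ u) := by
  refine continuous_pi fun v => ?_
  unfold unsubdivide
  refine Continuous.add ?_ ?_
  · split_ifs
    · exact continuous_const
    · exact continuous_apply v
  · split_ifs
    · exact (continuous_apply u).div_const _
    · exact continuous_const

variable {K : Finset (Finset ℕ)} {σ : Finset ℕ} {u : ℕ}

theorem subdivide_mem (hσ : σ.Nonempty) (hu : ¬ Adj K u u) {p : ℕ → ℝ} (hp : p ∈ geometric K) :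
    subdivide σ hσ u p ∈ geometric (stellar σ u K) := by
  obtain ⟨h0, X, hX, hs, hsum⟩ := hp
  have huX := not_mem_of_not_adj hu hX
  obtain ⟨f, hf, hfm⟩ := Finset.exists_mem_eq_inf' hσ p
  have hm0 : 0 ≤ σ.inf' hσ p := hfm ▸ h0 f
  refine ⟨fun v => ?_, ?_⟩
  · unfold subdivide
    have h1 : v ∈ σ → σ.inf' hσ p ≤ p v := fun h => Finset.inf'_le p h
    have h2 := h0 v
    have h3 : 0 ≤ σ.card * σ.inf' hσ p := by positivity
    split_ifs with h4 h5 h5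
    · have := h1 h4; linarith
    · have := h1 h4; linarith
    · linarith
    · linarith
  · by_cases hσX : σ ⊆ X
    · refine ⟨_, mem_stellar.2 (Or.inr ⟨X, hX, hσX, f, hf, rfl⟩), fun v hv => ?_, ?_⟩
      · simp only [Finset.mem_insert, Finset.mem_erase, not_or, not_and] at hv
        by_cases hvf : v = f
        · subst hvf
          simp [subdivide, hf, hv.1, hfm]
        · have hvX := hv.2 hvf
          have hvσ : v ∉ σ := fun h => hvX (hσX h)
          simp [subdivide, hv.1, hs v hvX, hvσ]
      · have hfX := hσX hf
        have huσ : u ∉ σ := fun h => huX (hσX h)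
        rw [Finset.sum_insert (by simp [huX])]
        have e1 : subdivide σ hσ u p f = 0 := by
          have : f ≠ u := by rintro rfl; exact huX hfX
          simp [subdivide, hf, this, hfm]
        have e2 : ∑ v ∈ X.erase f, subdivide σ hσ u p v = ∑ v ∈ X, subdivide σ hσ u p v := by
          rw [← Finset.add_sum_erase X _ hfX, e1, zero_add]
        have e3 : ∑ v ∈ X, subdivide σ hσ u p v
            = ∑ v ∈ X, (p v - if v ∈ σ then σ.inf' hσ p else 0) := by
          refine Finset.sum_congr rfl fun v hv => ?_
          have : v ≠ u := by rintro rfl; exact huX hv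
          simp [subdivide, this]
        rw [e2, e3, Finset.sum_sub_distrib, hsum, Finset.sum_ite_mem,
          Finset.inter_eq_right.2 hσX]
        simp [subdivide, huσ, hs u huX]
    · have hm : σ.inf' hσ p = 0 := by
        obtain ⟨g, hg, hgX⟩ := Finset.not_subset.1 hσX
        exact le_antisymm ((Finset.inf'_le p hg).trans (hs g hgX).le) hm0
      have : subdivide σ hσ u p = p := by
        funext v
        simp [subdivide, hm]
      rw [this]
      exact ⟨X, mem_stellar.2 (Or.inl ⟨hX, hσX⟩), hs, hsum⟩

theorem unsubdivide_subdivide (hσ : σ.Nonempty) (hu : ¬ Adj K u u) (huσ : u ∉ σ) {p : ℕ → ℝ}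
    (hp : p ∈ geometric K) : unsubdivide σ u (subdivide σ hσ u p) = p := by
  obtain ⟨h0, X, hX, hs, hsum⟩ := hp
  have huX := not_mem_of_not_adj hu hX
  have hc : (σ.card : ℝ) ≠ 0 := by exact_mod_cast hσ.card_ne_zero
  funext v
  have h1 : subdivide σ hσ u p u = σ.card * σ.inf' hσ p := by
    simp [subdivide, huσ, hs u huX]
  by_cases hv : v = u
  · subst hv
    simp [unsubdivide, huσ, hs v huX]
  · by_cases hvσ : v ∈ σ
    · simp only [unsubdivide, h1, hv, hvσ, if_true, if_false]
      simp only [subdivide, hvσ, hv, if_true, if_false]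
      field_simp
      ring
    · simp [unsubdivide, subdivide, hv, hvσ]

theorem unsubdivide_mem (hσ : σ.Nonempty) (hu : ¬ Adj K u u) (huσ : u ∉ σ) {q : ℕ → ℝ}
    (hq : q ∈ geometric (stellar σ u K)) : unsubdivide σ u q ∈ geometric K ∧
      σ.inf' hσ (unsubdivide σ u q) = q u / σ.card := by
  have hc : (σ.card : ℝ) ≠ 0 := by exact_mod_cast hσ.card_ne_zero
  obtain ⟨h0, X, hX, hs, hsum⟩ := hq
  have hd0 : 0 ≤ q u / σ.card := div_nonneg (h0 u) (Nat.cast_nonneg _)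
  have h0' : ∀ v, 0 ≤ unsubdivide σ u q v := by
    intro v
    unfold unsubdivide
    have := h0 v
    split_ifs <;> linarith
  have key : (∃ f ∈ σ, q f = 0) → σ.inf' hσ (unsubdivide σ u q) = q u / σ.card := by
    rintro ⟨f, hf, hqf⟩
    have hne : ∀ g ∈ σ, g ≠ u := by rintro g hg rfl; exact huσ hg
    apply le_antisymm
    · refine (Finset.inf'_le _ hf).trans ?_
      simp [unsubdivide, hf, hne f hf, hqf]
    · refine Finset.le_inf' _ _ fun g hg => ?_
      have := h0 g
      simp [unsubdivide, hg, hne g hg, this]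
  rcases mem_stellar.1 hX with ⟨hXK, hσX⟩ | ⟨Y, hY, hsY, f, hf, rfl⟩
  · have huX := not_mem_of_not_adj hu hXK
    have hqu := hs u huX
    have : unsubdivide σ u q = q := by
      funext v
      by_cases hv : v = u
      · subst hv; simp [unsubdivide, hqu]
      · simp [unsubdivide, hqu, hv]
    obtain ⟨g, hg, hgX⟩ := Finset.not_subset.1 hσX
    refine ⟨?_, key ⟨g, hg, hs g hgX⟩⟩
    rw [this]
    exact ⟨h0, X, hXK, hs, hsum⟩
  · have huY := not_mem_of_not_adj hu hY
    have hfY := hsY hf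
    have hfu : f ≠ u := by rintro rfl; exact huY hfY
    have hqf : q f = 0 := hs f (by simp [hfu])
    refine ⟨⟨h0', Y, hY, fun v hv => ?_, ?_⟩, key ⟨f, hf, hqf⟩⟩
    · have hvσ : v ∉ σ := fun h => hv (hsY h)
      by_cases hvu : v = u
      · simp [unsubdivide, hvu, huσ]
      · simp [unsubdivide, hvu, hvσ, hs v (by simp [hvu, hv])]
    · have e1 : ∑ v ∈ Y, unsubdivide σ u q v
          = ∑ v ∈ Y, (q v + if v ∈ σ then q u / σ.card else 0) := by
        refine Finset.sum_congr rfl fun v hv => ?_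
        have : v ≠ u := by rintro rfl; exact huY hv
        simp [unsubdivide, this]
      rw [Finset.sum_insert (by simp [huY])] at hsum
      rw [e1, Finset.sum_add_distrib, Finset.sum_ite_mem, Finset.inter_eq_right.2 hsY,
        ← Finset.add_sum_erase Y _ hfY, hqf, Finset.sum_const, nsmul_eq_mul]
      field_simp
      linarith

theorem subdivide_unsubdivide (hσ : σ.Nonempty) (hu : ¬ Adj K u u) (huσ : u ∉ σ) {q : ℕ → ℝ}
    (hq : q ∈ geometric (stellar σ u K)) : subdivide σ hσ u (unsubdivide σ u q) = q := by
  have hm := (unsubdivide_mem hσ hu huσ hq).2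
  have hc : (σ.card : ℝ) ≠ 0 := by exact_mod_cast hσ.card_ne_zero
  funext v
  simp only [subdivide, hm]
  by_cases hv : v = u
  · subst hv
    simp [unsubdivide, huσ]
    field_simp
  · by_cases hvσ : v ∈ σ <;> simp [unsubdivide, hv, hvσ]

theorem homeomorphic_stellar (hσ : σ.Nonempty) (hu : ¬ Adj K u u) (huσ : u ∉ σ) :
    Homeomorphic K (stellar σ u K) :=
  ⟨{ toFun := fun p => ⟨subdivide σ hσ u p, subdivide_mem hσ hu p.2⟩
     invFun := fun q => ⟨unsubdivide σ u q, (unsubdivide_mem hσ hu huσ q.2).1⟩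
     left_inv := fun p => Subtype.ext (unsubdivide_subdivide hσ hu huσ p.2)
     right_inv := fun q => Subtype.ext (subdivide_unsubdivide hσ hu huσ q.2)
     continuous_toFun := ((continuous_subdivide σ hσ u).comp continuous_subtype_val).subtype_mk _
     continuous_invFun := ((continuous_unsubdivide σ u).comp continuous_subtype_val).subtype_mk _ }⟩

theorem adj_flip_self {R : Finset ℕ} {x y : ℕ} (h : CanFlip R x y K) {v : ℕ}
    (hv : Adj (flip R x y K) v v) : Adj K v v := by
  obtain ⟨X, hX, hvX, -⟩ := hv
  rcases mem_flip.1 hX with ⟨hXK, -⟩ | ⟨r, hr, rfl⟩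
  · exact ⟨X, hXK, hvX, hvX⟩
  · simp only [Finset.mem_insert, Finset.mem_erase] at hvX
    rcases hvX with rfl | rfl | hvX
    · exact ⟨_, h.left_mem, by simp, by simp⟩
    · exact ⟨_, h.right_mem, by simp, by simp⟩
    · exact ⟨_, h.left_mem, by simp [hvX], by simp [hvX]⟩

theorem homeomorphic_flip {d : ℕ} (hd : 2 ≤ d) (hK : IsPseudomanifold d K) {R : Finset ℕ}
    {x y : ℕ} (h : CanFlip R x y K) : Homeomorphic K (flip R x y K) := by
  obtain ⟨u, hu⟩ := exists_not_adj_self K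
  have hcR : R.card + 1 = d := by
    rw [← hK.card_eq _ h.left_mem, Finset.card_insert_of_notMem h.left_notMem]
  have hux := not_mem_of_not_adj hu h.left_mem
  have huy := not_mem_of_not_adj hu h.right_mem
  simp only [Finset.mem_insert, not_or] at hux huy
  have h1 := homeomorphic_stellar (σ := R) (Finset.card_pos.1 (by omega)) hu hux.2
  have h2 := homeomorphic_stellar (σ := {x, y}) (u := u) (K := flip R x y K) (by simp)
    (fun hc => hu (adj_flip_self h hc)) (by simp [hux.1, huy.1])
  rw [stellar_flip hK h] at h2
  exact h1.trans h2.symm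

end FacetComplex

namespace FacetComplex

variable {d : ℕ} {K : Finset (Finset ℕ)}

theorem exists_mem_avoiding {A : Finset ℕ} (h : 3 ≤ A.card) (p q : ℕ) : ∃ r ∈ A, r ≠ p ∧ r ≠ q := by
  by_contra! hc
  have : A ⊆ {p, q} := fun r hr => by
    have := hc r hr
    simp only [Finset.mem_insert, Finset.mem_singleton]
    tauto
  have := (Finset.card_le_card this).trans (Finset.card_le_two)
  omega

theorem card_add_one_of_insert (hK : IsPseudomanifold d K) {R : Finset ℕ} {x : ℕ} (hx : x ∉ R)
    (h : insert x R ∈ K) : R.card + 1 = d := by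
  rw [← hK.card_eq _ h, Finset.card_insert_of_notMem hx]

theorem IsPseudomanifold.eq_of_subset (hK : IsPseudomanifold d K) {X Y : Finset ℕ} (hX : X ∈ K)
    (hY : Y ∈ K) (h : X ⊆ Y) : X = Y :=
  Finset.eq_of_subset_of_card_le h (by rw [hK.card_eq _ hX, hK.card_eq _ hY])

theorem adj_flip (hd : 4 ≤ d) (hK : IsPseudomanifold d K) {R : Finset ℕ} {x y : ℕ}
    (h : CanFlip R x y K) {p q : ℕ} :
    Adj (flip R x y K) p q ↔ Adj K p q ∨ (p = x ∧ q = y) ∨ (p = y ∧ q = x) := by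
  have hcR := card_add_one_of_insert hK h.left_notMem h.left_mem
  constructor
  · rintro ⟨X, hX, hp, hq⟩
    rcases mem_flip.1 hX with ⟨hXK, -⟩ | ⟨r, hr, rfl⟩
    · exact Or.inl ⟨X, hXK, hp, hq⟩
    · have h1 : ∀ z, z = x ∨ z = y → ∀ v, v = z ∨ v ∈ R.erase r → v ∈ insert z R := by
        intro z _ v hv
        rcases hv with rfl | hv
        · simp
        · simp [Finset.mem_of_mem_erase hv]
      simp only [Finset.mem_insert] at hp hq
      by_cases hpq : (p = x ∧ q = y) ∨ (p = y ∧ q = x)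
      · exact Or.inr hpq
      · left
        by_cases hy : p = y ∨ q = y
        · exact ⟨_, h.right_mem, h1 y (Or.inr rfl) p (by tauto), h1 y (Or.inr rfl) q (by tauto)⟩
        · exact ⟨_, h.left_mem, h1 x (Or.inl rfl) p (by tauto), h1 x (Or.inl rfl) q (by tauto)⟩
  · have hnew : ∀ r ∈ R, insert x (insert y (R.erase r)) ∈ flip R x y K :=
      fun r hr => mem_flip.2 (Or.inr ⟨r, hr, rfl⟩)
    obtain ⟨r, hr, hrp, hrq⟩ := exists_mem_avoiding (A := R) (by omega) p q
    rintro (⟨X, hX, hp, hq⟩ | ⟨rfl, rfl⟩ | ⟨rfl, rfl⟩)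
    · by_cases hc : X = insert x R ∨ X = insert y R
      · refine ⟨_, hnew r hr, ?_, ?_⟩
        · rcases hc with rfl | rfl <;>
          · simp only [Finset.mem_insert, Finset.mem_erase] at hp ⊢
            tauto
        · rcases hc with rfl | rfl <;>
          · simp only [Finset.mem_insert, Finset.mem_erase] at hq ⊢
            tauto
      · exact ⟨X, mem_flip.2 (Or.inl ⟨hX, by tauto, by tauto⟩), hp, hq⟩
    · exact ⟨_, hnew r hr, by simp, by simp⟩
    · exact ⟨_, hnew r hr, by simp, by simp⟩

theorem adj_stellar_of_mem (hd : 3 ≤ d) (hK : IsPseudomanifold d K) {X₀ : Finset ℕ} {u : ℕ}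
    (hX₀ : X₀ ∈ K) {p q : ℕ} :
    Adj (stellar X₀ u K) p q ↔
      Adj K p q ∨ (p = u ∧ q ∈ insert u X₀) ∨ (q = u ∧ p ∈ insert u X₀) := by
  have hc := hK.card_eq _ hX₀
  constructor
  · rintro ⟨X, hX, hp, hq⟩
    rcases mem_stellar.1 hX with ⟨hXK, -⟩ | ⟨Y, hY, hs, f, hf, rfl⟩
    · exact Or.inl ⟨X, hXK, hp, hq⟩
    · obtain rfl := hK.eq_of_subset hX₀ hY hs
      have : ∀ v, v ∈ insert u (X₀.erase f) → v = u ∨ v ∈ X₀ := fun v hv => by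
        simp only [Finset.mem_insert, Finset.mem_erase] at hv; tauto
      have hp := this p hp
      have hq := this q hq
      by_cases hpq : p ∈ X₀ ∧ q ∈ X₀
      · exact Or.inl ⟨X₀, hX₀, hpq⟩
      · simp only [Finset.mem_insert]
        tauto
  · have hnew : ∀ f ∈ X₀, insert u (X₀.erase f) ∈ stellar X₀ u K :=
      fun f hf => mem_stellar.2 (Or.inr ⟨X₀, hX₀, subset_rfl, f, hf, rfl⟩)
    obtain ⟨r, hr, hrp, hrq⟩ := exists_mem_avoiding (A := X₀) (by omega) p q
    rintro (⟨X, hX, hp, hq⟩ | ⟨rfl, hq⟩ | ⟨rfl, hp⟩)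
    · by_cases hs : X₀ ⊆ X
      · obtain rfl := hK.eq_of_subset hX₀ hX hs
        refine ⟨_, hnew r hr, ?_, ?_⟩ <;>
        · simp only [Finset.mem_insert, Finset.mem_erase]; tauto
      · exact ⟨X, mem_stellar.2 (Or.inl ⟨hX, hs⟩), hp, hq⟩
    · refine ⟨_, hnew r hr, by simp, ?_⟩
      simp only [Finset.mem_insert, Finset.mem_erase] at hq ⊢; tauto
    · refine ⟨_, hnew r hr, ?_, by simp⟩
      simp only [Finset.mem_insert, Finset.mem_erase] at hp ⊢; tauto

/-! ### Strong connectivity -/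

/-- Two facets that coincide or share a ridge. -/
def Neighbors (d : ℕ) (X Y : Finset ℕ) : Prop := ∃ S, S ⊆ X ∧ S ⊆ Y ∧ d ≤ S.card + 1

theorem Neighbors.symm {X Y : Finset ℕ} (h : Neighbors d X Y) : Neighbors d Y X := by
  obtain ⟨S, h1, h2, h3⟩ := h
  exact ⟨S, h2, h1, h3⟩

/-- A path of neighboring facets in the family `G`. -/
def Linked (d : ℕ) (G : Finset (Finset ℕ)) : Finset ℕ → Finset ℕ → Prop :=
  Relation.ReflTransGen fun X Y => X ∈ G ∧ Y ∈ G ∧ Neighbors d X Y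

theorem Linked.symm {G : Finset (Finset ℕ)} {X Y : Finset ℕ} (h : Linked d G X Y) :
    Linked d G Y X :=
  have : Std.Symm fun X Y => X ∈ G ∧ Y ∈ G ∧ Neighbors d X Y :=
    ⟨fun _ _ h => ⟨h.2.1, h.1, h.2.2.symm⟩⟩
  Relation.ReflTransGen.stdSymm.symm _ _ h

theorem Linked.trans {G : Finset (Finset ℕ)} {X Y W : Finset ℕ} (h : Linked d G X Y)
    (h' : Linked d G Y W) : Linked d G X W := Relation.ReflTransGen.trans h h'

theorem Neighbors.linked {G : Finset (Finset ℕ)} {X Y : Finset ℕ} (h : Neighbors d X Y)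
    (hX : X ∈ G) (hY : Y ∈ G) : Linked d G X Y := Relation.ReflTransGen.single ⟨hX, hY, h⟩

/-- Any two facets in the family are joined by a path of neighboring facets. -/
def StronglyConnected (d : ℕ) (G : Finset (Finset ℕ)) : Prop :=
  ∀ X ∈ G, ∀ Y ∈ G, Linked d G X Y

/-- Strong connectivity survives if the part `A` of a family is replaced by `A'`. -/
theorem StronglyConnected.replace {G G' : Finset (Finset ℕ)} {A A' : Set (Finset ℕ)}
    (h : StronglyConnected d G) {a α : Finset ℕ} (ha : a ∈ G) (haA : a ∈ A)
    (hsub : ∀ X ∈ G', X ∈ A' ∨ (X ∈ G ∧ X ∉ A)) (hA' : ∀ X ∈ A', X ∈ G')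
    (hold : ∀ X ∈ G, X ∉ A → X ∈ G') (hint : ∀ β ∈ A', Linked d G' α β)
    (hnb : ∀ X ∈ G, X ∉ A → ∀ Y ∈ G, Y ∈ A → Neighbors d X Y → ∃ β ∈ A', Neighbors d X β) :
    StronglyConnected d G' := by
  have key : ∀ X, Linked d G X a → X ∈ G → X ∉ A → Linked d G' X α := by
    intro X hX
    induction hX using Relation.ReflTransGen.head_induction_on with
    | refl => intro _ h; exact absurd haA h
    | @head X Y hXY _ ih =>
      intro hXG hXA
      by_cases hYA : Y ∈ A
      · obtain ⟨β, hβ, hn⟩ := hnb X hXG hXA Y hXY.2.1 hYA hXY.2.2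
        exact (hn.linked (hold X hXG hXA) (hA' β hβ)).trans (hint β hβ).symm
      · exact (hXY.2.2.linked (hold X hXG hXA) (hold Y hXY.2.1 hYA)).trans (ih hXY.2.1 hYA)
  have all : ∀ X ∈ G', Linked d G' X α := by
    intro X hX
    rcases hsub X hX with h1 | ⟨h1, h2⟩
    · exact (hint X h1).symm
    · exact key X (h X h1 a ha) h1 h2
  exact fun X hX Y hY => (all X hX).trans (all Y hY).symm

/-- The facets of `K` that contain `Z`. -/
def facetsAbove (Z : Finset ℕ) (K : Finset (Finset ℕ)) : Finset (Finset ℕ) :=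
  K.filter (Z ⊆ ·)

theorem mem_facetsAbove {Z X : Finset ℕ} : X ∈ facetsAbove Z K ↔ X ∈ K ∧ Z ⊆ X := by
  simp [facetsAbove]

theorem exists_eq_insert_of_neighbors (hK : IsPseudomanifold d K) {X Y : Finset ℕ} (hX : X ∈ K)
    (hY : Y ∈ K) (hne : X ≠ Y) (h : Neighbors d X Y) :
    ∃ g S, g ∉ S ∧ S ⊆ X ∧ Y = insert g S ∧ g ∉ X := by
  obtain ⟨S, hSX, hSY, hc⟩ := h
  have hcY := hK.card_eq _ hY
  by_cases hc' : d ≤ S.card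
  · have := Finset.eq_of_subset_of_card_le hSY (by omega)
    subst this
    exact absurd (hK.eq_of_subset hY hX hSX).symm hne
  · obtain ⟨g, hg, rfl⟩ := eq_insert_of_subset hSY (by omega)
    refine ⟨g, S, hg, hSX, rfl, fun hgX => hne ?_⟩
    exact (hK.eq_of_subset hY hX (Finset.insert_subset hgX hSX)).symm

theorem stronglyConnected_stellar (hK : IsPseudomanifold d K) {σ Z : Finset ℕ} {u : ℕ}
    (hu : ¬ Adj K u u) (hZσ : Z ⊆ σ) (hcσ : d ≤ σ.card + 1) (hc : Z.card < σ.card)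
    (hσK : ∃ X ∈ K, σ ⊆ X) (h : StronglyConnected d (facetsAbove Z K)) :
    StronglyConnected d (facetsAbove Z (stellar σ u K)) := by
  obtain ⟨X₀, hX₀, hσX₀⟩ := hσK
  have huZ : u ∉ Z := fun hh => not_mem_of_not_adj hu hX₀ (hσX₀ (hZσ hh))
  have huσ : u ∉ σ := fun hh => not_mem_of_not_adj hu hX₀ (hσX₀ hh)
  obtain ⟨f₀, hf₀, hf₀Z⟩ := Finset.exists_mem_notMem_of_card_lt_card hc
  have hnew : ∀ X ∈ K, σ ⊆ X → ∀ f ∈ σ, f ∉ Z →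
      insert u (X.erase f) ∈ facetsAbove Z (stellar σ u K) := by
    intro X hX hs f hf hfZ
    refine mem_facetsAbove.2 ⟨mem_stellar.2 (Or.inr ⟨X, hX, hs, f, hf, rfl⟩), fun z hz => ?_⟩
    have : z ≠ f := by rintro rfl; exact hfZ hz
    simp [this, hs (hZσ hz)]
  refine h.replace (A := {X | σ ⊆ X})
    (A' := {W | ∃ X ∈ K, σ ⊆ X ∧ ∃ f ∈ σ, f ∉ Z ∧ W = insert u (X.erase f)})
    (a := X₀) (α := insert u (X₀.erase f₀)) (mem_facetsAbove.2 ⟨hX₀, hZσ.trans hσX₀⟩) hσX₀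
    ?_ ?_ ?_ ?_ ?_
  · intro W hW
    obtain ⟨hW, hZW⟩ := mem_facetsAbove.1 hW
    rcases mem_stellar.1 hW with ⟨hWK, hs⟩ | ⟨Y, hY, hs, f, hf, rfl⟩
    · exact Or.inr ⟨mem_facetsAbove.2 ⟨hWK, hZW⟩, hs⟩
    · refine Or.inl ⟨Y, hY, hs, f, hf, fun hfZ => ?_, rfl⟩
      have := hZW hfZ
      simp only [Finset.mem_insert, Finset.mem_erase] at this
      rcases this with rfl | this
      · exact huZ hfZ
      · exact this.1 rfl
  · rintro W ⟨X, hX, hs, f, hf, hfZ, rfl⟩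
    exact hnew X hX hs f hf hfZ
  · intro X hX hs
    obtain ⟨hX, hZX⟩ := mem_facetsAbove.1 hX
    exact mem_facetsAbove.2 ⟨mem_stellar.2 (Or.inl ⟨hX, hs⟩), hZX⟩
  · rintro W ⟨Y, hY, hs, g, hg, hgZ, rfl⟩
    have h1 : Linked d (facetsAbove Z (stellar σ u K)) (insert u (X₀.erase f₀))
        (insert u (X₀.erase g)) := by
      by_cases hfg : f₀ = g
      · subst hfg; exact Relation.ReflTransGen.refl
      · refine Neighbors.linked ⟨insert u ((X₀.erase f₀).erase g), ?_, ?_, ?_⟩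
          (hnew _ hX₀ hσX₀ _ hf₀ hf₀Z) (hnew _ hX₀ hσX₀ _ hg hgZ)
        · exact Finset.insert_subset_insert _ (Finset.erase_subset _ _)
        · rw [Finset.erase_right_comm]
          exact Finset.insert_subset_insert _ (Finset.erase_subset _ _)
        · have e1 := Finset.card_erase_add_one (hσX₀ hf₀)
          have e2 := Finset.card_erase_add_one (s := X₀.erase f₀) (a := g)
            (by simp [hσX₀ hg, Ne.symm hfg])
          have e3 := hK.card_eq _ hX₀
          rw [Finset.card_insert_of_notMem (by simp [not_mem_of_not_adj hu hX₀])]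
          omega
    refine h1.trans (Neighbors.linked ⟨insert u (σ.erase g), ?_, ?_, ?_⟩
      (hnew _ hX₀ hσX₀ _ hg hgZ) (hnew _ hY hs _ hg hgZ))
    · exact Finset.insert_subset_insert _ (Finset.erase_subset_erase _ hσX₀)
    · exact Finset.insert_subset_insert _ (Finset.erase_subset_erase _ hs)
    · have e1 := Finset.card_erase_add_one hg
      rw [Finset.card_insert_of_notMem (by simp [huσ])]
      omega
  · intro X hX hsX Y hY hsY hn
    obtain ⟨hX, hZX⟩ := mem_facetsAbove.1 hX
    obtain ⟨hY, hZY⟩ := mem_facetsAbove.1 hY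
    have hne : X ≠ Y := by rintro rfl; exact hsX hsY
    obtain ⟨g, S, hgS, hSX, rfl, hgX⟩ := exists_eq_insert_of_neighbors hK hX hY hne hn
    have hgσ : g ∈ σ := by
      by_contra hgσ
      exact hsX fun v hv => hSX (((Finset.mem_insert.1 (hsY hv)).resolve_left
        (by rintro rfl; exact hgσ hv)))
    refine ⟨_, ⟨_, hY, hsY, g, hgσ, fun hgZ => hgX (hZX hgZ), rfl⟩, S, hSX, ?_, ?_⟩
    · rw [Finset.erase_insert hgS]; exact Finset.subset_insert _ _
    · have := hK.card_eq _ hY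
      rw [Finset.card_insert_of_notMem hgS] at this
      omega

theorem flip_mem_facetsAbove {R Z : Finset ℕ} {x y : ℕ} (hZ : Z ⊆ insert x R) {r : ℕ}
    (hr : r ∈ R) (hrZ : r ∉ Z) :
    insert x (insert y (R.erase r)) ∈ facetsAbove Z (flip R x y K) := by
  refine mem_facetsAbove.2 ⟨mem_flip.2 (Or.inr ⟨r, hr, rfl⟩), fun z hz => ?_⟩
  have : z ≠ r := by rintro rfl; exact hrZ hz
  have := hZ hz
  simp only [Finset.mem_insert, Finset.mem_erase] at this ⊢
  tauto

theorem stronglyConnected_flip (hK : IsPseudomanifold d K) {R Z : Finset ℕ} {x y : ℕ}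
    (hf : CanFlip R x y K) (hZ : Z ⊆ insert x R) (hc : (Z.erase x).card < R.card)
    (h : StronglyConnected d (facetsAbove Z K)) :
    StronglyConnected d (facetsAbove Z (flip R x y K)) := by
  have hxR := hf.left_notMem
  have hyR := hf.right_notMem
  have hxy := hf.ne
  obtain ⟨f₀, hf₀, hf₀Z'⟩ := Finset.exists_mem_notMem_of_card_lt_card hc
  have hf₀Z : f₀ ∉ Z := fun hz => hf₀Z' (by
    simp only [Finset.mem_erase]; exact ⟨by rintro rfl; exact hxR hf₀, hz⟩)
  refine h.replace (A := {X | X = insert x R ∨ X = insert y R})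
    (A' := {W | ∃ r ∈ R, r ∉ Z ∧ insert x (insert y (R.erase r)) = W})
    (a := insert x R) (mem_facetsAbove.2 ⟨hf.left_mem, hZ⟩) (Or.inl rfl)
    (α := insert x (insert y (R.erase f₀))) ?_ ?_ ?_ ?_ ?_
  · intro W hW
    obtain ⟨hW, hZW⟩ := mem_facetsAbove.1 hW
    rcases mem_flip.1 hW with ⟨hWK, h1, h2⟩ | ⟨r, hr, rfl⟩
    · exact Or.inr ⟨mem_facetsAbove.2 ⟨hWK, hZW⟩, by rintro (h | h) <;> contradiction⟩
    · refine Or.inl ⟨r, hr, fun hrZ => ?_, rfl⟩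
      have := hZW hrZ
      simp only [Finset.mem_insert, Finset.mem_erase] at this
      rcases this with rfl | rfl | this
      · exact hxR hr
      · exact hyR hr
      · exact this.1 rfl
  · rintro W ⟨r, hr, hrZ, rfl⟩
    exact flip_mem_facetsAbove hZ hr hrZ
  · intro X hX hs
    obtain ⟨hX, hZX⟩ := mem_facetsAbove.1 hX
    exact mem_facetsAbove.2 ⟨mem_flip.2 (Or.inl ⟨hX, fun h => hs (Or.inl h),
      fun h => hs (Or.inr h)⟩), hZX⟩
  · rintro W ⟨g, hg, hgZ, rfl⟩
    by_cases hfg : f₀ = g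
    · subst hfg; exact Relation.ReflTransGen.refl
    · refine Neighbors.linked ⟨insert x (insert y ((R.erase f₀).erase g)), ?_, ?_, ?_⟩
        (flip_mem_facetsAbove hZ hf₀ hf₀Z) (flip_mem_facetsAbove hZ hg hgZ)
      · exact Finset.insert_subset_insert _ (Finset.insert_subset_insert _
          (Finset.erase_subset _ _))
      · rw [Finset.erase_right_comm]
        exact Finset.insert_subset_insert _ (Finset.insert_subset_insert _
          (Finset.erase_subset _ _))
      · have e1 := Finset.card_erase_add_one hf₀
        have e2 := Finset.card_erase_add_one (s := R.erase f₀) (a := g)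
          (by simp [hg, Ne.symm hfg])
        have e3 := card_add_one_of_insert hK hxR hf.left_mem
        rw [Finset.card_insert_of_notMem (by simp [hxR, hxy]),
          Finset.card_insert_of_notMem (by simp [hyR])]
        omega
  · intro X hX hsX Y hY hsY hn
    obtain ⟨hX, hZX⟩ := mem_facetsAbove.1 hX
    obtain ⟨hY, hZY⟩ := mem_facetsAbove.1 hY
    have hne : X ≠ Y := by rintro rfl; exact hsX hsY
    obtain ⟨g, S, hgS, hSX, hYS, hgX⟩ := exists_eq_insert_of_neighbors hK hX hY hne hn
    have hRX : ¬ R ⊆ X := fun hR => by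
      rcases hK.eq_or_eq_of_insert hxR hxy hf.left_mem hf.right_mem hX hR with h | h
      · exact hsX (Or.inl h)
      · exact hsX (Or.inr h)
    have hRY : R ⊆ Y := by rcases hsY with rfl | rfl <;> exact Finset.subset_insert _ _
    have hgR : g ∈ R := by
      by_contra hgR
      exact hRX fun v hv => hSX ((Finset.mem_insert.1 (hYS ▸ hRY hv)).resolve_left
        (by rintro rfl; exact hgR hv))
    refine ⟨_, ⟨g, hgR, fun hgZ => hgX (hZX hgZ), rfl⟩, S, hSX, ?_, ?_⟩
    · intro v hv
      have hvY : v ∈ Y := hYS ▸ Finset.mem_insert_of_mem hv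
      have hvg : v ≠ g := by rintro rfl; exact hgS hv
      rcases hsY with rfl | rfl <;>
      · simp only [Finset.mem_insert, Finset.mem_erase] at hvY ⊢
        tauto
    · have := hK.card_eq _ hY
      rw [hYS, Finset.card_insert_of_notMem hgS] at this
      omega

theorem exists_mem_diff_ne {Z R : Finset ℕ} (h : Z.card + 2 ≤ R.card) (p : ℕ) :
    ∃ r ∈ R, r ∉ Z ∧ r ≠ p := by
  have : (insert p Z).card < R.card := by
    have := Finset.card_insert_le p Z; omega
  obtain ⟨r, hr, hr'⟩ := Finset.exists_mem_notMem_of_card_lt_card this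
  simp only [Finset.mem_insert, not_or] at hr'
  exact ⟨r, hr, hr'.2, hr'.1⟩

theorem exists_facet_flip {R Z : Finset ℕ} {x y : ℕ} (hx : x ∉ R) (hZ : Z ⊆ insert x R)
    (hc : (Z.erase x).card + 2 ≤ R.card) {p : ℕ} (h : ∃ X ∈ K, Z ⊆ X ∧ p ∈ X) :
    ∃ X ∈ flip R x y K, Z ⊆ X ∧ p ∈ X := by
  obtain ⟨X, hX, hZX, hp⟩ := h
  by_cases hs : X = insert x R ∨ X = insert y R
  · obtain ⟨r, hr, hrZ, hrp⟩ := exists_mem_diff_ne hc p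
    have hrZ : r ∉ Z := fun hz => hrZ (by
      simp only [Finset.mem_erase]; exact ⟨by rintro rfl; exact hx hr, hz⟩)
    obtain ⟨h1, h2⟩ := mem_facetsAbove.1 (flip_mem_facetsAbove (K := K) (y := y) hZ hr hrZ)
    refine ⟨_, h1, h2, ?_⟩
    rcases hs with rfl | rfl <;>
    · simp only [Finset.mem_insert, Finset.mem_erase] at hp ⊢
      tauto
  · exact ⟨X, mem_flip.2 (Or.inl ⟨hX, fun h => hs (Or.inl h), fun h => hs (Or.inr h)⟩), hZX, hp⟩

theorem exists_facet_stellar {σ Z : Finset ℕ} {u : ℕ} (hc : Z.card + 2 ≤ σ.card)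
    {p : ℕ} (h : ∃ X ∈ K, Z ⊆ X ∧ p ∈ X) : ∃ X ∈ stellar σ u K, Z ⊆ X ∧ p ∈ X := by
  obtain ⟨X, hX, hZX, hp⟩ := h
  by_cases hs : σ ⊆ X
  · obtain ⟨r, hr, hrZ, hrp⟩ := exists_mem_diff_ne hc p
    refine ⟨_, mem_stellar.2 (Or.inr ⟨X, hX, hs, r, hr, rfl⟩), fun z hz => ?_, ?_⟩
    · have : z ≠ r := by rintro rfl; exact hrZ hz
      simp [this, hZX hz]
    · simp [hrp.symm, hp]
  · exact ⟨X, mem_stellar.2 (Or.inl ⟨hX, hs⟩), hZX, hp⟩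

theorem adj_stellar_self {σ : Finset ℕ} {u v : ℕ} (h : Adj (stellar σ u K) v v) :
    v = u ∨ Adj K v v := by
  obtain ⟨X, hX, hv, -⟩ := h
  rcases mem_stellar.1 hX with ⟨hXK, -⟩ | ⟨Y, hY, hs, f, hf, rfl⟩
  · exact Or.inr ⟨X, hXK, hv, hv⟩
  · rcases Finset.mem_insert.1 hv with rfl | hv
    · exact Or.inl rfl
    · exact Or.inr ⟨Y, hY, Finset.mem_of_mem_erase hv, Finset.mem_of_mem_erase hv⟩

end FacetComplex

namespace FacetComplex

variable {d : ℕ} {K : Finset (Finset ℕ)}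

/-- A gallery of facets `Ys` starting behind the ridge `S`; each facet arises from the preceding
ridge by adding the corresponding vertex of `ws`, and never returns through that ridge. -/
inductive Walk (K : Finset (Finset ℕ)) : Finset ℕ → List ℕ → List (Finset ℕ) → Prop
  | nil (S : Finset ℕ) : Walk K S [] []
  | cons {S : Finset ℕ} {w s : ℕ} {ws : List ℕ} {Ys : List (Finset ℕ)} (hw : w ∉ S)
      (hm : insert w S ∈ K) (hs : s ∈ S) (h : Walk K ((insert w S).erase s) ws Ys) :
      Walk K S (w :: ws) (insert w S :: Ys)

theorem Walk.mem {S : Finset ℕ} {ws : List ℕ} {Ys : List (Finset ℕ)} (h : Walk K S ws Ys) :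
    ∀ Y ∈ Ys, Y ∈ K := by
  induction h with
  | nil => simp
  | cons hw hm hs h ih => simpa [hm] using ih

theorem Walk.exists_mem {S : Finset ℕ} {ws : List ℕ} {Ys : List (Finset ℕ)} (h : Walk K S ws Ys) :
    ∀ x ∈ ws, ∃ Y ∈ Ys, x ∈ Y := by
  induction h with
  | nil => simp
  | cons hw hm hs h ih =>
    intro x hx
    rcases List.mem_cons.1 hx with rfl | hx
    · exact ⟨_, List.mem_cons_self, Finset.mem_insert_self _ _⟩
    · obtain ⟨Y, hY, hxY⟩ := ih x hx
      exact ⟨Y, by simp [hY], hxY⟩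

theorem Walk.adj {S : Finset ℕ} {ws : List ℕ} {Ys : List (Finset ℕ)} (h : Walk K S ws Ys) {x : ℕ}
    (hx : x ∈ ws) : Adj K x x := by
  obtain ⟨Y, hY, hxY⟩ := h.exists_mem x hx
  exact ⟨Y, h.mem Y hY, hxY, hxY⟩

theorem Walk.mono {S : Finset ℕ} {ws : List ℕ} {Ys : List (Finset ℕ)} (h : Walk K S ws Ys)
    {L : Finset (Finset ℕ)} (hL : ∀ Y ∈ Ys, Y ∈ L) : Walk L S ws Ys := by
  induction h with
  | nil => exact Walk.nil _
  | cons hw hm hs h ih =>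
    exact Walk.cons hw (hL _ (by simp)) hs (ih fun Y hY => hL Y (by simp [hY]))

theorem Walk.erase_of_notMem {A : Finset ℕ} {s w : ℕ} {ws : List ℕ} {Ys : List (Finset ℕ)}
    (h : Walk K (A.erase s) ws Ys) (hwA : w ∈ A) (hY : ∀ Y ∈ Ys, w ∉ Y) :
    Walk K (A.erase w) ws Ys := by
  by_cases hws : w = s
  · rwa [hws]
  · cases h with
    | nil => exact Walk.nil _
    | cons hw hm hs h =>
      refine absurd (Finset.mem_insert_of_mem ?_) (hY _ List.mem_cons_self)
      exact Finset.mem_erase.2 ⟨hws, hwA⟩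

theorem Walk.subset_port {S Z : Finset ℕ} {a s : ℕ} {ws : List ℕ} {Ys : List (Finset ℕ)}
    (h : Walk K ((insert a S).erase s) ws Ys) (hs : s ∈ S) (hZ : Z ⊆ insert a S)
    (hY : ∀ Y ∈ Ys, Z ⊆ Y) (hn : insert a S ∉ Ys) : Z ⊆ (insert a S).erase s ∨ ws = [] := by
  cases h with
  | nil => exact Or.inr rfl
  | @cons _ b t _ _ hb hbm ht h =>
    left
    have hZY₂ := hY _ List.mem_cons_self
    intro v hv
    rcases Finset.mem_insert.1 (hZY₂ hv) with rfl | hv'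
    · have hv1 := hZ hv
      rw [Finset.mem_erase] at hb
      have : v = s := by tauto
      subst this
      rw [Finset.insert_erase (Finset.mem_insert_of_mem hs)] at hn
      exact absurd List.mem_cons_self hn
    · exact hv'

/-- The number of entries of a list that lie in `U` or occur earlier in the list. -/
def repetitions : Finset ℕ → List ℕ → ℕ
  | _, [] => 0
  | U, w :: ws => (if w ∈ U then 1 else 0) + repetitions (insert w U) ws

theorem repetitions_insert {e : ℕ} {ws : List ℕ} (h : e ∉ ws) (U : Finset ℕ) :
    repetitions (insert e U) ws = repetitions U ws := by
  induction ws generalizing U with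
  | nil => rfl
  | cons w ws ih =>
    simp only [List.mem_cons, not_or] at h
    simp only [repetitions, Finset.mem_insert, Ne.symm h.1, false_or]
    rw [Finset.insert_comm, ih h.2]

theorem count_le_repetitions {w : ℕ} (ws : List ℕ) {U : Finset ℕ} (hw : w ∈ U) :
    ws.count w ≤ repetitions U ws := by
  induction ws generalizing U with
  | nil => simp
  | cons v ws ih =>
    have := ih (U := insert v U) (by simp [hw])
    by_cases hv : v = w
    · subst hv
      simp [repetitions, hw] at this ⊢
      omega
    · rw [List.count_cons_of_ne hv]
      simp only [repetitions]
      omega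

/-- `L` arises from `K` by subdivisions that keep the facets outside `Ys` and those with the
vertex `z`; every new vertex is in `ws`. -/
structure IsRefinement (d : ℕ) (Z : Finset ℕ) (z : ℕ) (ws : List ℕ) (Ys : List (Finset ℕ))
    (K L : Finset (Finset ℕ)) : Prop where
  isPseudomanifold : IsPseudomanifold d L
  homeomorphic : Homeomorphic K L
  mem : ∀ X ∈ K, X ∉ Ys → X ∈ L
  mem_iff : ∀ X, z ∈ X → (X ∈ L ↔ X ∈ K)
  adj : ∀ p, Adj L p p → Adj K p p ∨ p ∈ ws
  connected : StronglyConnected d (facetsAbove Z K) → StronglyConnected d (facetsAbove Z L)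
  dominating : ∀ p, (∃ X ∈ K, Z ⊆ X ∧ p ∈ X) → ∃ X ∈ L, Z ⊆ X ∧ p ∈ X

theorem IsRefinement.refl {Z : Finset ℕ} {z : ℕ} (hK : IsPseudomanifold d K) :
    IsRefinement d Z z [] [] K K :=
  ⟨hK, Homeomorphic.refl K, fun _ h _ => h, fun _ _ => Iff.rfl, fun _ h => Or.inl h, id,
    fun _ h => h⟩

theorem IsRefinement.mono {Z : Finset ℕ} {z : ℕ} {ws ws' : List ℕ} {Ys Ys' : List (Finset ℕ)}
    {L : Finset (Finset ℕ)} (h : IsRefinement d Z z ws Ys K L) (hws : ∀ p ∈ ws, p ∈ ws')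
    (hYs : ∀ Y ∈ Ys, Y ∈ Ys') : IsRefinement d Z z ws' Ys' K L :=
  { h with
    mem := fun X hX hX' => h.mem X hX fun h' => hX' (hYs X h')
    adj := fun p hp => (h.adj p hp).imp_right (hws p) }

/-- Refining by a subdivision of the ridge between the facets `insert a E` and `insert b E`. -/
theorem IsRefinement.stellar {Z : Finset ℕ} {z : ℕ} {ws : List ℕ} {Ys : List (Finset ℕ)}
    {L : Finset (Finset ℕ)} (h : IsRefinement d Z z ws Ys K L) {E : Finset ℕ} {a b e : ℕ}
    (hZ : Z ⊆ E) (hZd : Z.card + 3 ≤ d) (ha : a ∉ E) (hab : a ≠ b) (haE : insert a E ∈ L)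
    (hbE : insert b E ∈ L) (hza : z ∉ insert a E) (hzb : z ∉ insert b E) (he : ¬ Adj L e e)
    (hez : e ≠ z) (hYa : insert a E ∈ Ys) (hYb : insert b E ∈ K → insert b E ∈ Ys) :
    IsRefinement d Z z (e :: ws) Ys K (stellar E e L) := by
  have hL := h.isPseudomanifold
  have hcE := card_add_one_of_insert hL ha haE
  have hEne : E.Nonempty := Finset.card_pos.1 (by omega)
  have heE : e ∉ E := fun hh => he ⟨_, haE, by simp [hh], by simp [hh]⟩
  have hstar : ∀ X ∈ L, E ⊆ X → X = insert a E ∨ X = insert b E := fun X hX hE =>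
    hL.eq_or_eq_of_insert ha hab haE hbE hX hE
  refine ⟨hL.stellar hEne he, h.homeomorphic.trans (homeomorphic_stellar hEne he heE), ?_, ?_, ?_,
    ?_, ?_⟩
  · intro X hX hXY
    refine mem_stellar.2 (Or.inl ⟨h.mem X hX hXY, fun hE => hXY ?_⟩)
    rcases hstar X (h.mem X hX hXY) hE with rfl | rfl
    · exact hYa
    · exact hYb hX
  · intro X hzX
    rw [← h.mem_iff X hzX, mem_stellar]
    constructor
    · rintro (hX | ⟨Y, hY, hs, f, hf, rfl⟩)
      · exact hX.1
      · exfalso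
        have hzY : z ∈ Y := Finset.mem_of_mem_erase ((Finset.mem_insert.1 hzX).resolve_left hez.symm)
        rcases hstar Y hY hs with rfl | rfl
        · exact hza hzY
        · exact hzb hzY
    · intro hX
      refine Or.inl ⟨hX, fun hE => ?_⟩
      rcases hstar X hX hE with rfl | rfl
      · exact hza hzX
      · exact hzb hzX
  · intro p hp
    rcases adj_stellar_self hp with rfl | hp
    · exact Or.inr (by simp)
    · exact (h.adj p hp).imp_right fun h => by simp [h]
  · intro hc
    exact stronglyConnected_stellar hL he hZ (by omega) (by omega)
      ⟨_, haE, Finset.subset_insert _ _⟩ (h.connected hc)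
  · intro p hp
    exact exists_facet_stellar (by omega) (h.dominating p hp)

set_option maxHeartbeats 1000000 in
/-- A vertex `w` can be pushed off a gallery by subdividing ridges of the gallery. -/
theorem exists_walk_avoiding {Z : Finset ℕ} {z : ℕ} (hZd : Z.card + 3 ≤ d)
    (hK : IsPseudomanifold d K) {w : ℕ} (hwZ : w ∉ Z) {S : Finset ℕ} {ws : List ℕ}
    {Ys : List (Finset ℕ)} (hW : Walk K S ws Ys) (hnd : Ys.Nodup) (hY : ∀ Y ∈ Ys, Z ⊆ Y ∧ z ∉ Y)
    (hZS : Z ⊆ S ∨ ws = []) :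
    ∃ L ws' Ys', IsRefinement d Z z ws' Ys K L ∧ Walk L S ws' Ys' ∧ Ys'.Nodup ∧
      (∀ Y ∈ Ys', Z ⊆ Y ∧ z ∉ Y) ∧ w ∉ ws' ∧ (∀ Y ∈ Ys'.tail, w ∉ Y) ∧
      (∀ Y ∈ Ys', Y ∈ K → Y ∈ Ys) ∧ (∀ x ∈ ws, x ≠ w → x ∈ ws') ∧
      ∀ U : Finset ℕ, w ∈ U → (∀ v ∈ U, Adj K v v) →
        repetitions U ws' + ws.count w ≤ repetitions U ws := by
  induction hW with
  | nil S => exact ⟨K, [], [], IsRefinement.refl hK, Walk.nil S, by simp, by simp, by simp,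
      by simp, by simp, by simp, by simp [repetitions]⟩
  | @cons S a s ws Ys ha hm hs h ih =>
    obtain ⟨hY₁, hnd⟩ := List.nodup_cons.1 hnd
    have hZY₁ := hY _ List.mem_cons_self
    replace hZS : Z ⊆ S := by simpa using hZS
    have hsa : s ≠ a := by rintro rfl; exact ha hs
    have hsE : s ∉ (insert a S).erase s := Finset.notMem_erase _ _
    have hsins : insert s ((insert a S).erase s) = insert a S :=
      Finset.insert_erase (Finset.mem_insert_of_mem hs)
    obtain ⟨L, ws', Ys', hL, hW', hnd', hY', hwws', hwtl, hold, hsub, hrep⟩ :=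
      ih hnd (fun Y hY' => hY Y (List.mem_cons_of_mem _ hY')) (h.subset_port hs hZY₁.1
        (fun Y hY' => (hY Y (List.mem_cons_of_mem _ hY')).1) hY₁)
    have hY₁L : insert a S ∈ L := hL.mem _ hm hY₁
    have hY₁' : insert a S ∉ Ys' := fun hh => hY₁ (hold _ hh hm)
    by_cases hcase : (a ≠ w ∧ (w ∉ S ∨ s = w)) ∨ (a ≠ w ∧ ws' = [])
    · -- the first facet is kept
      have haw : a ≠ w := by tauto
      refine ⟨L, a :: ws', insert a S :: Ys', hL.mono (fun p hp => List.mem_cons_of_mem _ hp)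
        (fun Y hY => List.mem_cons_of_mem _ hY), Walk.cons ha hY₁L hs hW',
        List.nodup_cons.2 ⟨hY₁', hnd'⟩, ?_, ?_, ?_, ?_, ?_, ?_⟩
      · intro Y hYm
        rcases List.mem_cons.1 hYm with rfl | hYm
        · exact hZY₁
        · exact hY' Y hYm
      · simp [haw.symm, hwws']
      · rw [List.tail_cons]
        cases hW' with
        | nil => simp
        | @cons _ b t ws₂ Ys₂ hb hbm ht h₂ =>
          have hwS : w ∉ S ∨ s = w := by simpa [haw] using hcase
          intro Y hYm
          rcases List.mem_cons.1 hYm with rfl | hYm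
          · simp only [List.mem_cons, not_or] at hwws'
            simp only [Finset.mem_insert, Finset.mem_erase, not_or, not_and]
            exact ⟨hwws'.1, fun hws' => by
              rcases hwS with h | h
              · exact ⟨haw.symm, h⟩
              · exact absurd h.symm hws'⟩
          · exact hwtl Y hYm
      · intro Y hYm hYK
        rcases List.mem_cons.1 hYm with rfl | hYm
        · exact List.mem_cons_self
        · exact List.mem_cons_of_mem _ (hold Y hYm hYK)
      · intro x hx hxw
        rcases List.mem_cons.1 hx with rfl | hx
        · exact List.mem_cons_self
        · exact List.mem_cons_of_mem _ (hsub x hx hxw)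
      · intro U hwU hU
        have := hrep (insert a U) (by simp [hwU]) (by
          intro v hv
          rcases Finset.mem_insert.1 hv with rfl | hv
          · exact ⟨_, hm, by simp, by simp⟩
          · exact hU v hv)
        rw [List.count_cons_of_ne haw]
        simp only [repetitions]
        omega
    · cases hW' with
      | nil =>
        -- the gallery becomes empty
        have haw : a = w := by by_contra h; simp [h] at hcase
        refine ⟨L, [], [], hL.mono (fun p hp => hp) (fun Y hY => List.mem_cons_of_mem _ hY),
          Walk.nil _, by simp, by simp, by simp, by simp, by simp, ?_, ?_⟩
        · intro x hx hxw
          rcases List.mem_cons.1 hx with rfl | hx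
          · exact absurd haw hxw
          · exact hsub x hx hxw
        · intro U hwU hU
          have := count_le_repetitions (a :: ws) hwU
          simpa [repetitions] using this
      | @cons _ b t ws₂ Ys₂ hb hbm ht h₂ =>
        -- the ridge between the first two facets is subdivided
        set E := (insert a S).erase s with hE
        obtain ⟨e, he⟩ := exists_not_adj_self (insert {z, w} (K ∪ L))
        have heL : ¬ Adj L e e := fun ⟨X, hX, h1, h2⟩ => he ⟨X, by simp [hX], h1, h2⟩
        have heK : ¬ Adj K e e := fun ⟨X, hX, h1, h2⟩ => he ⟨X, by simp [hX], h1, h2⟩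
        have hez : e ≠ z := by
          rintro rfl; exact he ⟨{e, w}, by simp, by simp, by simp⟩
        have hY₂ := hY' _ List.mem_cons_self
        have hsb : s ≠ b := by
          rintro rfl
          rw [hsins] at hY₁'
          exact hY₁' List.mem_cons_self
        have hZE : Z ⊆ E := by
          intro v hv
          rcases Finset.mem_insert.1 (hY₂.1 hv) with rfl | hv'
          · have hv1 := hZY₁.1 hv
            rw [hE, Finset.mem_erase] at hb
            exact absurd ⟨hsb.symm, hv1⟩ hb
          · exact hv'
        have hws₂ : e ∉ ws₂ := fun hh => heL (h₂.adj hh)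
        have heY₁ := not_mem_of_not_adj heL hY₁L
        have heY₂ := not_mem_of_not_adj heL hbm
        have hstar : ∀ X ∈ L, E ⊆ X → X = insert a S ∨ X = insert b E := fun X hX hEX => by
          rw [← hsins]
          exact hL.isPseudomanifold.eq_or_eq_of_insert hsE hsb (by rwa [hsins]) hbm hX hEX
        obtain ⟨hY₂₂, hnd₂⟩ := List.nodup_cons.1 hnd'
        have hρ : ∀ Y ∈ Ys₂, Y ∈ stellar E e L := by
          intro Y hYm
          refine mem_stellar.2 (Or.inl ⟨h₂.mem Y hYm, fun hEY => ?_⟩)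
          rcases hstar Y (h₂.mem Y hYm) hEY with rfl | rfl
          · exact hY₁' (List.mem_cons_of_mem _ hYm)
          · exact hY₂₂ hYm
        have hρe : ∀ Y ∈ Ys₂, e ∉ Y := fun Y hYm => not_mem_of_not_adj heL (h₂.mem Y hYm)
        have hρw : ∀ Y ∈ Ys₂, w ∉ Y := fun Y hYm => hwtl Y hYm
        have hp₁ : ∀ f ∈ E, insert e ((insert a S).erase f) ∈ stellar E e L := fun f hf =>
          mem_stellar.2 (Or.inr ⟨_, hY₁L, Finset.erase_subset _ _, f, hf, rfl⟩)
        have hp₂ : ∀ f ∈ E, insert e ((insert b E).erase f) ∈ stellar E e L := fun f hf =>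
          mem_stellar.2 (Or.inr ⟨_, hbm, Finset.subset_insert _ _, f, hf, rfl⟩)
        have hcommon : ∀ ws'', (∀ p ∈ e :: b :: ws₂, p ∈ ws'') →
            IsRefinement d Z z ws'' (insert a S :: Ys) K (stellar E e L) := by
          intro ws'' hws''
          refine ((hL.mono (Ys' := insert a S :: Ys) (fun p hp => hp)
            (fun Y hY => List.mem_cons_of_mem _ hY)).stellar hZE hZd hsE hsb (by rwa [hsins])
            hbm (by rw [hsins]; exact hZY₁.2) hY₂.2 heL hez (by rw [hsins]; exact List.mem_cons_self)
            (fun hh => List.mem_cons_of_mem _ (hold _ List.mem_cons_self hh))).mono hws''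
            (fun Y hY => hY)
        simp only [List.mem_cons, not_or] at hwws'
        have haE : a ∈ E := by rw [hE]; simp [hsa.symm]
        have hew : e ≠ w := by
          rintro rfl; exact he ⟨{z, e}, by simp, by simp, by simp⟩
        have hbS : b ∉ S := fun hh => hb (by rw [hE]; simp [hh, hsb.symm])
        have hea : e ≠ a := by rintro rfl; exact heY₁ (by simp)
        have heS : e ∉ S := fun hh => heY₁ (by simp [hh])
        have heb : e ≠ b := by rintro rfl; exact heY₂ (by simp)
        have hab : a ≠ b := by rintro rfl; exact hb haE
        have hzS : z ∉ S := fun hh => hZY₁.2 (by simp [hh])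
        have hzb : z ≠ b := by rintro rfl; exact hY₂.2 (by simp)
        have haZ : a ∉ Z := fun hh => ha (hZS hh)
        have hsZ : s ∉ Z := fun hh => hsE (hZE hh)
        have hport : w ∈ E → Walk (stellar E e L) ((insert b E).erase w) ws₂ Ys₂ := fun hwE =>
          (h₂.erase_of_notMem (Finset.mem_insert_of_mem hwE) hρw).mono hρ
        have heK' : ∀ Y ∈ K, e ∉ Y := fun Y hYK => not_mem_of_not_adj heK hYK
        have hA₁ : insert e S = insert e ((insert a S).erase a) := by
          rw [Finset.erase_insert ha]
        have hadj : Adj K a a := ⟨_, hm, by simp, by simp⟩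
        have hrest : ∀ Y ∈ Ys₂, Y ∈ K → Y ∈ insert a S :: Ys := fun Y hYm hYK =>
          List.mem_cons_of_mem _ (hold Y (List.mem_cons_of_mem _ hYm) hYK)
        clear ih hnd hold hL h hwtl hm hbm hY₁L hnd' hY₁ hY₁' he heL heK heY₁ heY₂ hY₂₂ h₂
        have hcount : ∀ l : List ℕ, e ∉ l → ∀ U : Finset ℕ, e ∉ U →
            repetitions U (e :: l) = repetitions U l := fun l hl U hU => by
          simp [repetitions, hU, repetitions_insert hl]
        have heU : ∀ U : Finset ℕ, (∀ v ∈ U, Adj K v v) → e ∉ U := fun U hU hh => by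
          obtain ⟨Y, hYK, heY, -⟩ := hU e hh
          exact heK' Y hYK heY
        have haU : ∀ U : Finset ℕ, (∀ v ∈ U, Adj K v v) → ∀ v ∈ insert a U, Adj K v v := by
          intro U hU v hv
          rcases Finset.mem_insert.1 hv with rfl | hv
          · exact hadj
          · exact hU v hv
        by_cases haw : a = w
        · subst haw
          have hA₂ : insert b ((insert e S).erase s) = insert e ((insert b E).erase a) := by
            clear hrep hport hρ hρe hρw hp₁ hp₂ hcommon hsub hstar hrest hcount heU haU
            ext v; simp only [hE, Finset.mem_insert, Finset.mem_erase]; grind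
          have hA₃ : (insert b ((insert e S).erase s)).erase e = (insert b E).erase a := by
            rw [hA₂, Finset.erase_insert]
            clear hrep hport hρ hρe hρw hp₁ hp₂ hcommon hsub hstar hrest hcount heU haU
            simp only [hE, Finset.mem_insert, Finset.mem_erase]; grind
          refine ⟨stellar E e L, e :: b :: ws₂, insert e S :: insert b ((insert e S).erase s) :: Ys₂,
            hcommon _ (fun p hp => hp), ?_, ?_, ?_, ?_, ?_, ?_, ?_, ?_⟩
          · refine Walk.cons heS (hA₁ ▸ hp₁ a haE) hs (Walk.cons ?_ (hA₂ ▸ hp₂ a haE) (s := e) ?_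
              (hA₃ ▸ hport haE))
            · simp [heb.symm, hbS]
            · have : e ≠ s := by rintro rfl; exact heS hs
              simp [this]
          · refine List.nodup_cons.2 ⟨?_, List.nodup_cons.2 ⟨?_, hnd₂⟩⟩
            · rw [List.mem_cons, not_or]
              refine ⟨fun hh => ?_, fun hh => hρe _ hh (by simp)⟩
              have : b ∈ insert e S := hh ▸ Finset.mem_insert_self _ _
              simp [heb.symm, hbS] at this
            · exact fun hh => hρe _ hh (by rw [hA₂]; simp)
          · intro Y hYm
            rcases List.mem_cons.1 hYm with rfl | hYm
            · exact ⟨hZS.trans (Finset.subset_insert _ _), by simp [hez.symm, hzS]⟩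
            rcases List.mem_cons.1 hYm with rfl | hYm
            · refine ⟨fun v hv => ?_, by simp [hez.symm, hzS, hzb]⟩
              have : v ≠ s := by rintro rfl; exact hsZ hv
              simp [this, hZS hv]
            · exact hY' Y (List.mem_cons_of_mem _ hYm)
          · simp [hew.symm, hwws']
          · intro Y hYm
            rw [List.tail_cons] at hYm
            rcases List.mem_cons.1 hYm with rfl | hYm
            · simp [hab, hea.symm, ha]
            · exact hρw Y hYm
          · intro Y hYm hYK
            rcases List.mem_cons.1 hYm with rfl | hYm
            · exact absurd (by simp) (heK' _ hYK)
            rcases List.mem_cons.1 hYm with rfl | hYm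
            · exact absurd (by rw [hA₂]; simp) (heK' _ hYK)
            · exact hrest Y hYm hYK
          · intro x hx hxa
            rcases List.mem_cons.1 hx with rfl | hx
            · exact absurd rfl hxa
            · exact List.mem_cons_of_mem _ (hsub x hx hxa)
          · intro U haU' hU
            rw [hcount _ (by simp [heb, hws₂]) U (heU U hU)]
            have := hrep U haU' hU
            have h1 : insert a U = U := Finset.insert_eq_of_mem haU'
            simp only [repetitions, haU', if_true, List.count_cons_self, h1] at this ⊢
            omega
        · obtain ⟨hwS, hsw⟩ : w ∈ S ∧ s ≠ w := by
            have h1 : ¬ (w ∉ S ∨ s = w) := fun h => hcase (Or.inl ⟨haw, h⟩)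
            exact ⟨not_not.1 fun h => h1 (Or.inl h), fun h => h1 (Or.inr h)⟩
          have hwE : w ∈ E := by rw [hE]; simp [hsw.symm, hwS]
          have hA₂ : insert a ((insert e S).erase w) = insert e ((insert a S).erase w) := by
            rw [Finset.erase_insert_of_ne hew, Finset.erase_insert_of_ne haw, Finset.insert_comm]
          have hA₃ : insert b ((insert a ((insert e S).erase w)).erase s)
              = insert e ((insert b E).erase w) := by
            clear hrep hport hρ hρe hρw hp₁ hp₂ hcommon hsub hstar hrest hcount heU haU
            ext v; simp only [hE, Finset.mem_insert, Finset.mem_erase]; grind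
          have hA₄ : (insert b ((insert a ((insert e S).erase w)).erase s)).erase e
              = (insert b E).erase w := by
            rw [hA₃, Finset.erase_insert]
            clear hrep hport hρ hρe hρw hp₁ hp₂ hcommon hsub hstar hrest hcount heU haU
            simp only [hE, Finset.mem_insert, Finset.mem_erase]; grind
          have hes : e ≠ s := by rintro rfl; exact heS hs
          refine ⟨stellar E e L, e :: a :: b :: ws₂, insert e S :: insert a ((insert e S).erase w) ::
            insert b ((insert a ((insert e S).erase w)).erase s) :: Ys₂,
            hcommon _ (fun p hp => ?_), ?_, ?_, ?_, ?_, ?_, ?_, ?_, ?_⟩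
          · simp only [List.mem_cons] at hp ⊢; tauto
          · refine Walk.cons heS (hA₁ ▸ hp₁ a haE) hwS (Walk.cons ?_ (hA₂ ▸ hp₁ w hwE) (s := s) ?_
              (Walk.cons ?_ (hA₃ ▸ hp₂ w hwE) (s := e) ?_ (hA₄ ▸ hport hwE)))
            · simp [hea.symm, ha]
            · simp [hsw, hs]
            · simp [heb.symm, hbS, hab.symm]
            · simp [hes, hew]
          · refine List.nodup_cons.2 ⟨?_, List.nodup_cons.2 ⟨?_, List.nodup_cons.2 ⟨?_, hnd₂⟩⟩⟩
            · rw [List.mem_cons, List.mem_cons, not_or, not_or]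
              refine ⟨fun hh => ?_, fun hh => ?_, fun hh => hρe _ hh (by simp)⟩
              · have : a ∈ insert e S := hh ▸ Finset.mem_insert_self _ _
                simp [hea.symm, ha] at this
              · have : b ∈ insert e S := hh ▸ Finset.mem_insert_self _ _
                simp [heb.symm, hbS] at this
            · rw [List.mem_cons, not_or]
              refine ⟨fun hh => ?_, fun hh => hρe _ hh (by rw [hA₂]; simp)⟩
              have : b ∈ insert a ((insert e S).erase w) := hh ▸ Finset.mem_insert_self _ _
              simp [heb.symm, hbS, hab.symm] at this
            · exact fun hh => hρe _ hh (by rw [hA₃]; simp)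
          · intro Y hYm
            rcases List.mem_cons.1 hYm with rfl | hYm
            · exact ⟨hZS.trans (Finset.subset_insert _ _), by simp [hez.symm, hzS]⟩
            rcases List.mem_cons.1 hYm with rfl | hYm
            · rw [hA₂]
              refine ⟨fun v hv => ?_, ?_⟩
              · have : v ≠ w := by rintro rfl; exact hwZ hv
                simp [this, hZS hv]
              · have := hZY₁.2
                simp only [Finset.mem_insert, Finset.mem_erase] at this ⊢
                tauto
            rcases List.mem_cons.1 hYm with rfl | hYm
            · rw [hA₃]
              refine ⟨fun v hv => ?_, ?_⟩
              · have : v ≠ w := by rintro rfl; exact hwZ hv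
                simp [this, hZE hv]
              · have := hY₂.2
                simp only [Finset.mem_insert, Finset.mem_erase] at this ⊢
                tauto
            · exact hY' Y (List.mem_cons_of_mem _ hYm)
          · simp [hew.symm, hwws', Ne.symm haw]
          · intro Y hYm
            rw [List.tail_cons] at hYm
            rcases List.mem_cons.1 hYm with rfl | hYm
            · simp [Ne.symm haw]
            rcases List.mem_cons.1 hYm with rfl | hYm
            · simp [Ne.symm haw, hwws'.1]
            · exact hρw Y hYm
          · intro Y hYm hYK
            rcases List.mem_cons.1 hYm with rfl | hYm
            · exact absurd (by simp) (heK' _ hYK)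
            rcases List.mem_cons.1 hYm with rfl | hYm
            · exact absurd (by rw [hA₂]; simp) (heK' _ hYK)
            rcases List.mem_cons.1 hYm with rfl | hYm
            · exact absurd (by rw [hA₃]; simp) (heK' _ hYK)
            · exact hrest Y hYm hYK
          · intro x hx hxw
            rcases List.mem_cons.1 hx with rfl | hx
            · simp
            · exact List.mem_cons_of_mem _ (List.mem_cons_of_mem _ (hsub x hx hxw))
          · intro U hwU hU
            rw [hcount _ (by simp [heb, hea, hws₂]) U (heU U hU), List.count_cons_of_ne haw]
            have := hrep (insert a U) (by simp [hwU]) (haU U hU)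
            simp only [repetitions] at this ⊢
            omega

end FacetComplex

namespace FacetComplex

variable {d : ℕ} {K : Finset (Finset ℕ)}

theorem Walk.mem_of_notMem {S : Finset ℕ} {ws : List ℕ} {Ys : List (Finset ℕ)}
    (h : Walk K S ws Ys) {x : ℕ} (hx : x ∉ S) {Y : Finset ℕ} (hY : Y ∈ Ys) (hxY : x ∈ Y) :
    x ∈ ws := by
  induction h with
  | nil => simp at hY
  | @cons S w s ws Ys hw hm hs h ih =>
    by_cases hxw : x = w
    · simp [hxw]
    · rcases List.mem_cons.1 hY with rfl | hY
      · exact absurd hxY (by simp [hxw, hx])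
      · exact List.mem_cons_of_mem _ (ih (by simp [hxw, hx]) hY)

/-- The situation while the star of `z` grows within the star of `Z`. -/
structure IsGrowing (d : ℕ) (Z : Finset ℕ) (z : ℕ) (K : Finset (Finset ℕ)) : Prop where
  isPseudomanifold : IsPseudomanifold d K
  notMem : z ∉ Z
  dominating : ∀ p, Adj K p p → ∃ X ∈ K, Z ⊆ X ∧ p ∈ X
  connected : StronglyConnected d (facetsAbove Z K)
  connected' : StronglyConnected d (facetsAbove (insert z Z) K)
  of_adj : ∀ p, Adj K z p → ∃ X ∈ K, insert z Z ⊆ X ∧ p ∈ X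

theorem IsGrowing.flip {Z : Finset ℕ} {z : ℕ} (h : IsGrowing d Z z K) (hZd : Z.card + 3 ≤ d)
    (hd : 4 ≤ d) {S : Finset ℕ} {w : ℕ} (hZ : Z ⊆ S) (hf : CanFlip S z w K) :
    IsGrowing d Z z (flip S z w K) := by
  have hK := h.isPseudomanifold
  have hcS := card_add_one_of_insert hK hf.left_notMem hf.left_mem
  have hzZ := h.notMem
  have e1 : Z.erase z = Z := Finset.erase_eq_of_notMem hzZ
  have e2 : (insert z Z).erase z = Z := Finset.erase_insert hzZ
  have hZ1 : Z ⊆ insert z S := hZ.trans (Finset.subset_insert _ _)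
  have hZ2 : insert z Z ⊆ insert z S := Finset.insert_subset_insert _ hZ
  refine ⟨hK.flip (by omega) hf, hzZ, fun p hp => ?_, ?_, ?_, fun p hp => ?_⟩
  · exact exists_facet_flip hf.left_notMem hZ1 (by rw [e1]; omega)
      (h.dominating p (adj_flip_self hf hp))
  · exact stronglyConnected_flip hK hf hZ1 (by rw [e1]; omega) h.connected
  · exact stronglyConnected_flip hK hf hZ2 (by rw [e2]; omega) h.connected'
  · rcases (adj_flip hd hK hf).1 hp with hp | ⟨-, rfl⟩ | ⟨h1, -⟩
    · exact exists_facet_flip hf.left_notMem hZ2 (by rw [e2]; omega) (h.of_adj p hp)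
    · obtain ⟨r, hr, hrZ⟩ := Finset.exists_mem_notMem_of_card_lt_card (s := Z) (t := S) (by omega)
      have hrz : r ≠ z := by rintro rfl; exact hf.left_notMem hr
      obtain ⟨h1, h2⟩ := mem_facetsAbove.1 (flip_mem_facetsAbove (K := K) (y := p) hZ2 hr
        (by simp [hrz, hrZ]))
      exact ⟨_, h1, h2, by simp⟩
    · exact absurd h1 hf.ne

theorem IsGrowing.refinement {Z : Finset ℕ} {z : ℕ} (h : IsGrowing d Z z K) {ws : List ℕ}
    {Ys : List (Finset ℕ)} {L : Finset (Finset ℕ)} (hL : IsRefinement d Z z ws Ys K L)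
    (hws : ∀ p ∈ ws, ∃ X ∈ L, Z ⊆ X ∧ p ∈ X) :
    IsGrowing d Z z L ∧ ∀ p, Adj L z p ↔ Adj K z p := by
  have hadj : ∀ p, Adj L z p ↔ Adj K z p := by
    intro p
    constructor
    · rintro ⟨X, hX, hz, hp⟩
      exact ⟨X, (hL.mem_iff X hz).1 hX, hz, hp⟩
    · rintro ⟨X, hX, hz, hp⟩
      exact ⟨X, (hL.mem_iff X hz).2 hX, hz, hp⟩
  refine ⟨⟨hL.isPseudomanifold, h.notMem, fun p hp => ?_, hL.connected h.connected, ?_,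
    fun p hp => ?_⟩, hadj⟩
  · rcases hL.adj p hp with hp | hp
    · exact hL.dominating p (h.dominating p hp)
    · exact hws p hp
  · have : facetsAbove (insert z Z) L = facetsAbove (insert z Z) K := by
      ext X
      rw [mem_facetsAbove, mem_facetsAbove]
      exact and_congr_left fun hX => hL.mem_iff X (hX (Finset.mem_insert_self _ _))
    rw [this]
    exact h.connected'
  · obtain ⟨X, hX, hZX, hpX⟩ := h.of_adj p ((hadj p).1 hp)
    exact ⟨X, (hL.mem_iff X (hZX (Finset.mem_insert_self _ _))).2 hX, hZX, hpX⟩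

/-- The neighbors of `z`, including `z`. -/
noncomputable def neighbors (K : Finset (Finset ℕ)) (z : ℕ) : Finset ℕ :=
  by classical exact (vertices K).filter fun p => Adj K z p

theorem mem_neighbors {z p : ℕ} : p ∈ neighbors K z ↔ Adj K z p := by
  classical
  simp only [neighbors, Finset.mem_filter, mem_vertices]
  exact ⟨fun h => h.2, fun h => ⟨h.right, h⟩⟩

/-- The star of `z` can absorb all vertices of a gallery. -/
theorem exists_absorbing {Z : Finset ℕ} {z : ℕ} (hZd : Z.card + 3 ≤ d) (hd : 4 ≤ d) :
    ∀ (n : ℕ) (ws : List ℕ) (K : Finset (Finset ℕ)) (S : Finset ℕ) (Ys : List (Finset ℕ)),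
      repetitions (neighbors K z) ws = n → IsGrowing d Z z K → Walk K S ws Ys → Ys.Nodup →
      (∀ Y ∈ Ys, Z ⊆ Y ∧ z ∉ Y) → (Z ⊆ S ∨ ws = []) → z ∉ S → insert z S ∈ K →
      ∃ L, Homeomorphic K L ∧ IsGrowing d Z z L ∧ (∀ p, Adj K z p → Adj L z p) ∧
        (∀ x ∈ ws, Adj L z x) ∧ ∀ p, Adj L p p → ¬ Adj L z p → Adj K p p := by
  intro n
  induction n using Nat.strong_induction_on with
  | _ n ih₁ =>
  intro ws
  induction ws with
  | nil =>
    intro K S Ys _ hK _ _ _ _ _ _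
    exact ⟨K, Homeomorphic.refl K, hK, fun _ h => h, by simp, fun _ h _ => h⟩
  | cons w ws ih₂ =>
    intro K S Ys hrep hK hW hnd hY hZS hzS hzSK
    replace hZS : Z ⊆ S := by simpa using hZS
    by_cases hzw : Adj K z w
    · have hwZ : w ∉ Z := by
        cases hW with
        | cons hw hm hs h => exact fun hh => hw (hZS hh)
      obtain ⟨L, ws', Ys', hL, hW', hnd', hY', hwws', -, -, hsub, hrep'⟩ :=
        exists_walk_avoiding hZd hK.isPseudomanifold hwZ hW hnd hY (Or.inl hZS)
      obtain ⟨hgr, hadj⟩ := hK.refinement hL (fun p hp => by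
        obtain ⟨Y, hYm, hpY⟩ := hW'.exists_mem p hp
        exact ⟨Y, hW'.mem Y hYm, (hY' Y hYm).1, hpY⟩)
      have hN : neighbors L z = neighbors K z := by
        ext p; rw [mem_neighbors, mem_neighbors, hadj]
      have h1 := hrep' (neighbors K z) (mem_neighbors.2 hzw)
        (fun v hv => (mem_neighbors.1 hv).right)
      rw [List.count_cons_self] at h1
      obtain ⟨L', hLL', hgr', hmono, hws', hold⟩ := ih₁ (repetitions (neighbors L z) ws')
        (by rw [hN]; omega) ws' L S Ys' rfl hgr hW' hnd' hY' (Or.inl hZS) hzS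
        ((hL.mem_iff _ (Finset.mem_insert_self _ _)).2 hzSK)
      refine ⟨L', hL.homeomorphic.trans hLL', hgr', fun p hp => hmono p ((hadj p).2 hp), ?_, ?_⟩
      · intro x hx
        by_cases hxw : x = w
        · subst hxw
          exact hmono x ((hadj x).2 hzw)
        · exact hws' x (hsub x hx hxw)
      · intro p hp hzp
        rcases hL.adj p (hold p hp hzp) with h | h
        · exact h
        · exact absurd (hws' p h) hzp
    · cases hW with
      | @cons _ _ s _ Ys hw hm hs h =>
      have hf : CanFlip S z w K := ⟨hzS, hw, hzSK, hm, hzw⟩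
      obtain ⟨hYn, hnd⟩ := List.nodup_cons.1 hnd
      have hgr := hK.flip hZd hd hZS hf
      have hadj : ∀ p q, Adj (FacetComplex.flip S z w K) p q ↔
          Adj K p q ∨ (p = z ∧ q = w) ∨ (p = w ∧ q = z) := fun p q =>
        adj_flip hd hK.isPseudomanifold hf
      have hN : neighbors (FacetComplex.flip S z w K) z = insert w (neighbors K z) := by
        ext p
        rw [mem_neighbors, Finset.mem_insert, mem_neighbors, hadj]
        have := hf.ne
        tauto
      have hws : w ≠ s := by rintro rfl; exact hw hs
      have hzs : z ≠ s := by rintro rfl; exact hzS hs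
      have hrep' : repetitions (neighbors (FacetComplex.flip S z w K) z) ws = n := by
        rw [hN, ← hrep]
        simp [repetitions, mem_neighbors, hzw]
      obtain ⟨L, hL, hgr', hmono, hws', hold⟩ := ih₂ (FacetComplex.flip S z w K)
        ((insert w S).erase s) Ys hrep' hgr (h.mono fun Y hYm => mem_flip.2 (Or.inl
          ⟨h.mem Y hYm, fun hh => (hY Y (List.mem_cons_of_mem _ hYm)).2 (hh ▸ by simp),
            fun hh => hYn (hh ▸ hYm)⟩)) hnd (fun Y hYm => hY Y (List.mem_cons_of_mem _ hYm))
        (h.subset_port hs (hY _ List.mem_cons_self).1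
          (fun Y hYm => (hY Y (List.mem_cons_of_mem _ hYm)).1) hYn)
        (by simp [hf.ne, hzS])
        (mem_flip.2 (Or.inr ⟨s, hs, by rw [Finset.erase_insert_of_ne hws]⟩))
      refine ⟨L, (homeomorphic_flip (by omega) hK.isPseudomanifold hf).trans hL, hgr',
        fun p hp => hmono p ((hadj z p).2 (Or.inl hp)), ?_, ?_⟩
      · intro x hx
        rcases List.mem_cons.1 hx with rfl | hx
        · exact hmono _ ((hadj _ _).2 (Or.inr (Or.inl ⟨rfl, rfl⟩)))
        · exact hws' x hx
      · intro p hp hzp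
        exact adj_flip_self hf (hold p hp hzp)

/-- The dual graph of a family of facets. -/
def dualGraph (d : ℕ) (G : Finset (Finset ℕ)) : SimpleGraph (Finset ℕ) where
  Adj X Y := X ≠ Y ∧ X ∈ G ∧ Y ∈ G ∧ Neighbors d X Y
  symm := ⟨fun _ _ h => ⟨h.1.symm, h.2.2.1, h.2.1, h.2.2.2.symm⟩⟩
  loopless := ⟨fun _ h => h.1 rfl⟩

theorem Linked.reachable {G : Finset (Finset ℕ)} {X Y : Finset ℕ} (h : Linked d G X Y) :
    (dualGraph d G).Reachable X Y := by
  induction h with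
  | refl => exact SimpleGraph.Reachable.refl _
  | @tail Y W _ h ih =>
    by_cases hYW : Y = W
    · rwa [← hYW]
    · exact ih.trans (SimpleGraph.Adj.reachable ⟨hYW, h⟩)

theorem exists_walk_of_path (hd : 2 ≤ d) (hK : IsPseudomanifold d K) {Z : Finset ℕ} {z : ℕ}
    (hzZ : z ∉ Z) {A B : Finset ℕ} (p : (dualGraph d (facetsAbove Z K)).Walk A B) (hp : p.IsPath)
    (hBK : B ∈ facetsAbove Z K) (hzB : z ∉ B) :
    (∃ S ws Ys, Walk K S ws Ys ∧ Ys.Nodup ∧ (∀ Y ∈ Ys, Z ⊆ Y ∧ z ∉ Y) ∧ Z ⊆ S ∧ z ∉ S ∧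
      insert z S ∈ K ∧ B ∈ Ys) ∨
    ((∀ Y ∈ p.support, Z ⊆ Y ∧ z ∉ Y) ∧ ∀ S a, a ∉ S → insert a S = A →
      (∀ Y ∈ K, S ⊆ Y → Y ∈ p.support → Y = A) → ∃ ws, Walk K S ws p.support) := by
  induction p with
  | @nil B =>
    obtain ⟨hB, hZB⟩ := mem_facetsAbove.1 hBK
    refine Or.inr ⟨by simp [hZB, hzB], ?_⟩
    rintro S a ha rfl -
    have := card_add_one_of_insert hK ha hB
    obtain ⟨s, hs⟩ : S.Nonempty := Finset.card_pos.1 (by omega)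
    exact ⟨[a], by simpa using Walk.cons ha hB hs (Walk.nil _)⟩
  | @cons A Y B hAY p ih =>
    obtain ⟨hne, hAG, hYG, hn⟩ : A ≠ Y ∧ A ∈ facetsAbove Z K ∧ Y ∈ facetsAbove Z K ∧
      Neighbors d A Y := id hAY
    obtain ⟨hA, hZA⟩ := mem_facetsAbove.1 hAG
    obtain ⟨hY, hZY⟩ := mem_facetsAbove.1 hYG
    rw [SimpleGraph.Walk.cons_isPath_iff] at hp
    rcases ih hp.1 hBK hzB with h | ⟨hsup, hport⟩
    · exact Or.inl h
    · obtain ⟨g, S₀, hg, hS₀A, rfl, hgA⟩ := exists_eq_insert_of_neighbors hK hA hY hne hn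
      have hc := card_add_one_of_insert hK hg hY
      obtain ⟨s, hs, rfl⟩ := eq_insert_of_subset hS₀A (by rw [hK.card_eq _ hA]; omega)
      have hgs : s ≠ g := by rintro rfl; simp at hgA
      obtain ⟨ws, hW⟩ := hport S₀ g hg rfl (by
        intro W hW hSW hWp
        rcases hK.eq_or_eq_of_insert hs hgs hA hY hW hSW with rfl | rfl
        · exact absurd hWp hp.2
        · rfl)
      have hzS₀ : z ∉ S₀ := fun hh => (hsup _ p.start_mem_support).2 (by simp [hh])
      by_cases hzs : z = s
      · subst hzs
        refine Or.inl ⟨S₀, ws, p.support, hW, hp.1.support_nodup, hsup, ?_, hs, hA,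
          p.end_mem_support⟩
        intro v hv
        refine (Finset.mem_insert.1 (hZA hv)).resolve_left ?_
        rintro rfl
        exact hzZ hv
      · refine Or.inr ⟨?_, ?_⟩
        · intro W hW
          rw [SimpleGraph.Walk.support_cons] at hW
          rcases List.mem_cons.1 hW with rfl | hW
          · exact ⟨hZA, by simp [hzs, hzS₀]⟩
          · exact hsup W hW
        · intro S a ha haS hS
          have hsa : s ≠ a := by
            rintro rfl
            have : S = S₀ := by
              rw [← Finset.erase_insert ha, haS, Finset.erase_insert hs]
            subst this
            exact hne (hS _ hY (Finset.subset_insert _ _) (by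
              rw [SimpleGraph.Walk.support_cons]
              exact List.mem_cons_of_mem _ p.start_mem_support)).symm
          have hsS : s ∈ S := by
            have : s ∈ insert a S := haS ▸ Finset.mem_insert_self _ _
            exact (Finset.mem_insert.1 this).resolve_left hsa
          refine ⟨a :: ws, ?_⟩
          rw [SimpleGraph.Walk.support_cons, ← haS]
          refine Walk.cons ha (haS ▸ hA) hsS ?_
          rw [haS, Finset.erase_insert hs]
          exact hW

theorem IsGrowing.stellar {Z X₀ : Finset ℕ} {z : ℕ} (hK : IsPseudomanifold d K) (hd : 4 ≤ d)
    (hZd : Z.card + 3 ≤ d) (hdom : ∀ p, Adj K p p → ∃ X ∈ K, Z ⊆ X ∧ p ∈ X)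
    (hcon : StronglyConnected d (facetsAbove Z K)) (hX₀ : X₀ ∈ K) (hZX₀ : Z ⊆ X₀)
    (hz : ¬ Adj K z z) : IsGrowing d Z z (stellar X₀ z K) := by
  have hc := hK.card_eq _ hX₀
  have hzX₀ := not_mem_of_not_adj hz hX₀
  have hnew : ∀ p, ∃ f ∈ X₀, f ≠ p ∧ Z ⊆ insert z (X₀.erase f) := by
    intro p
    obtain ⟨f, hf, hfZ, hfp⟩ := exists_mem_diff_ne (Z := Z) (R := X₀) (by omega) p
    refine ⟨f, hf, hfp, fun v hv => ?_⟩
    have : v ≠ f := by rintro rfl; exact hfZ hv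
    simp [this, hZX₀ hv]
  have hmem : ∀ f ∈ X₀, insert z (X₀.erase f) ∈ FacetComplex.stellar X₀ z K := fun f hf =>
    mem_stellar.2 (Or.inr ⟨X₀, hX₀, subset_rfl, f, hf, rfl⟩)
  have habove : ∀ W ∈ facetsAbove (insert z Z) (FacetComplex.stellar X₀ z K),
      ∃ f ∈ X₀, W = insert z (X₀.erase f) := by
    intro W hW
    obtain ⟨hW, hzW⟩ := mem_facetsAbove.1 hW
    rcases mem_stellar.1 hW with ⟨hWK, -⟩ | ⟨Y, hY, hs, f, hf, rfl⟩
    · exact absurd (hzW (Finset.mem_insert_self _ _)) (not_mem_of_not_adj hz hWK)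
    · obtain rfl := hK.eq_of_subset hX₀ hY hs
      exact ⟨f, hf, rfl⟩
  refine ⟨hK.stellar (Finset.card_pos.1 (by omega)) hz, fun hh => hzX₀ (hZX₀ hh), ?_, ?_, ?_, ?_⟩
  · intro p hp
    rcases adj_stellar_self hp with rfl | hp
    · obtain ⟨f, hf, -, hZf⟩ := hnew p
      exact ⟨_, hmem f hf, hZf, by simp⟩
    · exact exists_facet_stellar (by omega) (hdom p hp)
  · exact stronglyConnected_stellar hK hz hZX₀ (by omega) (by omega) ⟨X₀, hX₀, subset_rfl⟩ hcon
  · intro W hW W' hW'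
    obtain ⟨f, hf, rfl⟩ := habove W hW
    obtain ⟨g, hg, rfl⟩ := habove W' hW'
    by_cases hfg : f = g
    · subst hfg; exact Relation.ReflTransGen.refl
    · refine Neighbors.linked ⟨insert z ((X₀.erase f).erase g), ?_, ?_, ?_⟩ hW hW'
      · exact Finset.insert_subset_insert _ (Finset.erase_subset _ _)
      · rw [Finset.erase_right_comm]
        exact Finset.insert_subset_insert _ (Finset.erase_subset _ _)
      · have e1 := Finset.card_erase_add_one hf
        have e2 := Finset.card_erase_add_one (s := X₀.erase f) (a := g)
          (by simp [hg, Ne.symm hfg])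
        rw [Finset.card_insert_of_notMem (by simp [hzX₀])]
        omega
  · intro p hp
    rcases (adj_stellar_of_mem (by omega) hK hX₀).1 hp with hp | ⟨-, hp⟩ | ⟨rfl, -⟩
    · exact absurd hp.left hz
    · obtain ⟨f, hf, hfp, hZf⟩ := hnew p
      refine ⟨_, hmem f hf, Finset.insert_subset (Finset.mem_insert_self _ _) hZf, ?_⟩
      simp only [Finset.mem_insert, Finset.mem_erase] at hp ⊢
      tauto
    · obtain ⟨f, hf, -, hZf⟩ := hnew p
      exact ⟨_, hmem f hf, Finset.insert_subset (Finset.mem_insert_self _ _) hZf, by simp⟩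

/-- The set `Z` is in a facet together with each vertex, and its star is strongly connected. -/
structure IsHub (d : ℕ) (Z : Finset ℕ) (K : Finset (Finset ℕ)) : Prop where
  isPseudomanifold : IsPseudomanifold d K
  dominating : ∀ p, Adj K p p → ∃ X ∈ K, Z ⊆ X ∧ p ∈ X
  connected : StronglyConnected d (facetsAbove Z K)

theorem IsGrowing.exists_isHub {Z : Finset ℕ} {z : ℕ} (hd : 4 ≤ d) (hZd : Z.card + 3 ≤ d) :
    ∀ (n : ℕ) (K : Finset (Finset ℕ)), IsGrowing d Z z K → Adj K z z →
      (vertices K \ neighbors K z).card = n →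
      ∃ L, Homeomorphic K L ∧ IsHub d (insert z Z) L := by
  intro n
  induction n using Nat.strong_induction_on with
  | _ n ih =>
  intro K hK hz hn
  by_cases hall : ∀ p, Adj K p p → Adj K z p
  · exact ⟨K, Homeomorphic.refl K, hK.isPseudomanifold, fun p hp => hK.of_adj p (hall p hp),
      hK.connected'⟩
  · push Not at hall
    obtain ⟨x, hx, hzx⟩ := hall
    obtain ⟨A, hA, hZA, -⟩ := hK.of_adj z hz
    obtain ⟨B, hB, hZB, hxB⟩ := hK.dominating x hx
    have hzA : z ∈ A := hZA (Finset.mem_insert_self _ _)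
    have hzB : z ∉ B := fun hh => hzx ⟨B, hB, hh, hxB⟩
    have hBG := mem_facetsAbove.2 ⟨hB, hZB⟩
    obtain ⟨p, hp⟩ := (hK.connected A (mem_facetsAbove.2
      ⟨hA, (Finset.subset_insert _ _).trans hZA⟩) B hBG).reachable.exists_isPath
    rcases exists_walk_of_path (by omega) hK.isPseudomanifold hK.notMem p hp hBG hzB with
      ⟨S, ws, Ys, hW, hnd, hY, hZS, hzS, hzSK, hBY⟩ | ⟨h, -⟩
    · obtain ⟨L, hL, hgr, hmono, hws, hold⟩ := exists_absorbing hZd hd _ ws K S Ys rfl hK hW hnd hY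
        (Or.inl hZS) hzS hzSK
      have hxS : x ∉ S := fun hh => hzx ⟨_, hzSK, by simp, by simp [hh]⟩
      have hxL := hws x (hW.mem_of_notMem hxS hBY hxB)
      obtain ⟨L', hLL', hhub⟩ := ih _ (by
        rw [← hn]
        refine Finset.card_lt_card (Finset.ssubset_iff_of_subset (fun p hp => ?_) |>.2 ⟨x, ?_, ?_⟩)
        · rw [Finset.mem_sdiff, mem_vertices, mem_neighbors] at hp ⊢
          exact ⟨hold p hp.1 hp.2, fun h => hp.2 (hmono p h)⟩
        · rw [Finset.mem_sdiff, mem_vertices, mem_neighbors]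
          exact ⟨hx, hzx⟩
        · rw [Finset.mem_sdiff, mem_vertices, mem_neighbors]
          exact fun h => h.2 hxL) L hgr (hmono z hz) rfl
      exact ⟨L', hL.trans hLL', hhub⟩
    · exact absurd hzA (h _ p.start_mem_support).2

/-- A hub can be enlarged by a new vertex. -/
theorem IsHub.exists_insert {Z : Finset ℕ} (hd : 4 ≤ d) (hZd : Z.card + 3 ≤ d)
    (hK : IsHub d Z K) : ∃ L z, Homeomorphic K L ∧ z ∉ Z ∧ IsHub d (insert z Z) L := by
  obtain ⟨X, hX⟩ := hK.isPseudomanifold.nonempty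
  have hcX := hK.isPseudomanifold.card_eq X hX
  obtain ⟨v, hv⟩ : X.Nonempty := Finset.card_pos.1 (by omega)
  obtain ⟨X₀, hX₀, hZX₀, -⟩ := hK.dominating v ⟨X, hX, hv, hv⟩
  obtain ⟨z, hz⟩ := exists_not_adj_self K
  have hzX₀ := not_mem_of_not_adj hz hX₀
  have hc := hK.isPseudomanifold.card_eq X₀ hX₀
  have hgr := IsGrowing.stellar hK.isPseudomanifold hd hZd hK.dominating hK.connected hX₀ hZX₀ hz
  have hzz : Adj (stellar X₀ z K) z z :=
    (adj_stellar_of_mem (by omega) hK.isPseudomanifold hX₀).2 (Or.inr (Or.inl ⟨rfl, by simp⟩))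
  obtain ⟨L, hL, hhub⟩ := IsGrowing.exists_isHub hd hZd _ _ hgr hzz rfl
  exact ⟨L, z, (homeomorphic_stellar (Finset.card_pos.1 (by omega)) hz hzX₀).trans hL,
    hgr.notMem, hhub⟩

/-- A strongly connected closed pseudomanifold can be modified to have a hub of codimension two. -/
theorem exists_isHub (hd : 4 ≤ d) (hK : IsPseudomanifold d K) (hc : StronglyConnected d K) :
    ∃ L Q, Homeomorphic K L ∧ Q.card + 2 = d ∧ IsHub d Q L := by
  have key : ∀ n, n + 2 ≤ d → ∃ L Q, Homeomorphic K L ∧ Q.card = n ∧ IsHub d Q L := by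
    intro n
    induction n with
    | zero =>
      intro _
      refine ⟨K, ∅, Homeomorphic.refl K, rfl, hK, ?_, ?_⟩
      · rintro p ⟨X, hX, hp, -⟩
        exact ⟨X, hX, Finset.empty_subset _, hp⟩
      · have : facetsAbove ∅ K = K := by ext X; simp [mem_facetsAbove]
        rwa [this]
    | succ n ih =>
      intro hn
      obtain ⟨L, Q, hL, hQ, hhub⟩ := ih (by omega)
      obtain ⟨L', z, hL', hz, hhub'⟩ := hhub.exists_insert hd (by omega)
      exact ⟨L', insert z Q, hL.trans hL', by rw [Finset.card_insert_of_notMem hz, hQ], hhub'⟩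
  obtain ⟨L, Q, hL, hQ, hhub⟩ := key (d - 2) (by omega)
  exact ⟨L, Q, hL, by omega, hhub⟩

end FacetComplex

namespace FacetComplex

variable {d : ℕ} {K L : Finset (Finset ℕ)}

/-- Each two consecutive members of the list span a facet together with `D`. -/
def Ladder (K : Finset (Finset ℕ)) (D : Finset ℕ) (l : List ℕ) : Prop :=
  l.IsChain fun a b => insert a (insert b D) ∈ K

theorem Ladder.mono {D : Finset ℕ} {l : List ℕ} (h : Ladder K D l)
    (hL : ∀ X ∈ K, D ⊆ X → (∀ p ∈ X, p ∈ D ∨ p ∈ l) → X ∈ L) : Ladder L D l := by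
  refine List.IsChain.imp_of_mem_imp (fun a b ha hb hab => hL _ hab (fun p hp => ?_) ?_) h
  · simp [hp]
  · intro p hp
    simp only [Finset.mem_insert] at hp
    rcases hp with rfl | rfl | hp
    · exact Or.inr ha
    · exact Or.inr hb
    · exact Or.inl hp

theorem Ladder.reverse {D : Finset ℕ} {l : List ℕ} (h : Ladder K D l) :
    Ladder K D l.reverse := by
  rw [Ladder, List.isChain_reverse]
  refine List.IsChain.imp (fun a b hab => ?_) h
  rwa [Finset.insert_comm]

theorem notMem_of_insert_insert (hK : IsPseudomanifold d K) {D : Finset ℕ} {a b : ℕ}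
    (hD : D.card + 2 = d) (h : insert a (insert b D) ∈ K) : a ∉ D ∧ b ∉ D ∧ a ≠ b := by
  have hc := hK.card_eq _ h
  have h1 := Finset.card_insert_le a (insert b D)
  have h2 := Finset.card_insert_le b D
  refine ⟨fun ha => ?_, fun hb => ?_, fun hab => ?_⟩
  · rw [Finset.insert_eq_of_mem (by simp [ha])] at hc; omega
  · rw [Finset.insert_eq_of_mem hb] at hc h1; omega
  · rw [Finset.insert_eq_of_mem (by simp [hab])] at hc; omega

theorem not_subset_of_mem {A X : Finset ℕ} {a : ℕ} (h : a ∈ A) (h' : a ∉ X) : ¬ A ⊆ X :=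
  fun hh => h' (hh h)

/-- The complex `L` arises from `K` by flips that join `u` to the vertices `ps` one after the
other; the facets in question contain `D` and two consecutive members of `init ++ [e]`. -/
structure IsFan (d u : ℕ) (D : Finset ℕ) (init : List ℕ) (e : ℕ) (ps : List ℕ)
    (K L : Finset (Finset ℕ)) : Prop where
  homeomorphic : Homeomorphic K L
  isPseudomanifold : IsPseudomanifold d L
  last_mem : insert u (insert e D) ∈ L
  ladder : ∀ δ ∈ D, Ladder L (insert u (D.erase δ)) (init ++ [e])
  mem_of : ∀ X ∈ K, (∀ p ∈ init, ¬ insert p D ⊆ X) → X ∈ L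
  adj : ∀ p q, Adj L p q ↔ Adj K p q ∨ (p = u ∧ q ∈ ps) ∨ (q = u ∧ p ∈ ps)

theorem exists_fan (hd : 4 ≤ d) {u : ℕ} {D : Finset ℕ} (hD : D.card + 2 = d) :
    ∀ (ps : List ℕ) (p₀ : ℕ) (init : List ℕ) (e : ℕ) (K : Finset (Finset ℕ)),
      p₀ :: ps = init ++ [e] → IsPseudomanifold d K → insert u (insert p₀ D) ∈ K →
      Ladder K D (p₀ :: ps) → (p₀ :: ps).Nodup → (∀ p ∈ ps, ¬ Adj K u p) →
      ∃ L, IsFan d u D init e ps K L := by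
  intro ps
  induction ps with
  | nil =>
    intro p₀ init e K he hK hu _ _ _
    obtain ⟨rfl, rfl⟩ : init = [] ∧ p₀ = e := by
      cases init with
      | nil => simpa using he
      | cons a l => simp at he
    exact ⟨K, Homeomorphic.refl K, hK, hu, fun δ _ => List.isChain_singleton _,
      fun X hX _ => hX, fun p q => by simp⟩
  | cons p₁ ps ih =>
    intro p₀ init e K he hK hu hlad hnd hadj
    obtain ⟨init, rfl, he₁⟩ : ∃ init', init = p₀ :: init' ∧ p₁ :: ps = init' ++ [e] := by
      cases init with
      | nil => simp at he
      | cons a l =>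
        rw [List.cons_append, List.cons.injEq] at he
        exact ⟨l, by rw [he.1], he.2⟩
    obtain ⟨hm, hlad⟩ := List.isChain_cons_cons.1 hlad
    obtain ⟨hn, hnd'⟩ := List.nodup_cons.1 hnd
    obtain ⟨h0, h1, h01⟩ := notMem_of_insert_insert hK hD hm
    obtain ⟨hu', -, hu0⟩ := notMem_of_insert_insert hK hD hu
    have hup₁ := hadj p₁ List.mem_cons_self
    have hu1 : u ≠ p₁ := by rintro rfl; exact hup₁ ⟨_, hm, by simp, by simp⟩
    have hf : CanFlip (insert p₀ D) u p₁ K :=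
      ⟨by simp [hu0, hu'], by simp [h01.symm, h1], hu, by rwa [Finset.insert_comm], hup₁⟩
    have hpers : ∀ X ∈ K, ¬ insert p₀ D ⊆ X → X ∈ flip (insert p₀ D) u p₁ K := fun X hX hs =>
      mem_flip.2 (Or.inl ⟨hX, fun h => hs (h ▸ Finset.subset_insert _ _),
        fun h => hs (h ▸ Finset.subset_insert _ _)⟩)
    have hadj' : ∀ p q, Adj (flip (insert p₀ D) u p₁ K) p q ↔ _ := fun p q => adj_flip hd hK hf
    obtain ⟨L, hL⟩ := ih p₁ init e (flip (insert p₀ D) u p₁ K) he₁ (hK.flip (by omega) hf)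
      (mem_flip.2 (Or.inr ⟨p₀, by simp, by rw [Finset.erase_insert h0]⟩))
      (Ladder.mono hlad fun X hX _ hX' => hpers X hX
        (not_subset_of_mem (Finset.mem_insert_self _ _) fun h => (hX' _ h).elim h0 hn)) hnd' (by
        intro p hp
        rw [hadj']
        rintro (h | ⟨-, rfl⟩ | ⟨rfl, -⟩)
        · exact hadj p (List.mem_cons_of_mem _ hp) h
        · exact (List.nodup_cons.1 hnd').1 hp
        · exact hu1 rfl)
    refine ⟨L, (homeomorphic_flip (by omega) hK hf).trans hL.homeomorphic, hL.isPseudomanifold,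
      hL.last_mem, ?_, ?_, ?_⟩
    · intro δ hδ
      have hp0 : p₀ ≠ δ := by rintro rfl; exact h0 hδ
      have hp1 : p₁ ≠ δ := by rintro rfl; exact h1 hδ
      have huδ : u ≠ δ := by rintro rfl; exact hu' hδ
      have h := hL.ladder δ hδ
      rw [List.cons_append, ← he₁]
      rw [← he₁] at h
      refine List.isChain_cons_cons.2 ⟨?_, h⟩
      have e1 : insert p₀ (insert p₁ (insert u (D.erase δ))) =
          insert u (insert p₁ ((insert p₀ D).erase δ)) := by
        rw [Finset.erase_insert_of_ne hp0, Finset.insert_comm p₁ u, Finset.insert_comm p₀ u,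
          Finset.insert_comm p₀ p₁]
      rw [e1]
      refine hL.mem_of _ (mem_flip.2 (Or.inr ⟨δ, by simp [hδ], rfl⟩)) fun p _ =>
        not_subset_of_mem (Finset.mem_insert_of_mem hδ) ?_
      simp [huδ.symm, hp1.symm]
    · intro X hX h
      exact hL.mem_of X (hpers X hX (h _ List.mem_cons_self))
        fun p hp => h p (List.mem_cons_of_mem _ hp)
    · intro p q
      rw [hL.adj, hadj', List.mem_cons, List.mem_cons]
      tauto

/-- The members of the cycle are the vertices outside of `Q`, and its consecutive members span a
facet together with `Q`. -/
structure IsRim (d : ℕ) (Q : Finset ℕ) (c : Cycle ℕ) (K : Finset (Finset ℕ)) : Prop where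
  isPseudomanifold : IsPseudomanifold d K
  card_add_two : Q.card + 2 = d
  nodup : c.Nodup
  chain : c.Chain fun a b => insert a (insert b Q) ∈ K
  mem_or : ∀ p, Adj K p p → p ∈ Q ∨ p ∈ c

theorem IsRim.exists_eq_coe {Q : Finset ℕ} {c : Cycle ℕ} (h : IsRim d Q c K) {x : ℕ}
    (hx : x ∈ c) : ∃ y l, c = ((x :: y :: l : List ℕ) : Cycle ℕ) := by
  induction c using Quotient.inductionOn with
  | _ l =>
  obtain ⟨l₁, l₂, rfl⟩ := List.append_of_mem (show x ∈ l from hx)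
  have e : ((l₁ ++ x :: l₂ : List ℕ) : Cycle ℕ) = ((x :: (l₂ ++ l₁) : List ℕ) : Cycle ℕ) := by
    rw [Cycle.coe_eq_coe, ← List.cons_append]
    exact List.isRotated_append
  have hc := h.chain
  change Cycle.Chain _ ((l₁ ++ x :: l₂ : List ℕ) : Cycle ℕ) at hc
  change ∃ y l, ((l₁ ++ x :: l₂ : List ℕ) : Cycle ℕ) = _
  rw [e] at hc ⊢
  cases hl : l₂ ++ l₁ with
  | nil =>
    rw [hl, Cycle.chain_singleton] at hc
    exact absurd rfl (notMem_of_insert_insert h.isPseudomanifold h.card_add_two hc).2.2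
  | cons y l => exact ⟨y, l, rfl⟩

theorem IsRim.notMem {Q : Finset ℕ} {c : Cycle ℕ} (h : IsRim d Q c K) {x : ℕ}
    (hx : x ∈ c) : x ∉ Q := by
  obtain ⟨y, l, rfl⟩ := h.exists_eq_coe hx
  have hc := h.chain
  rw [Cycle.chain_coe_cons, List.cons_append, List.isChain_cons_cons] at hc
  exact (notMem_of_insert_insert h.isPseudomanifold h.card_add_two hc.1).1

theorem IsRim.adj_of_mem {Q : Finset ℕ} {c : Cycle ℕ} (h : IsRim d Q c K) {x q : ℕ}
    (hx : x ∈ c) (hq : q ∈ Q) : Adj K x q := by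
  obtain ⟨y, l, rfl⟩ := h.exists_eq_coe hx
  have hc := h.chain
  rw [Cycle.chain_coe_cons, List.cons_append, List.isChain_cons_cons] at hc
  exact ⟨_, hc.1, by simp, by simp [hq]⟩

theorem mem_stellar_of_not_subset {σ X : Finset ℕ} {u : ℕ} (hX : X ∈ K) (h : ¬ σ ⊆ X) :
    X ∈ stellar σ u K := mem_stellar.2 (Or.inl ⟨hX, h⟩)

theorem insert_erase_mem_stellar {X₀ : Finset ℕ} {u : ℕ} (hX₀ : X₀ ∈ K) {f : ℕ} (hf : f ∈ X₀) :
    insert u (X₀.erase f) ∈ stellar X₀ u K :=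
  mem_stellar.2 (Or.inr ⟨X₀, hX₀, subset_rfl, f, hf, rfl⟩)

/-- After the subdivision of a facet, one can join the new vertex to further vertices of the
cycle one after the other. -/
theorem IsRim.exists_isFan (hd : 4 ≤ d) {Q : Finset ℕ} {x y : ℕ} {l : List ℕ}
    (h : IsRim d Q ((x :: y :: l : List ℕ) : Cycle ℕ) K) {z : ℕ} (hz : ¬ Adj K z z)
    {ps init : List ℕ} {e : ℕ} (hps : ps <+: l) (he : y :: ps = init ++ [e]) :
    ∃ L, IsFan d z Q init e ps (stellar (insert x (insert y Q)) z K) L := by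
  have hK := h.isPseudomanifold
  have hQ := h.card_add_two
  have hnd := h.nodup
  rw [Cycle.nodup_coe_iff] at hnd
  have hmemQ : ∀ p ∈ x :: y :: l, p ∉ Q := fun p hp => h.notMem hp
  have hc := h.chain
  rw [Cycle.chain_coe_cons, List.cons_append, List.isChain_cons_cons] at hc
  obtain ⟨hxy, hc⟩ := hc
  obtain ⟨q₀, hq₀⟩ : Q.Nonempty := Finset.card_pos.1 (by omega)
  have hzl : ∀ p ∈ x :: y :: l, p ≠ z := by
    rintro p hp rfl
    exact hz (h.adj_of_mem hp hq₀).left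
  have hpsl : y :: ps <+: y :: l := List.prefix_cons_inj y |>.2 hps
  obtain ⟨hxn, hnd'⟩ := List.nodup_cons.1 hnd
  obtain ⟨hyn, -⟩ := List.nodup_cons.1 hnd'
  have hxyne : x ≠ y := fun hh => hxn (by simp [hh])
  have hxQ := hmemQ x (by simp)
  have hlad : Ladder K Q (y :: l) := hc.left_of_append
  have hzQy : insert z (insert y Q) ∈ stellar (insert x (insert y Q)) z K := by
    have := insert_erase_mem_stellar (u := z) hxy (Finset.mem_insert_self _ _)
    rwa [Finset.erase_insert (by simp [hxyne, hxQ])] at this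
  refine exists_fan hd hQ ps y init e _ he (hK.stellar ⟨x, by simp⟩ hz) hzQy
    (Ladder.mono (hlad.prefix hpsl) fun X hX _ hX' => mem_stellar_of_not_subset hX
      (not_subset_of_mem (Finset.mem_insert_self _ _) fun hh =>
        (hX' x hh).elim hxQ fun hx => hxn (hpsl.mem hx))) (hnd'.sublist hpsl.sublist) ?_
  intro p hp
  replace hp : p ∈ l := hps.mem hp
  rw [adj_stellar_of_mem (by omega) hK hxy]
  rintro (hh | ⟨-, hh⟩ | ⟨rfl, -⟩)
  · exact hz hh.left
  · simp only [Finset.mem_insert] at hh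
    rcases hh with rfl | rfl | rfl | hh
    · exact hzl _ (by simp [hp]) rfl
    · exact hxn (by simp [hp])
    · exact hyn hp
    · exact hmemQ p (by simp [hp]) hh
  · exact hzl _ (by simp [hp]) rfl

/-- One can add a vertex that is adjacent to all vertices. -/
theorem IsRim.exists_cone (hd : 4 ≤ d) {Q : Finset ℕ} {x y : ℕ} {l : List ℕ}
    (h : IsRim d Q ((x :: y :: l : List ℕ) : Cycle ℕ) K) {z : ℕ} (hz : ¬ Adj K z z) :
    ∃ L, Homeomorphic K L ∧
      (∀ p q, Adj L p q ↔ Adj K p q ∨ (p = z ∧ (q = z ∨ Adj K q q)) ∨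
        (q = z ∧ (p = z ∨ Adj K p p))) ∧
      ∀ q ∈ Q, IsRim d (insert z (Q.erase q)) ((q :: x :: y :: l : List ℕ) : Cycle ℕ) L := by
  have hK := h.isPseudomanifold
  have hQ := h.card_add_two
  have hnd := h.nodup
  rw [Cycle.nodup_coe_iff] at hnd
  have hmemQ : ∀ p ∈ x :: y :: l, p ∉ Q := fun p hp => h.notMem hp
  have hvert : ∀ p ∈ x :: y :: l, ∀ q ∈ Q, Adj K p q := fun p hp q hq => h.adj_of_mem hp hq
  have hc := h.chain
  rw [Cycle.chain_coe_cons, List.cons_append, List.isChain_cons_cons] at hc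
  obtain ⟨hxy, hc⟩ := hc
  obtain ⟨q₀, hq₀⟩ : Q.Nonempty := Finset.card_pos.1 (by omega)
  have hzl : ∀ p ∈ x :: y :: l, p ≠ z := by
    rintro p hp rfl
    exact hz (hvert p hp q₀ hq₀).left
  have hzQ : z ∉ Q := fun hh => hz (hvert x (by simp) z hh).right
  obtain ⟨hxn, hnd'⟩ := List.nodup_cons.1 hnd
  obtain ⟨hyn, -⟩ := List.nodup_cons.1 hnd'
  have hxyne : x ≠ y := fun hh => hxn (by simp [hh])
  have hxQ := hmemQ x (by simp)
  have hyQ := hmemQ y (by simp)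
  have hzx := hzl x (by simp)
  have hzy := hzl y (by simp)
  obtain ⟨X₀, hX₀⟩ : ∃ X, X = insert x (insert y Q) := ⟨_, rfl⟩
  rw [← hX₀] at hxy
  have hxX₀ : x ∈ X₀ := by simp [hX₀]
  have hyX₀ : y ∈ X₀ := by simp [hX₀]
  have hadj₁ : ∀ p q, Adj (stellar X₀ z K) p q ↔ _ := fun p q =>
    adj_stellar_of_mem (by omega) hK hxy
  obtain ⟨init, e, he⟩ : ∃ init e, y :: l = init ++ [e] :=
    ⟨_, _, (List.dropLast_append_getLast (List.cons_ne_nil y l)).symm⟩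
  have hzQx : insert z (insert x Q) ∈ stellar X₀ z K := by
    have := insert_erase_mem_stellar (u := z) hxy hyX₀
    have e1 : X₀.erase y = insert x Q := by
      rw [hX₀, Finset.erase_insert_of_ne hxyne, Finset.erase_insert hyQ]
    rwa [e1] at this
  obtain ⟨L, hL⟩ := h.exists_isFan hd hz (List.prefix_refl l) he
  rw [← hX₀] at hL
  have hinit : ∀ p ∈ init, p ≠ x ∧ p ≠ z ∧ p ∉ Q ∧ p ≠ e := by
    intro p hp
    have h1 : p ∈ y :: l := by rw [he]; simp [hp]
    refine ⟨fun hh => hxn (hh ▸ h1), hzl p (List.mem_cons_of_mem _ h1),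
      hmemQ p (List.mem_cons_of_mem _ h1), ?_⟩
    rintro rfl
    rw [he, List.nodup_append] at hnd'
    exact hnd'.2.2 p hp p (by simp) rfl
  have hadj : ∀ p q, Adj L p q ↔ Adj K p q ∨ (p = z ∧ (q = z ∨ Adj K q q)) ∨
        (q = z ∧ (p = z ∨ Adj K p p)) := by
    have key : ∀ p, Adj K p p ↔ p ∈ X₀ ∨ p ∈ l := by
      intro p
      simp only [Finset.mem_insert, hX₀]
      constructor
      · intro hp
        have := h.mem_or p hp
        rw [Cycle.mem_coe_iff, List.mem_cons, List.mem_cons] at this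
        tauto
      · rintro ((rfl | rfl | hp) | hp)
        · exact (hvert p (by simp) q₀ hq₀).left
        · exact (hvert p (by simp) q₀ hq₀).left
        · exact (hvert x (by simp) p hp).right
        · exact (hvert p (by simp [hp]) q₀ hq₀).left
    intro p q
    rw [hL.adj, hadj₁, key, key, Finset.mem_insert, Finset.mem_insert]
    tauto
  refine ⟨L, (homeomorphic_stellar ⟨x, hxX₀⟩ hz (by
    simp [hX₀, hzx.symm, hzy.symm, hzQ])).trans hL.homeomorphic, hadj, ?_⟩
  intro q hq
  have hqz : q ≠ z := by rintro rfl; exact hzQ hq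
  have hqx : q ≠ x := by rintro rfl; exact hxQ hq
  have hqy : q ≠ y := by rintro rfl; exact hyQ hq
  refine ⟨hL.isPseudomanifold, ?_, ?_, ?_, ?_⟩
  · have := Finset.card_erase_add_one hq
    rw [Finset.card_insert_of_notMem (by simp [hzQ])]
    omega
  · rw [Cycle.nodup_coe_iff]
    exact List.nodup_cons.2 ⟨fun hh => hmemQ q hh hq, hnd⟩
  · rw [Cycle.chain_coe_cons, List.cons_append, List.cons_append, List.isChain_cons_cons,
      List.isChain_cons_cons, ← List.cons_append, he]
    refine ⟨?_, ?_, ?_⟩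
    · have e1 : insert q (insert x (insert z (Q.erase q))) = insert z (insert x Q) := by
        rw [Finset.insert_comm x z, Finset.insert_comm q z, Finset.insert_comm q x,
          Finset.insert_erase hq]
      rw [e1]
      refine hL.mem_of _ hzQx fun p hp => not_subset_of_mem (Finset.mem_insert_self _ _) ?_
      obtain ⟨h1, h2, h3, -⟩ := hinit p hp
      simp [h1, h2, h3]
    · have e1 : insert x (insert y (insert z (Q.erase q))) = insert z (X₀.erase q) := by
        rw [hX₀, Finset.erase_insert_of_ne hqx.symm, Finset.erase_insert_of_ne hqy.symm,
          Finset.insert_comm y z, Finset.insert_comm x z]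
      rw [e1]
      refine hL.mem_of _ (insert_erase_mem_stellar hxy (by simp [hX₀, hq])) fun p hp =>
        not_subset_of_mem (Finset.mem_insert_of_mem hq) (by simp [hqz])
    · rw [List.append_assoc, List.singleton_append, List.isChain_split]
      refine ⟨hL.ladder q hq, List.isChain_pair.2 ?_⟩
      have e1 : insert e (insert q (insert z (Q.erase q))) = insert z (insert e Q) := by
        rw [Finset.insert_comm q z, Finset.insert_comm e z, Finset.insert_erase hq]
      rw [e1]
      exact hL.last_mem
  · intro p hp
    rw [Cycle.mem_coe_iff, List.mem_cons, Finset.mem_insert, Finset.mem_erase]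
    by_cases hpz : p = z
    · exact Or.inl (Or.inl hpz)
    · rw [hadj] at hp
      have := h.mem_or p (by tauto)
      rw [Cycle.mem_coe_iff] at this
      tauto

end FacetComplex

namespace FacetComplex

variable {d : ℕ} {K L : Finset (Finset ℕ)}

/-- The complex `L` is homeomorphic to `K`, keeps all edges, and its new vertices are adjacent to
all vertices. -/
structure IsDenser (K L : Finset (Finset ℕ)) : Prop where
  homeomorphic : Homeomorphic K L
  mono : ∀ p q, Adj K p q → Adj L p q
  adj_of_not_adj : ∀ p q, Adj L p p → Adj L q q → ¬ Adj K p p → Adj L p q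

theorem IsDenser.trans {M : Finset (Finset ℕ)} (h : IsDenser K L) (h' : IsDenser L M) :
    IsDenser K M := by
  refine ⟨h.homeomorphic.trans h'.homeomorphic, fun p q hpq => h'.mono p q (h.mono p q hpq),
    fun p q hp hq hpK => ?_⟩
  by_cases hpL : Adj L p p
  · by_cases hqL : Adj L q q
    · exact h'.mono p q (h.adj_of_not_adj p q hpL hqL hpK)
    · exact (h'.adj_of_not_adj q p hq hp hqL).symm
  · exact h'.adj_of_not_adj p q hp hq hpL

theorem IsRim.adj_of_mem_cycle {Q : Finset ℕ} {c : Cycle ℕ} (h : IsRim d Q c K) {x : ℕ}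
    (hx : x ∈ c) : Adj K x x := by
  obtain ⟨y, l, rfl⟩ := h.exists_eq_coe hx
  have hc := h.chain
  rw [Cycle.chain_coe_cons, List.cons_append, List.isChain_cons_cons] at hc
  exact ⟨_, hc.1, by simp, by simp⟩

set_option maxHeartbeats 1000000 in
/-- The new edge `xy` is inserted at the vertex `v` of the cycle, and then a cone is added. -/
theorem IsRim.exists_isDenser_adj (hd : 4 ≤ d) {E : Finset ℕ} {x y v z : ℕ} {l : List ℕ}
    (hz : z ∉ E)
    (h : IsRim d (insert z E) ((x :: (l ++ [y, v]) : List ℕ) : Cycle ℕ) K) (hxy : ¬ Adj K x y) :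
    ∃ L Q c, IsRim d Q c L ∧ IsDenser K L ∧ Adj L x y := by
  have hK := h.isPseudomanifold
  have hQ := h.card_add_two
  have hnd := h.nodup
  rw [Cycle.nodup_coe_iff] at hnd
  have hmemQ : ∀ p ∈ x :: (l ++ [y, v]), p ∉ insert z E := fun p hp => h.notMem hp
  have hvert : ∀ p ∈ x :: (l ++ [y, v]), Adj K p p := fun p hp => h.adj_of_mem_cycle hp
  have hvertQ : ∀ p ∈ insert z E, Adj K p p := fun p hp =>
    (h.adj_of_mem (x := x) (by simp) hp).right
  have hc := h.chain
  rw [Cycle.chain_coe_cons, show l ++ [y, v] ++ [x] = l ++ y :: [v, x] by simp,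
    ← List.cons_append, List.isChain_split] at hc
  obtain ⟨hc1, hc2⟩ := hc
  rw [List.isChain_cons_cons, List.isChain_pair] at hc2
  obtain ⟨hyv, hvx⟩ := hc2
  have hlad : Ladder K (insert z E) (x :: l) := hc1.left_of_append
  have hcE : E.card + 3 = d := by
    rw [Finset.card_insert_of_notMem hz] at hQ; omega
  obtain ⟨hxn, hnd'⟩ := List.nodup_cons.1 hnd
  obtain ⟨hndl, hndyv, hdisj⟩ := List.nodup_append.1 hnd'
  simp only [List.mem_append, List.mem_cons, List.not_mem_nil, or_false, not_or] at hxn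
  obtain ⟨hxl, hxy', hxv⟩ := hxn
  replace hxv : x ≠ v := hxv
  have hyv' : y ≠ v := by simpa using hndyv
  have hlE : ∀ p ∈ l, p ∉ insert z E := fun p hp => hmemQ p (by simp [hp])
  have hly : y ∉ l := fun hh => hdisj y hh y (by simp) rfl
  have hlv : v ∉ l := fun hh => hdisj v hh v (by simp) rfl
  have hxE : x ∉ E ∧ x ≠ z := by
    have := hmemQ x (by simp); simp only [Finset.mem_insert, not_or] at this; tauto
  have hyE : y ∉ E ∧ y ≠ z := by
    have := hmemQ y (by simp); simp only [Finset.mem_insert, not_or] at this; tauto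
  have hvE : v ∉ E ∧ v ≠ z := by
    have := hmemQ v (by simp); simp only [Finset.mem_insert, not_or] at this; tauto
  have hzl : z ∉ l := fun hh => hlE z hh (Finset.mem_insert_self _ _)
  -- the flip
  obtain ⟨Q, hQdef⟩ : ∃ Q, Q = insert z E := ⟨_, rfl⟩
  rw [← hQdef] at hyv hvx hlad hQ hvertQ hmemQ
  have hxQ : x ∉ Q := hmemQ x (by simp)
  have hyQ : y ∉ Q := hmemQ y (by simp)
  have hvQ : v ∉ Q := hmemQ v (by simp)
  have hf : CanFlip (insert v Q) x y K :=
    ⟨by simp [hxv, hxQ], by simp [hyv', hyQ], by rwa [Finset.insert_comm], hyv, hxy⟩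
  obtain ⟨K₁, hK₁⟩ : ∃ K₁, K₁ = flip (insert v Q) x y K := ⟨_, rfl⟩
  have hp₁ : ∀ X ∈ K, v ∉ X → X ∈ K₁ := by
    intro X hX hv
    rw [hK₁]
    exact mem_flip.2 (Or.inl ⟨hX, fun hh => hv (by simp [hh]), fun hh => hv (by simp [hh])⟩)
  have hadj₁ : ∀ p q, Adj K₁ p q ↔ Adj K p q ∨ (p = x ∧ q = y) ∨ (p = y ∧ q = x) :=
    fun p q => by rw [hK₁]; exact adj_flip hd hK hf
  have hPM₁ : IsPseudomanifold d K₁ := hK₁ ▸ hK.flip (by omega) hf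
  have hhom₁ : Homeomorphic K K₁ := hK₁ ▸ homeomorphic_flip (by omega) hK hf
  have hX₀ : insert x (insert y Q) ∈ K₁ := by
    rw [hK₁]
    exact mem_flip.2 (Or.inr ⟨v, by simp, by rw [Finset.erase_insert hvQ]⟩)
  have hxyvE : insert x (insert y (insert v E)) ∈ K₁ := by
    rw [hK₁]
    refine mem_flip.2 (Or.inr ⟨z, by simp [hQdef], ?_⟩)
    rw [hQdef, Finset.erase_insert_of_ne hvE.2, Finset.erase_insert hz]
  -- the subdivision
  obtain ⟨t, ht⟩ := exists_not_adj_self K₁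
  have htK : ∀ p, Adj K p p → t ≠ p := by
    rintro p hp rfl
    exact ht ((hadj₁ _ _).2 (Or.inl hp))
  have htx : t ≠ x := htK x (hvert x (by simp))
  have hty : t ≠ y := htK y (hvert y (by simp))
  have htv : t ≠ v := htK v (hvert v (by simp))
  have htz : t ≠ z := htK z (hvertQ z (by simp [hQdef]))
  have htE : t ∉ E := fun hh => htK t (hvertQ t (by simp [hQdef, hh])) rfl
  have htl : t ∉ l := fun hh => htK t (hvert t (by simp [hh])) rfl
  have hlt : ∀ p ∈ l, p ≠ t := by rintro p hp rfl; exact htl hp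
  obtain ⟨K₂, hK₂⟩ : ∃ K₂, K₂ = stellar (insert x (insert y Q)) t K₁ := ⟨_, rfl⟩
  have hPM₂ : IsPseudomanifold d K₂ := hK₂ ▸ hPM₁.stellar ⟨x, by simp⟩ ht
  have hadj₂ : ∀ p q, Adj K₂ p q ↔ Adj K₁ p q ∨ (p = t ∧ q ∈ insert t (insert x (insert y Q))) ∨
      (q = t ∧ p ∈ insert t (insert x (insert y Q))) := fun p q => by
    rw [hK₂]; exact adj_stellar_of_mem (by omega) hPM₁ hX₀
  have hhom₂ : Homeomorphic K₁ K₂ := hK₂ ▸ homeomorphic_stellar ⟨x, by simp⟩ ht (by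
    simp [hQdef, htx, hty, htz, htE])
  have hp₂ : ∀ X ∈ K₁, ∀ a ∈ insert x (insert y Q), a ∉ X → X ∈ K₂ := by
    intro X hX a ha haX
    rw [hK₂]
    exact mem_stellar_of_not_subset hX (not_subset_of_mem ha haX)
  have hnew₂ : ∀ f ∈ insert x (insert y Q), insert t ((insert x (insert y Q)).erase f) ∈ K₂ := by
    intro f hf
    rw [hK₂]
    exact insert_erase_mem_stellar hX₀ hf
  have htQx : insert t (insert x Q) ∈ K₂ := by
    have := hnew₂ y (by simp)
    rwa [Finset.erase_insert_of_ne hxy', Finset.erase_insert hyQ] at this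
  have htQy : insert t (insert y Q) ∈ K₂ := by
    have := hnew₂ x (by simp)
    rwa [Finset.erase_insert (by simp [hxy', hxQ])] at this
  have htxyE : insert t (insert x (insert y E)) ∈ K₂ := by
    have := hnew₂ z (by simp [hQdef])
    rwa [Finset.erase_insert_of_ne hxE.2, Finset.erase_insert_of_ne hyE.2, hQdef,
      Finset.erase_insert hz] at this
  -- the long fan
  obtain ⟨init, e, he⟩ : ∃ init e, x :: l = init ++ [e] :=
    ⟨_, _, (List.dropLast_append_getLast (List.cons_ne_nil x l)).symm⟩
  have hinit : ∀ p ∈ init, p = x ∨ p ∈ l := by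
    intro p hp
    have : p ∈ x :: l := by rw [he]; simp [hp]
    simpa using this
  obtain ⟨K₃, hF₃⟩ := exists_fan hd hQ l x init e K₂ he hPM₂ htQx (by
      refine hlad.mono fun X hX _ hX' => hp₂ X (hp₁ X hX fun hh => ?_) y (by simp) fun hh => ?_
      · rcases hX' v hh with h' | h'
        · exact hvQ h'
        · simp [hxv.symm, hlv] at h'
      · rcases hX' y hh with h' | h'
        · exact hyQ h'
        · simp [Ne.symm hxy', hly] at h')
    (List.nodup_cons.2 ⟨hxl, hndl⟩) (by
      intro p hp
      rw [hadj₂]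
      rintro (hh | ⟨-, hh⟩ | ⟨rfl, -⟩)
      · exact ht hh.left
      · simp only [Finset.mem_insert] at hh
        rcases hh with rfl | rfl | rfl | hh
        · exact htl hp
        · exact hxl hp
        · exact hly hp
        · exact hmemQ p (by simp [hp]) hh
      · exact htl hp)
  have hp₃ : ∀ X ∈ K₂, ∀ a ∈ Q, a ∉ X → X ∈ K₃ := fun X hX a ha haX =>
    hF₃.mem_of X hX fun p _ => not_subset_of_mem (Finset.mem_insert_of_mem ha) haX
  -- the short fan
  have hzQ : z ∈ Q := by simp [hQdef]
  obtain ⟨L, hF₄⟩ := exists_fan hd (u := t) (D := insert y E)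
    (by rw [Finset.card_insert_of_notMem hyE.1]; omega) [v] x [x] v K₃ rfl hF₃.isPseudomanifold
    (hp₃ _ htxyE z hzQ (by simp [htz.symm, hxE.2.symm, hyE.2.symm, hz]))
    (List.isChain_pair.2 (hp₃ _ (hp₂ _ (by rwa [Finset.insert_comm v y]) z (by simp [hzQ])
      (by simp [hxE.2.symm, hyE.2.symm, hvE.2.symm, hz])) z hzQ
      (by simp [hxE.2.symm, hyE.2.symm, hvE.2.symm, hz]))) (by simp [hxv]) (by
      intro p hp
      rw [List.mem_singleton.1 hp, hF₃.adj, hadj₂]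
      rintro ((hh | ⟨-, hh⟩ | ⟨rfl, -⟩) | ⟨-, hh⟩ | ⟨rfl, -⟩)
      · exact ht hh.left
      · simp [htv.symm, hxv.symm, hyv'.symm, hvQ] at hh
      · exact htv rfl
      · exact hlv hh
      · exact htv rfl)
  have hp₄ : ∀ X ∈ K₃, ∀ a, a = x ∨ a = y → a ∉ X → X ∈ L := by
    rintro X hX a ha haX
    refine hF₄.mem_of X hX fun p hp => not_subset_of_mem ?_ haX
    rw [List.mem_singleton.1 hp]
    rcases ha with rfl | rfl <;> simp
  have htQe : insert t (insert e Q) ∈ L := by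
    refine hp₄ _ hF₃.last_mem y (Or.inr rfl) ?_
    have hel : e ∈ x :: l := by rw [he]; simp
    have : y ≠ e := by
      rintro rfl
      simp [Ne.symm hxy', hly] at hel
    simp [hty.symm, this, hyQ]
  have hladL : Ladder L (insert t E) (x :: l) := by
    have := hF₃.ladder z hzQ
    rw [← he, hQdef, Finset.erase_insert hz] at this
    refine this.mono fun X hX _ hX' => hp₄ X hX y (Or.inr rfl) fun hh => ?_
    have := hX' y hh
    simp [hty.symm, hyE.1, Ne.symm hxy', hly] at this
  have htQy' : insert t (insert y Q) ∈ L := by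
    refine hp₄ _ (hF₃.mem_of _ htQy fun p hp => ?_) x (Or.inl rfl)
      (by simp [htx.symm, hxy', hxQ])
    refine not_subset_of_mem (Finset.mem_insert_self _ _) ?_
    rcases hinit p hp with rfl | hp
    · simp [htx.symm, hxy', hxQ]
    · have h1 : p ≠ y := by rintro rfl; exact hly hp
      have h2 : p ∉ Q := hmemQ p (by simp [hp])
      simp [hlt p hp, h1, h2]
  have hyvL : insert y (insert v (insert t E)) ∈ L := by
    have := hF₄.last_mem
    rwa [Finset.insert_comm t v, Finset.insert_comm t y, Finset.insert_comm v y] at this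
  have hvxL : insert v (insert x (insert t E)) ∈ L := by
    have := hF₄.ladder y (by simp)
    rw [Finset.erase_insert hyE.1, Ladder, List.singleton_append, List.isChain_pair] at this
    rwa [Finset.insert_comm v x]
  have hadj : ∀ p q, Adj L p q ↔ Adj K p q ∨ (p = x ∧ q = y) ∨ (p = y ∧ q = x) ∨
      (p = t ∧ q ∈ insert t (insert x (insert y Q)) ∪ l.toFinset ∪ {v}) ∨
      (q = t ∧ p ∈ insert t (insert x (insert y Q)) ∪ l.toFinset ∪ {v}) := by
    intro p q
    rw [hF₄.adj, hF₃.adj, hadj₂, hadj₁]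
    simp only [Finset.mem_union, Finset.mem_singleton, List.mem_toFinset, List.mem_singleton]
    clear * -
    tauto
  have hmem : ∀ p, Adj K p p → p ∈ insert t (insert x (insert y Q)) ∪ l.toFinset ∪ {v} := by
    intro p hp
    have := h.mem_or p hp
    rw [← hQdef] at this
    simp only [Finset.mem_union, Finset.mem_singleton, List.mem_toFinset, Cycle.mem_coe_iff,
      List.mem_cons, List.mem_append, Finset.mem_insert, List.not_mem_nil, or_false] at this ⊢
    clear * - this
    tauto
  have hverts : ∀ p, Adj L p p → p = t ∨ Adj K p p := by
    intro p hp
    rcases (hadj p p).1 hp with hp | ⟨rfl, -⟩ | ⟨rfl, -⟩ | ⟨rfl, -⟩ | ⟨rfl, -⟩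
    · exact Or.inr hp
    · exact Or.inr (hvert _ (by simp))
    · exact Or.inr (hvert _ (by simp))
    · exact Or.inl rfl
    · exact Or.inl rfl
  refine ⟨L, insert t E, ((x :: (l ++ [z, y, v]) : List ℕ) : Cycle ℕ),
    ⟨hF₄.isPseudomanifold, ?_, ?_, ?_, ?_⟩, ⟨?_, ?_, ?_⟩, ?_⟩
  · rw [Finset.card_insert_of_notMem htE]; omega
  · rw [Cycle.nodup_coe_iff]
    have hp : (x :: (l ++ [z, y, v])).Perm (z :: x :: (l ++ [y, v])) := by
      rw [List.perm_iff_count]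
      intro a
      simp only [List.count_cons, List.count_append, List.count_nil]
      ring
    rw [hp.nodup_iff]
    exact List.nodup_cons.2 ⟨fun hh => hmemQ z hh hzQ, hnd⟩
  · rw [Cycle.chain_coe_cons, show l ++ [z, y, v] ++ [x] = l ++ z :: [y, v, x] by simp,
      ← List.cons_append, List.isChain_split]
    refine ⟨?_, ?_⟩
    · rw [he, List.append_assoc, List.singleton_append, List.isChain_split, ← he]
      refine ⟨hladL, List.isChain_pair.2 ?_⟩
      have e1 : insert e (insert z (insert t E)) = insert t (insert e Q) := by
        rw [hQdef, Finset.insert_comm z t, Finset.insert_comm e t]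
      rwa [e1]
    · rw [List.isChain_cons_cons, List.isChain_cons_cons, List.isChain_pair]
      refine ⟨?_, hyvL, hvxL⟩
      have e1 : insert z (insert y (insert t E)) = insert t (insert y Q) := by
        rw [hQdef, Finset.insert_comm y t, Finset.insert_comm z t, Finset.insert_comm z y]
      rwa [e1]
  · intro p hp
    rcases hverts p hp with rfl | hp
    · exact Or.inl (Finset.mem_insert_self _ _)
    · have := h.mem_or p hp
      simp only [Cycle.mem_coe_iff, List.mem_cons, List.mem_append, Finset.mem_insert] at this ⊢
      clear * - this
      tauto
  · exact ((hhom₁.trans hhom₂).trans hF₃.homeomorphic).trans hF₄.homeomorphic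
  · exact fun p q hpq => (hadj p q).2 (Or.inl hpq)
  · intro p q hp hq hpK
    obtain rfl := (hverts p hp).resolve_right hpK
    refine (hadj _ _).2 (Or.inr (Or.inr (Or.inr (Or.inl ⟨rfl, ?_⟩))))
    rcases hverts q hq with rfl | hq
    · simp
    · exact hmem q hq
  · exact (hadj _ _).2 (Or.inr (Or.inl ⟨rfl, rfl⟩))

end FacetComplex

namespace FacetComplex

variable {d : ℕ} {K L : Finset (Finset ℕ)}

theorem IsRim.exists_isDenser_cone (hd : 4 ≤ d) {Q : Finset ℕ} {x y : ℕ} {l : List ℕ}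
    (h : IsRim d Q ((x :: y :: l : List ℕ) : Cycle ℕ) K) {z : ℕ} (hz : ¬ Adj K z z) :
    ∃ L, IsDenser K L ∧ (∀ p q, Adj L p q ↔ Adj K p q ∨ (p = z ∧ (q = z ∨ Adj K q q)) ∨
        (q = z ∧ (p = z ∨ Adj K p p))) ∧
      ∀ q ∈ Q, IsRim d (insert z (Q.erase q)) ((q :: x :: y :: l : List ℕ) : Cycle ℕ) L := by
  obtain ⟨L, hL, hadj, hrim⟩ := h.exists_cone hd hz
  refine ⟨L, ⟨hL, fun p q hpq => (hadj p q).2 (Or.inl hpq), fun p q hp hq hpK => ?_⟩, hadj, hrim⟩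
  rw [hadj] at hp hq ⊢
  tauto

set_option maxHeartbeats 1000000 in
/-- The cycle can be changed such that `x` and `y` have a common neighbor in it. -/
theorem IsRim.exists_isDenser_common (hd : 4 ≤ d) {D : Finset ℕ} {x y v w : ℕ} {A s : List ℕ}
    (hA : A ≠ []) (hvw : v ≠ w) (hvD : v ∉ D) (hwD : w ∉ D)
    (h : IsRim d (insert v (insert w D)) ((x :: (A ++ y :: s) : List ℕ) : Cycle ℕ) K)
    (hxy : ¬ Adj K x y) :
    ∃ L z u, z ∉ insert u D ∧ ¬ Adj L x y ∧ IsDenser K L ∧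
      IsRim d (insert z (insert u D)) ((x :: (A ++ w :: s.reverse ++ [y, v]) : List ℕ) : Cycle ℕ)
        L := by
  have hQ := h.card_add_two
  have hcD : D.card + 4 = d := by
    rw [Finset.card_insert_of_notMem (by simp [hvw, hvD]), Finset.card_insert_of_notMem hwD] at hQ
    omega
  have hnd := h.nodup
  rw [Cycle.nodup_coe_iff] at hnd
  have hmem : ∀ p ∈ x :: (A ++ y :: s), p ∉ D ∧ p ≠ v ∧ p ≠ w := fun p hp => by
    have := h.notMem hp
    simp only [Finset.mem_insert, not_or] at this
    tauto
  have hvert : ∀ p ∈ x :: (A ++ y :: s), Adj K p p := fun p hp => h.adj_of_mem_cycle hp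
  have hvertQ : ∀ p ∈ insert v (insert w D), Adj K p p := fun p hp =>
    (h.adj_of_mem (x := x) (by simp) hp).right
  obtain ⟨hxn, hnd'⟩ := List.nodup_cons.1 hnd
  obtain ⟨hndA, hndys, hdisj⟩ := List.nodup_append.1 hnd'
  obtain ⟨hys, hnds⟩ := List.nodup_cons.1 hndys
  simp only [List.mem_append, List.mem_cons, not_or] at hxn
  obtain ⟨hxA, hxy', hxs⟩ := hxn
  replace hxy' : x ≠ y := hxy'
  have hAy : y ∉ A := fun hh => hdisj y hh y (by simp) rfl
  have hAs : ∀ p ∈ A, p ∉ s := fun p hp hh => hdisj p hp p (by simp [hh]) rfl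
  obtain ⟨hxD, hxv, hxw⟩ := hmem x (by simp)
  obtain ⟨hyD, hyv, hyw⟩ := hmem y (by simp)
  have hmemA : ∀ p ∈ A, p ∉ D ∧ p ≠ v ∧ p ≠ w := fun p hp => hmem p (by simp [hp])
  have hmems : ∀ p ∈ s, p ∉ D ∧ p ≠ v ∧ p ≠ w := fun p hp => hmem p (by simp [hp])
  obtain ⟨a, A', hAa⟩ := List.exists_cons_of_ne_nil hA
  obtain ⟨I, b, hAb⟩ : ∃ I b, A = I ++ [b] := ⟨_, _, (List.dropLast_append_getLast hA).symm⟩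
  obtain ⟨J, e, hJe⟩ : ∃ J e, y :: s = J ++ [e] :=
    ⟨_, _, (List.dropLast_append_getLast (List.cons_ne_nil y s)).symm⟩
  have haA : a ∈ A := by simp [hAa]
  have hbA : b ∈ A := by simp [hAb]
  have hJ : ∀ p ∈ J, p = y ∨ p ∈ s := by
    intro p hp
    have : p ∈ y :: s := by rw [hJe]; simp [hp]
    simpa using this
  have he : e = y ∨ e ∈ s := by
    have : e ∈ y :: s := by rw [hJe]; simp
    simpa using this
  -- the first cone
  obtain ⟨z, hz⟩ := exists_not_adj_self K
  have hzK : ∀ p, Adj K p p → z ≠ p := by rintro p hp rfl; exact hz hp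
  have hzx : z ≠ x := hzK x (hvert x (by simp))
  have hzy : z ≠ y := hzK y (hvert y (by simp))
  have hzv : z ≠ v := hzK v (hvertQ v (by simp))
  have hzw : z ≠ w := hzK w (hvertQ w (by simp))
  have hzD : z ∉ D := fun hh => hzK z (hvertQ z (by simp [hh])) rfl
  have hzA : z ∉ A := fun hh => hzK z (hvert z (by simp [hh])) rfl
  have hzs : z ∉ s := fun hh => hzK z (hvert z (by simp [hh])) rfl
  have hrim := h
  rw [hAa, List.cons_append] at hrim
  obtain ⟨K₁, hden₁, hadj₁, hrim₁⟩ := hrim.exists_isDenser_cone hd hz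
  have hr₁ := hrim₁ w (by simp)
  have hr₂ := hrim₁ v (by simp)
  rw [Finset.erase_insert_of_ne hvw, Finset.erase_insert hwD] at hr₁
  rw [Finset.erase_insert (by simp [hvw, hvD])] at hr₂
  have hPM₁ := hr₁.isPseudomanifold
  have hc₁ := hr₁.chain
  rw [Cycle.chain_coe_cons, List.cons_append, List.isChain_cons_cons, List.cons_append,
    List.isChain_cons_cons] at hc₁
  obtain ⟨-, hX₀, hc₁⟩ := hc₁
  have hlad₁ : Ladder K₁ (insert z (insert v D)) (A ++ [y]) := by
    have e1 : a :: (A' ++ y :: s ++ [w]) = A ++ [y] ++ (s ++ [w]) := by simp [hAa]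
    rw [e1] at hc₁
    exact hc₁.left_of_append
  have hc₂ := hr₂.chain
  rw [Cycle.chain_coe_cons, List.cons_append, List.isChain_cons_cons, List.cons_append,
    List.isChain_cons_cons] at hc₂
  obtain ⟨-, -, hc₂⟩ := hc₂
  have hc₃ : List.IsChain (fun p q => insert p (insert q (insert z (insert w D))) ∈ K₁)
      (b :: y :: s) := by
    have e1 : a :: (A' ++ y :: s ++ [v]) = I ++ ((b :: y :: s) ++ [v]) := by
      rw [← List.cons_append, ← List.cons_append, ← hAa, hAb]; simp
    rw [e1] at hc₂
    exact hc₂.right_of_append.left_of_append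
  obtain ⟨hbyQ, hlad₂⟩ := List.isChain_cons_cons.1 hc₃
  -- the subdivision
  obtain ⟨u, hu⟩ := exists_not_adj_self K₁
  have huK : ∀ p, Adj K p p → u ≠ p := by
    rintro p hp rfl
    exact hu (hden₁.mono _ _ hp)
  have hux : u ≠ x := huK x (hvert x (by simp))
  have huy : u ≠ y := huK y (hvert y (by simp))
  have huv : u ≠ v := huK v (hvertQ v (by simp))
  have huw : u ≠ w := huK w (hvertQ w (by simp))
  have huz : u ≠ z := by
    rintro rfl
    exact hu ((hadj₁ _ _).2 (by simp))
  have huD : u ∉ D := fun hh => huK u (hvertQ u (by simp [hh])) rfl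
  have huA : u ∉ A := fun hh => huK u (hvert u (by simp [hh])) rfl
  have hus : u ∉ s := fun hh => huK u (hvert u (by simp [hh])) rfl
  have hna : ∀ p ∈ A, p ≠ x ∧ p ≠ y ∧ p ≠ z ∧ p ≠ u := by
    intro p hp
    refine ⟨?_, ?_, ?_, ?_⟩ <;> rintro rfl <;> contradiction
  have hns : ∀ p ∈ s, p ≠ x ∧ p ≠ y ∧ p ≠ z ∧ p ≠ u := by
    intro p hp
    refine ⟨?_, ?_, ?_, ?_⟩ <;> rintro rfl <;> contradiction
  obtain ⟨hax, hay, haz, hau⟩ := hna a haA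
  obtain ⟨hbx, hby, hbz, hbu⟩ := hna b hbA
  obtain ⟨haD, hav, haw⟩ := hmemA a haA
  obtain ⟨hbD, hbv, hbw⟩ := hmemA b hbA
  obtain ⟨K₂, hK₂⟩ : ∃ K₂, K₂ = stellar (insert x (insert a (insert z (insert v D)))) u K₁ :=
    ⟨_, rfl⟩
  have hPM₂ : IsPseudomanifold d K₂ := hK₂ ▸ hPM₁.stellar ⟨x, by simp⟩ hu
  have hadj₂ : ∀ p q, Adj K₂ p q ↔ Adj K₁ p q ∨
      (p = u ∧ q ∈ insert u (insert x (insert a (insert z (insert v D))))) ∨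
      (q = u ∧ p ∈ insert u (insert x (insert a (insert z (insert v D))))) := fun p q => by
    rw [hK₂]; exact adj_stellar_of_mem (by omega) hPM₁ hX₀
  have hhom₂ : Homeomorphic K₁ K₂ := hK₂ ▸ homeomorphic_stellar ⟨x, by simp⟩ hu (by
    simp [hux, hau.symm, huz, huv, huD])
  have hp₂ : ∀ X ∈ K₁, x ∉ X → X ∈ K₂ := by
    intro X hX hxX
    rw [hK₂]
    exact mem_stellar_of_not_subset hX (not_subset_of_mem (Finset.mem_insert_self _ _) hxX)
  have hnew₂ : ∀ f ∈ insert x (insert a (insert z (insert v D))),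
      insert u ((insert x (insert a (insert z (insert v D)))).erase f) ∈ K₂ := by
    intro f hf
    rw [hK₂]
    exact insert_erase_mem_stellar hX₀ hf
  have h2x : insert u (insert x (insert z (insert v D))) ∈ K₂ := by
    have := hnew₂ a (by simp)
    rwa [Finset.erase_insert_of_ne hax.symm, Finset.erase_insert (by simp [haz, hav, haD])] at this
  have h2a : insert u (insert a (insert z (insert v D))) ∈ K₂ := by
    have := hnew₂ x (by simp)
    rwa [Finset.erase_insert (by simp [hax.symm, hzx.symm, hxv, hxD])] at this
  have h2xa : insert u (insert x (insert a (insert z D))) ∈ K₂ := by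
    have := hnew₂ v (by simp)
    rwa [Finset.erase_insert_of_ne hxv, Finset.erase_insert_of_ne hav,
      Finset.erase_insert_of_ne hzv, Finset.erase_insert hvD] at this
  -- the first fan
  obtain ⟨K₃, hF₃⟩ := exists_fan hd hr₁.card_add_two (A' ++ [y]) a A y K₂ (by simp [hAa]) hPM₂ h2a
    (by
      have hlad₁' := hlad₁
      rw [hAa, List.cons_append] at hlad₁'
      refine hlad₁'.mono fun X hX _ hX' => hp₂ X hX fun hh => ?_
      have := hX' x hh
      rw [← List.cons_append, ← hAa] at this
      simp [hzx.symm, hxv, hxD, hxA, hxy'] at this)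
    (by
      rw [← List.cons_append, ← hAa, List.nodup_append]
      refine ⟨hndA, by simp, fun p hp q hq => ?_⟩
      rw [List.mem_singleton.1 hq]
      exact (hna p hp).2.1) (by
      intro p hp
      have hp' : p ≠ a ∧ (p ∈ A ∨ p = y) := by
        rcases List.mem_append.1 hp with hp | hp
        · rw [hAa] at hndA
          exact ⟨by rintro rfl; exact (List.nodup_cons.1 hndA).1 hp, Or.inl (by simp [hAa, hp])⟩
        · rw [List.mem_singleton.1 hp]
          exact ⟨hay.symm, Or.inr rfl⟩
      have hp'' : p ≠ u ∧ p ≠ x ∧ p ≠ z ∧ p ≠ v ∧ p ∉ D := by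
        rcases hp'.2 with hp | rfl
        · exact ⟨(hna p hp).2.2.2, (hna p hp).1, (hna p hp).2.2.1, (hmemA p hp).2.1,
            (hmemA p hp).1⟩
        · exact ⟨huy.symm, hxy'.symm, hzy.symm, hyv, hyD⟩
      rw [hadj₂]
      rintro (hh | ⟨-, hh⟩ | ⟨rfl, -⟩)
      · exact hu hh.left
      · simp [hp', hp''] at hh
      · exact hp''.1 rfl)
  have hp₃ : ∀ X ∈ K₂, z ∉ X ∨ v ∉ X → X ∈ K₃ := fun X hX hzv => hF₃.mem_of X hX fun p _ => by
    rcases hzv with hh | hh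
    · exact not_subset_of_mem (by simp) hh
    · exact not_subset_of_mem (by simp) hh
  have hlad₃ : Ladder K₃ (insert u (insert z D)) (A ++ [y]) := by
    have := hF₃.ladder v (by simp)
    rwa [Finset.erase_insert_of_ne hzv, Finset.erase_insert hvD] at this
  -- the short fan
  have hb₃ : insert u (insert b (insert z (insert y D))) ∈ K₃ := by
    have := hlad₃
    rw [hAb, List.append_assoc] at this
    have := List.isChain_pair.1 this.right_of_append
    rwa [show insert u (insert b (insert z (insert y D))) =
      insert b (insert y (insert u (insert z D))) by
        rw [Finset.insert_comm y u, Finset.insert_comm b u, Finset.insert_comm y z]]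
  obtain ⟨K₄, hF₄⟩ := exists_fan hd (u := u) (D := insert z (insert y D))
    (by rw [Finset.card_insert_of_notMem (by simp [hzy, hzD]), Finset.card_insert_of_notMem hyD]
        omega) [w] b [b] w K₃ rfl hF₃.isPseudomanifold hb₃
    (List.isChain_pair.2 (by
      have e1 : insert b (insert w (insert z (insert y D))) =
          insert b (insert y (insert z (insert w D))) := by
        rw [Finset.insert_comm z y, Finset.insert_comm w y, Finset.insert_comm w z]
      rw [e1]
      exact hp₃ _ (hp₂ _ hbyQ (by simp [hbx.symm, hxy', hzx.symm, hxw, hxD]))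
        (Or.inr (by simp [hbv.symm, hyv.symm, hzv.symm, hvw, hvD])))) (by simp [hbw]) (by
      intro p hp
      rw [List.mem_singleton.1 hp, hF₃.adj, hadj₂]
      have hwA : w ∉ A := fun hh => (hmemA w hh).2.2 rfl
      rintro ((hh | ⟨-, hh⟩ | ⟨rfl, -⟩) | ⟨-, hh⟩ | ⟨rfl, -⟩)
      · exact hu hh.left
      · simp [huw.symm, hxw.symm, haw.symm, hzw.symm, hvw.symm, hwD] at hh
      · exact huw rfl
      · have : w ∈ A ++ [y] := by rw [hAa]; exact List.mem_cons_of_mem _ hh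
        simp [hwA, hyw.symm] at this
      · exact huw rfl)
  have hp₄ : ∀ X ∈ K₃, b ∉ X ∨ y ∉ X → X ∈ K₄ := fun X hX hh => hF₄.mem_of X hX fun p hp => by
    rw [List.mem_singleton.1 hp]
    rcases hh with hh | hh
    · exact not_subset_of_mem (by simp) hh
    · exact not_subset_of_mem (by simp) hh
  -- the second long fan
  obtain ⟨L, hF₅⟩ := exists_fan hd hr₂.card_add_two s y J e K₄ hJe hF₄.isPseudomanifold
    (by
      have := hF₄.last_mem
      rwa [Finset.insert_comm z y, Finset.insert_comm w y, Finset.insert_comm w z] at this)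
    (Ladder.mono hlad₂ fun X hX _ hX' => hp₄ X (hp₃ X (hp₂ X hX fun hh => by
        have := hX' x hh
        simp [hzx.symm, hxw, hxD, hxy', hxs] at this) (Or.inr fun hh => by
        have := hX' v hh
        have hvs : v ∉ s := fun h' => (hmems v h').2.1 rfl
        simp [hzv.symm, hvw, hvD, hyv.symm, hvs] at this)) (Or.inl fun hh => by
        have := hX' b hh
        simp [hbz, hbw, hbD, hby, hAs b hbA] at this)) hndys (by
      intro p hp
      rw [hF₄.adj, hF₃.adj, hadj₂]
      obtain ⟨h1, h2, h3, h4⟩ := hns p hp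
      obtain ⟨h5, h6, h7⟩ := hmems p hp
      have h8 : p ∉ A := fun hh => hAs p hh hp
      rintro (((hh | ⟨-, hh⟩ | ⟨rfl, -⟩) | ⟨-, hh⟩ | ⟨rfl, -⟩) | ⟨-, hh⟩ | ⟨rfl, -⟩)
      · exact hu hh.left
      · have h9 : p ≠ a := by rintro rfl; exact h8 haA
        simp [h1, h3, h4, h5, h6, h9] at hh
      · exact h4 rfl
      · have : p ∈ A ++ [y] := by rw [hAa]; exact List.mem_cons_of_mem _ hh
        simp [h8, h2] at this
      · exact h4 rfl
      · simp [h7] at hh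
      · exact h4 rfl)
  have hp₅ : ∀ X ∈ K₄, w ∉ X → X ∈ L := fun X hX hh => hF₅.mem_of X hX fun p _ =>
    not_subset_of_mem (by simp) hh
  have hp₅' : ∀ X ∈ K₄, y ∉ X → (∀ p ∈ s, p ∉ X) → X ∈ L := fun X hX hh hh' =>
    hF₅.mem_of X hX fun p hp => not_subset_of_mem (Finset.mem_insert_self _ _) (by
      rcases hJ p hp with rfl | hp
      · exact hh
      · exact hh' p hp)
  -- the facets around the new edge
  have hxaL : insert x (insert a (insert z (insert u D))) ∈ L := by
    have e1 : insert x (insert a (insert z (insert u D))) =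
        insert u (insert x (insert a (insert z D))) := by
      rw [Finset.insert_comm z u, Finset.insert_comm a u, Finset.insert_comm x u]
    rw [e1]
    refine hp₅ _ (hp₄ _ (hp₃ _ h2xa (Or.inr ?_)) (Or.inr ?_)) ?_
    · simp [huv.symm, hxv.symm, hav.symm, hzv.symm, hvD]
    · simp [huy.symm, hxy'.symm, hay.symm, hzy.symm, hyD]
    · simp [huw.symm, hxw.symm, haw.symm, hzw.symm, hwD]
  have hladA : Ladder L (insert z (insert u D)) A := by
    rw [Finset.insert_comm]
    have := hlad₃.left_of_append
    refine Ladder.mono this fun X hX _ hX' => hp₅ X (hp₄ X hX (Or.inr fun hh => ?_)) fun hh => ?_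
    · have := hX' y hh
      simp [huy.symm, hzy.symm, hyD, hAy] at this
    · have := hX' w hh
      have hwA : w ∉ A := fun hh => (hmemA w hh).2.2 rfl
      simp [huw.symm, hzw.symm, hwD, hwA] at this
  have hbwL : insert b (insert w (insert z (insert u D))) ∈ L := by
    have := hF₄.ladder y (by simp)
    rw [Finset.erase_insert_of_ne hzy, Finset.erase_insert hyD, Ladder, List.singleton_append,
      List.isChain_pair] at this
    rw [Finset.insert_comm z u]
    refine hp₅' _ this ?_ fun p hp => ?_
    · simp [hby.symm, hyw, huy.symm, hzy.symm, hyD]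
    · obtain ⟨h1, h2, h3, h4⟩ := hns p hp
      obtain ⟨h5, h6, h7⟩ := hmems p hp
      have h8 : p ≠ b := by rintro rfl; exact hAs p hbA hp
      simp [h3, h4, h5, h7, h8]
  have hweL : insert w (insert e (insert z (insert u D))) ∈ L := by
    have := hF₅.last_mem
    have e1 : insert w (insert e (insert z (insert u D))) =
        insert u (insert e (insert z (insert w D))) := by
      rw [Finset.insert_comm z u, Finset.insert_comm e u, Finset.insert_comm w u,
        Finset.insert_comm w e, Finset.insert_comm w z]
    rwa [e1]
  have hladS : Ladder L (insert z (insert u D)) (y :: s) := by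
    have := hF₅.ladder w (by simp)
    rwa [Finset.erase_insert_of_ne hzw, Finset.erase_insert hwD, ← hJe, Finset.insert_comm]
      at this
  have hyvL : insert y (insert v (insert z (insert u D))) ∈ L := by
    have := hF₃.last_mem
    have e1 : insert y (insert v (insert z (insert u D))) =
        insert u (insert y (insert z (insert v D))) := by
      rw [Finset.insert_comm z u, Finset.insert_comm v u, Finset.insert_comm y u,
        Finset.insert_comm v z]
    rw [e1]
    refine hp₅ _ (hp₄ _ this (Or.inl ?_)) ?_
    · simp [hbu, hby, hbz, hbv, hbD]
    · simp [huw.symm, hyw.symm, hzw.symm, hvw.symm, hwD]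
  have hvxL : insert v (insert x (insert z (insert u D))) ∈ L := by
    have e1 : insert v (insert x (insert z (insert u D))) =
        insert u (insert x (insert z (insert v D))) := by
      rw [Finset.insert_comm z u, Finset.insert_comm x u, Finset.insert_comm v u,
        Finset.insert_comm v x, Finset.insert_comm v z]
    rw [e1]
    refine hp₅ _ (hp₄ _ (hF₃.mem_of _ h2x fun p hp => ?_) (Or.inr ?_)) ?_
    · refine not_subset_of_mem (Finset.mem_insert_self _ _) ?_
      obtain ⟨h1, h2, h3, h4⟩ := hna p hp
      obtain ⟨h5, h6, h7⟩ := hmemA p hp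
      simp [h1, h3, h4, h5, h6]
    · simp [huy.symm, hxy'.symm, hzy.symm, hyv, hyD]
    · simp [huw.symm, hxw.symm, hzw.symm, hvw.symm, hwD]
  -- adjacency
  have hset : ∀ p, (p = u ∨ p = x ∨ p = y ∨ p = z ∨ p = v ∨ p = w ∨ p ∈ D ∨ p ∈ A ∨ p ∈ s) ↔
      p ∈ insert u (insert x (insert a (insert z (insert v D)))) ∨ p ∈ A' ++ [y] ∨ p ∈ [w] ∨
        p ∈ s := by
    intro p
    simp only [hAa, Finset.mem_insert, List.mem_append, List.mem_cons, List.not_mem_nil, or_false]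
    clear * -
    constructor
    · rintro (h | h | h | h | h | h | h | (h | h) | h) <;> simp [h]
    · rintro ((h | h | h | h | h | h) | (h | h) | h | h) <;> simp [h]
  have hadj : ∀ p q, Adj L p q ↔ Adj K₁ p q ∨
      (p = u ∧ (q = u ∨ q = x ∨ q = y ∨ q = z ∨ q = v ∨ q = w ∨ q ∈ D ∨ q ∈ A ∨ q ∈ s)) ∨
      (q = u ∧ (p = u ∨ p = x ∨ p = y ∨ p = z ∨ p = v ∨ p = w ∨ p ∈ D ∨ p ∈ A ∨ p ∈ s)) := by
    intro p q
    rw [hF₅.adj, hF₄.adj, hF₃.adj, hadj₂, hset, hset]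
    generalize (q ∈ insert u (insert x (insert a (insert z (insert v D))))) = q₁,
      (q ∈ A' ++ [y]) = q₂, (q ∈ [w]) = q₃, (q ∈ s) = q₄
    generalize (p ∈ insert u (insert x (insert a (insert z (insert v D))))) = p₁,
      (p ∈ A' ++ [y]) = p₂, (p ∈ [w]) = p₃, (p ∈ s) = p₄
    clear * -
    constructor
    · rintro ((((h | h | h) | h | h) | h | h) | h | h) <;> simp [h]
    · rintro (h | ⟨h, h' | h' | h' | h'⟩ | ⟨h, h' | h' | h' | h'⟩)
      · simp [h]
      all_goals simp [h, h']
  have hcov : ∀ p, Adj K₁ p p →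
      p = x ∨ p = y ∨ p = z ∨ p = v ∨ p = w ∨ p ∈ D ∨ p ∈ A ∨ p ∈ s := by
    intro p hp
    have := hr₁.mem_or p hp
    rw [← List.cons_append, ← hAa] at this
    simp only [Finset.mem_insert, Cycle.mem_coe_iff, List.mem_cons, List.mem_append] at this
    clear * - this
    tauto
  have hverts : ∀ p, Adj L p p → p = u ∨ Adj K₁ p p := by
    intro p hp
    rcases (hadj p p).1 hp with hp | ⟨rfl, -⟩ | ⟨rfl, -⟩
    · exact Or.inr hp
    · exact Or.inl rfl
    · exact Or.inl rfl
  refine ⟨L, z, u, by simp [huz.symm, hzD], ?_, hden₁.trans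
    ⟨((hhom₂.trans hF₃.homeomorphic).trans hF₄.homeomorphic).trans hF₅.homeomorphic,
      fun p q hpq => (hadj p q).2 (Or.inl hpq), ?_⟩, ⟨hF₅.isPseudomanifold, ?_, ?_, ?_, ?_⟩⟩
  · rw [hadj, hadj₁]
    rintro ((hh | ⟨rfl, -⟩ | ⟨rfl, -⟩) | ⟨rfl, -⟩ | ⟨rfl, -⟩) <;> contradiction
  · intro p q hp hq hpK
    obtain rfl := (hverts p hp).resolve_right hpK
    refine (hadj _ _).2 (Or.inr (Or.inl ⟨rfl, ?_⟩))
    rcases hverts q hq with rfl | hq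
    · exact Or.inl rfl
    · exact Or.inr (hcov q hq)
  · rw [Finset.card_insert_of_notMem (by simp [huz.symm, hzD]), Finset.card_insert_of_notMem huD]
    omega
  · rw [Cycle.nodup_coe_iff]
    have hp : (x :: (A ++ w :: s.reverse ++ [y, v])).Perm (v :: w :: x :: (A ++ y :: s)) := by
      rw [List.perm_iff_count]
      intro p
      simp only [List.count_cons, List.count_append, List.count_nil, List.count_reverse]
      ring
    rw [hp.nodup_iff]
    refine List.nodup_cons.2 ⟨fun hh => ?_, List.nodup_cons.2
      ⟨fun hh => (hmem w hh).2.2 rfl, hnd⟩⟩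
    rcases List.mem_cons.1 hh with hh | hh
    · exact hvw hh
    · exact (hmem v hh).2.1 rfl
  · rw [Cycle.chain_coe_cons, show x :: (A ++ w :: s.reverse ++ [y, v] ++ [x]) =
      (x :: A) ++ w :: (s.reverse ++ y :: [v, x]) by simp, List.isChain_split]
    refine ⟨?_, ?_⟩
    · have e1 : x :: A ++ [w] = (x :: I) ++ b :: [w] := by simp [hAb]
      have e2 : (x :: I) ++ [b] = x :: A := by simp [hAb]
      rw [e1, List.isChain_split, e2]
      refine ⟨?_, List.isChain_pair.2 hbwL⟩
      rw [hAa, List.isChain_cons_cons, ← hAa]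
      exact ⟨hxaL, hladA⟩
    · rw [← List.cons_append, List.isChain_split]
      refine ⟨?_, ?_⟩
      · have e1 : w :: s.reverse ++ [y] = w :: (y :: s).reverse := by simp
        have hrev := hladS.reverse
        rw [hJe, List.reverse_append, List.reverse_singleton, List.singleton_append] at hrev
        rw [e1, hJe, List.reverse_append, List.reverse_singleton, List.singleton_append,
          List.isChain_cons_cons]
        exact ⟨hweL, hrev⟩
      · rw [List.isChain_cons_cons, List.isChain_pair]
        exact ⟨hyvL, hvxL⟩
  · intro p hp
    simp only [Finset.mem_insert, Cycle.mem_coe_iff, List.mem_cons, List.mem_append,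
      List.mem_reverse]
    rcases hverts p hp with rfl | hp
    · simp
    · have := hcov p hp
      clear * - this
      tauto

end FacetComplex

namespace FacetComplex

variable {d : ℕ} {K L : Finset (Finset ℕ)}

theorem IsPseudomanifold.exists_insert_ne (hK : IsPseudomanifold d K) {S : Finset ℕ} {b : ℕ}
    (hb : b ∉ S) (h : insert b S ∈ K) : ∃ b', b' ∉ S ∧ b' ≠ b ∧ insert b' S ∈ K := by
  obtain ⟨Y, hY, hne, hsub⟩ := hK.exists_ne _ h b (Finset.mem_insert_self _ _)
  rw [Finset.erase_insert hb] at hsub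
  have hc := card_add_one_of_insert hK hb h
  obtain ⟨b', hb', rfl⟩ := eq_insert_of_subset hsub (by rw [hK.card_eq _ hY, hc])
  exact ⟨b', hb', by rintro rfl; exact hne rfl, hY⟩

theorem IsPseudomanifold.eq_or_eq_of_insert_mem (hK : IsPseudomanifold d K) {S : Finset ℕ}
    {b b' c : ℕ} (hb : b ∉ S) (hc : c ∉ S) (hne : b ≠ b') (h : insert b S ∈ K)
    (h' : insert b' S ∈ K) (h'' : insert c S ∈ K) : c = b ∨ c = b' := by
  have key : ∀ p, insert c S = insert p S → c = p := fun p hp => by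
    have : c ∈ insert p S := hp ▸ Finset.mem_insert_self _ _
    exact (Finset.mem_insert.1 this).resolve_right hc
  rcases hK.eq_or_eq_of_insert hb hne h h' h'' (Finset.subset_insert _ _) with hh | hh
  · exact Or.inl (key _ hh)
  · exact Or.inr (key _ hh)

/-- A path in the link of `Q` can be extended to a cycle. -/
theorem exists_cycle_of_ladder (hK : IsPseudomanifold d K) {Q : Finset ℕ}
    (hQ : Q.card + 2 = d) : ∀ (n : ℕ) (x y : ℕ) (l : List ℕ), (x :: y :: l).Nodup →
      Ladder K Q (x :: y :: l) → (vertices K).card - (x :: y :: l).length = n →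
      ∃ x y z l, (x :: y :: z :: l).Nodup ∧
        Cycle.Chain (fun a b => insert a (insert b Q) ∈ K) (x :: y :: z :: l : List ℕ) := by
  intro n
  induction n using Nat.strong_induction_on with
  | _ n ih =>
  intro x y l hnd hlad hn
  obtain ⟨hxy, hlad'⟩ := List.isChain_cons_cons.1 hlad
  obtain ⟨hxQ, hyQ, hxyne⟩ := notMem_of_insert_insert hK hQ hxy
  have hyx := hxy
  rw [Finset.insert_comm] at hyx
  obtain ⟨w, hw, hwy, hwx⟩ := hK.exists_insert_ne (by simp [hxyne.symm, hyQ]) hyx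
  have hwxne : w ≠ x := by rintro rfl; simp at hw
  by_cases hwl : w ∈ l
  · obtain ⟨t₁, t₂, rfl⟩ := List.append_of_mem hwl
    have hpred : ∃ e ∈ x :: y :: t₁, e ≠ x ∧ insert e (insert w Q) ∈ K := by
      obtain ⟨I, e, hIe⟩ : ∃ I e, y :: t₁ = I ++ [e] :=
        ⟨_, _, (List.dropLast_append_getLast (List.cons_ne_nil y t₁)).symm⟩
      have he : e ∈ y :: t₁ := by rw [hIe]; simp
      refine ⟨e, List.mem_cons_of_mem _ he, ?_, ?_⟩
      · rintro rfl
        exact (List.nodup_cons.1 hnd).1 (by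
          rw [← List.cons_append]; exact List.mem_append_left _ he)
      · rw [← List.cons_append, hIe, List.append_assoc] at hlad'
        exact (List.isChain_cons_cons.1 hlad'.right_of_append).1
    obtain ⟨e, he, hex, hew⟩ := hpred
    cases t₂ with
    | nil =>
      obtain ⟨z, m, hzm⟩ := List.exists_cons_of_ne_nil (l := t₁ ++ [w]) (by simp)
      rw [hzm] at hnd
      refine ⟨x, y, z, m, hnd, ?_⟩
      rw [← hzm, Cycle.chain_coe_cons,
        show x :: (y :: (t₁ ++ [w]) ++ [x]) = (x :: y :: t₁) ++ w :: [x] by simp,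
        List.isChain_split]
      exact ⟨List.isChain_cons_cons.2 ⟨hxy, by simpa using hlad'⟩, List.isChain_pair.2 hwx⟩
    | cons t t₂ =>
      exfalso
      have hwt : insert t (insert w Q) ∈ K := by
        rw [← List.cons_append] at hlad'
        have := (List.isChain_cons_cons.1 hlad'.right_of_append).1
        rwa [Finset.insert_comm]
      have hxw : insert x (insert w Q) ∈ K := by rwa [Finset.insert_comm]
      have hne : ∀ p, insert p (insert w Q) ∈ K → p ∉ insert w Q := fun p hp => by
        obtain ⟨h1, -, h2⟩ := notMem_of_insert_insert hK hQ hp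
        simp [h1, h2]
      have hte : t ∉ x :: y :: t₁ := by
        intro hh
        have hnd' := hnd
        rw [← List.cons_append, ← List.cons_append] at hnd'
        exact (List.nodup_append.1 hnd').2.2 t hh t (by simp) rfl
      rcases hK.eq_or_eq_of_insert_mem (hne _ hxw) (hne _ hwt) hex.symm hxw hew hwt
        with rfl | rfl
      · simp at hte
      · exact hte he
  · have hwn : (w :: x :: y :: l).Nodup := List.nodup_cons.2 ⟨by simp [hwxne, hwy, hwl], hnd⟩
    have hladw : Ladder K Q (w :: x :: y :: l) := List.isChain_cons_cons.2 ⟨hwx, hlad⟩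
    have hlen : (w :: x :: y :: l).length ≤ (vertices K).card := by
      rw [← List.toFinset_card_of_nodup hwn]
      refine Finset.card_le_card fun p hp => mem_vertices.2 ?_
      have key : ∀ (m : List ℕ) (a b : ℕ), Ladder K Q (a :: b :: m) → ∀ p ∈ a :: b :: m,
          Adj K p p := by
        intro m
        induction m with
        | nil =>
          intro a b hab p hp
          have := List.isChain_pair.1 hab
          simp only [List.mem_cons, List.not_mem_nil, or_false] at hp
          exact ⟨_, this, by rcases hp with rfl | rfl <;> simp,
            by rcases hp with rfl | rfl <;> simp⟩
        | cons c m ih =>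
          intro a b hab p hp
          obtain ⟨h1, h2⟩ := List.isChain_cons_cons.1 hab
          rcases List.mem_cons.1 hp with rfl | hp
          · exact ⟨_, h1, by simp, by simp⟩
          · exact ih b c h2 p hp
      exact key _ _ _ hladw p (List.mem_toFinset.1 hp)
    simp only [List.length_cons] at hlen hn
    exact ih _ (by simp only [List.length_cons]; omega) w x (y :: l) hwn hladw rfl

theorem IsHub.exists_isRim {Q : Finset ℕ} (hQ : Q.card + 2 = d) (h : IsHub d Q K) :
    ∃ c, IsRim d Q c K := by
  have hK := h.isPseudomanifold
  obtain ⟨X, hX⟩ := hK.nonempty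
  obtain ⟨p, hp⟩ : X.Nonempty := Finset.card_pos.1 (by rw [hK.card_eq X hX]; omega)
  obtain ⟨Y, hY, hQY, -⟩ := h.dominating p ⟨X, hX, hp, hp⟩
  have hcY := hK.card_eq Y hY
  have hcd : (Y \ Q).card = 2 := by rw [Finset.card_sdiff_of_subset hQY]; omega
  obtain ⟨a, b, hab, hYQ⟩ := Finset.card_eq_two.1 hcd
  have hYab : insert a (insert b Q) ∈ K := by
    have : Y = insert a (insert b Q) := by
      rw [← Finset.sdiff_union_of_subset hQY, hYQ, Finset.insert_union, Finset.singleton_union]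
    rwa [← this]
  obtain ⟨x, y, z, l, hnd, hc⟩ := exists_cycle_of_ladder hK hQ _ a b [] (by simp [hab])
    (List.isChain_pair.2 hYab) rfl
  have htwo : ∀ a ∈ x :: y :: z :: l, ∃ b ∈ x :: y :: z :: l, ∃ e ∈ x :: y :: z :: l, b ≠ e ∧
      insert b (insert a Q) ∈ K ∧ insert e (insert a Q) ∈ K := by
    intro a ha
    obtain ⟨l₁, l₂, he⟩ := List.append_of_mem ha
    have hrot : ((l₁ ++ a :: l₂ : List ℕ) : Cycle ℕ) = ((a :: (l₂ ++ l₁) : List ℕ) : Cycle ℕ) := by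
      rw [Cycle.coe_eq_coe, ← List.cons_append]
      exact List.isRotated_append
    have hmem : ∀ p ∈ l₂ ++ l₁, p ∈ x :: y :: z :: l := by
      intro p hp
      rw [he]
      simp only [List.mem_append, List.mem_cons] at hp ⊢
      tauto
    have hnd' : (l₂ ++ l₁).Nodup := by
      rw [he, ← Cycle.nodup_coe_iff, hrot, Cycle.nodup_coe_iff] at hnd
      exact (List.nodup_cons.1 hnd).2
    have hlen : 2 ≤ (l₂ ++ l₁).length := by
      have := congrArg List.length he
      simp only [List.length_cons, List.length_append] at this ⊢
      omega
    rw [he, hrot, Cycle.chain_coe_cons] at hc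
    generalize l₂ ++ l₁ = m at *
    obtain ⟨b, m, rfl⟩ := List.exists_cons_of_length_pos (by omega : 0 < m.length)
    obtain ⟨m', e, rfl⟩ : ∃ m' e, m = m' ++ [e] := by
      have : m ≠ [] := by rintro rfl; simp at hlen
      exact ⟨_, _, (List.dropLast_append_getLast this).symm⟩
    refine ⟨b, hmem b (by simp), e, hmem e (by simp), ?_, ?_, ?_⟩
    · rintro rfl
      simp at hnd'
    · have := (List.isChain_cons_cons.1 hc).1
      rwa [Finset.insert_comm]
    · rw [show a :: (b :: (m' ++ [e]) ++ [a]) = (a :: b :: m') ++ [e, a] by simp] at hc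
      exact List.isChain_pair.1 hc.right_of_append
  have hxyK : insert x (insert y Q) ∈ K := by
    rw [Cycle.chain_coe_cons, List.cons_append, List.isChain_cons_cons] at hc
    exact hc.1
  refine ⟨_, hK, hQ, Cycle.nodup_coe_iff.2 hnd, hc, ?_⟩
  have key : ∀ W, Linked d (facetsAbove Q K) (insert x (insert y Q)) W →
      ∀ p ∈ W, p ∈ Q ∨ p ∈ x :: y :: z :: l := by
    intro W hW
    induction hW with
    | refl =>
      intro p hp
      simp only [Finset.mem_insert] at hp
      rcases hp with rfl | rfl | hp
      · simp
      · simp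
      · exact Or.inl hp
    | @tail Y W _ hYW ih =>
      obtain ⟨hY, hW, hn⟩ := hYW
      obtain ⟨hY, hQY⟩ := mem_facetsAbove.1 hY
      obtain ⟨hW, hQW⟩ := mem_facetsAbove.1 hW
      by_cases hne : Y = W
      · rwa [← hne]
      · obtain ⟨g, S, hg, hSY, rfl, hgY⟩ := exists_eq_insert_of_neighbors hK hY hW hne hn
        have hQS : Q ⊆ S := fun q hq => (Finset.mem_insert.1 (hQW hq)).resolve_left (by
          rintro rfl; exact hgY (hQY hq))
        have hcS := card_add_one_of_insert hK hg hW
        obtain ⟨a, ha, rfl⟩ := eq_insert_of_subset hQS (by omega)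
        have hac := (ih a (hSY (Finset.mem_insert_self _ _))).resolve_left ha
        obtain ⟨b, hb, e, he, hbe, hbK, heK⟩ := htwo a hac
        have hne' : ∀ p, insert p (insert a Q) ∈ K → p ∉ insert a Q := fun p hp => by
          obtain ⟨h1, -, h2⟩ := notMem_of_insert_insert hK hQ hp
          simp [h1, h2]
        intro p hp
        rcases Finset.mem_insert.1 hp with rfl | hp
        · rcases hK.eq_or_eq_of_insert_mem (hne' _ hbK) hg hbe hbK heK hW
            with rfl | rfl
          · exact Or.inr hb
          · exact Or.inr he
        · exact ih p (hSY hp)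
  intro p hp
  obtain ⟨W, hW, hQW, hpW⟩ := h.dominating p hp
  exact key W (h.connected _ (mem_facetsAbove.2 ⟨hxyK, fun q hq => by simp [hq]⟩) _
    (mem_facetsAbove.2 ⟨hW, hQW⟩)) p hpW

/-- Every two vertices of `K` are adjacent. -/
def IsComplete (K : Finset (Finset ℕ)) : Prop := ∀ p q, Adj K p p → Adj K q q → Adj K p q

theorem IsRim.exists_eq_cons {Q : Finset ℕ} {c : Cycle ℕ} (h : IsRim d Q c K) :
    ∃ x y l, c = ((x :: y :: l : List ℕ) : Cycle ℕ) := by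
  obtain ⟨r, hr⟩ : ∃ r, r ∈ c := by
    by_contra! hne
    obtain ⟨X, hX⟩ := h.isPseudomanifold.nonempty
    have h1 := h.isPseudomanifold.card_eq X hX
    have h2 : X ⊆ Q := fun r hr => (h.mem_or r ⟨X, hX, hr, hr⟩).resolve_right (hne r)
    have := Finset.card_le_card h2
    have := h.card_add_two
    omega
  exact ⟨r, h.exists_eq_coe hr⟩

/-- A missing edge can be inserted. -/
theorem IsRim.exists_isDenser (hd : 4 ≤ d) {Q : Finset ℕ} {c : Cycle ℕ} (h : IsRim d Q c K)
    {x y : ℕ} (hx : Adj K x x) (hy : Adj K y y) (hxy : ¬ Adj K x y) :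
    ∃ L Q c, IsRim d Q c L ∧ IsDenser K L ∧ Adj L x y := by
  have hxy' : x ≠ y := by rintro rfl; exact hxy hx
  have hmem : ∀ p q, Adj K p p → Adj K q q → ¬ Adj K p q → p ∈ c := by
    intro p q hp hq hpq
    refine (h.mem_or p hp).resolve_left fun hpQ => ?_
    rcases h.mem_or q hq with hqQ | hqc
    · obtain ⟨r, s, l, rfl⟩ := h.exists_eq_cons
      have hc := h.chain
      rw [Cycle.chain_coe_cons, List.cons_append, List.isChain_cons_cons] at hc
      exact hpq ⟨_, hc.1, by simp [hpQ], by simp [hqQ]⟩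
    · exact hpq (h.adj_of_mem hqc hpQ).symm
  have hxc := hmem x y hx hy hxy
  have hyc := hmem y x hy hx fun hh => hxy hh.symm
  obtain ⟨t, l, rfl⟩ := h.exists_eq_coe hxc
  rw [Cycle.mem_coe_iff, List.mem_cons] at hyc
  obtain ⟨A, s, hAs⟩ := List.append_of_mem (hyc.resolve_left hxy'.symm)
  rw [hAs] at h
  have hA : A ≠ [] := by
    rintro rfl
    have hc := h.chain
    rw [List.nil_append, Cycle.chain_coe_cons, List.cons_append, List.isChain_cons_cons] at hc
    exact hxy ⟨_, hc.1, by simp, by simp⟩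
  obtain ⟨v, w, D, hvw, hvD, hwD, rfl⟩ : ∃ v w D, v ≠ w ∧ v ∉ D ∧ w ∉ D ∧
      Q = insert v (insert w D) := by
    have := h.card_add_two
    obtain ⟨v, hv⟩ : Q.Nonempty := Finset.card_pos.1 (by omega)
    have h1 := Finset.card_erase_add_one hv
    obtain ⟨w, hw⟩ : (Q.erase v).Nonempty := Finset.card_pos.1 (by omega)
    exact ⟨v, w, (Q.erase v).erase w, (Finset.ne_of_mem_erase hw).symm, by simp, by simp, by
      rw [Finset.insert_erase hw, Finset.insert_erase hv]⟩
  obtain ⟨L, z, u, hz, hxyL, hden, hrim⟩ := h.exists_isDenser_common hd hA hvw hvD hwD hxy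
  obtain ⟨M, Q', c', hrim', hden', hadj⟩ := hrim.exists_isDenser_adj hd hz hxyL
  exact ⟨M, Q', c', hrim', hden.trans hden', hadj⟩

/-- The ordered pairs of vertices which are not adjacent. -/
noncomputable def nonEdges (K : Finset (Finset ℕ)) : Finset (ℕ × ℕ) := by
  classical exact (vertices K ×ˢ vertices K).filter fun e => ¬ Adj K e.1 e.2

theorem mem_nonEdges {e : ℕ × ℕ} :
    e ∈ nonEdges K ↔ (Adj K e.1 e.1 ∧ Adj K e.2 e.2) ∧ ¬ Adj K e.1 e.2 := by
  classical
  simp [nonEdges, mem_vertices]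

theorem IsRim.exists_isComplete (hd : 4 ≤ d) : ∀ (n : ℕ) (K : Finset (Finset ℕ)) (Q : Finset ℕ)
    (c : Cycle ℕ), IsRim d Q c K → (nonEdges K).card = n →
    ∃ L Q c, Homeomorphic K L ∧ IsRim d Q c L ∧ IsComplete L := by
  intro n
  induction n using Nat.strong_induction_on with
  | _ n ih =>
  intro K Q c h hn
  by_cases hall : IsComplete K
  · exact ⟨K, Q, c, Homeomorphic.refl K, h, hall⟩
  · unfold IsComplete at hall
    push Not at hall
    obtain ⟨x, y, hx, hy, hxy⟩ := hall
    obtain ⟨L, Q', c', hrim, hden, hadj⟩ := h.exists_isDenser hd hx hy hxy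
    obtain ⟨M, Q'', c'', hhom, hrim', hcomp⟩ := ih _ (by
      rw [← hn]
      refine Finset.card_lt_card ((Finset.ssubset_iff_of_subset fun e he => ?_).2
        ⟨(x, y), mem_nonEdges.2 ⟨⟨hx, hy⟩, hxy⟩, fun hh => (mem_nonEdges.1 hh).2 hadj⟩)
      obtain ⟨⟨h1, h2⟩, h3⟩ := mem_nonEdges.1 he
      refine mem_nonEdges.2 ⟨⟨?_, ?_⟩, fun hh => h3 (hden.mono _ _ hh)⟩
      · by_contra hh
        exact h3 (hden.adj_of_not_adj _ _ h1 h2 hh)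
      · by_contra hh
        exact h3 (hden.adj_of_not_adj _ _ h2 h1 hh).symm) L Q' c' hrim rfl
    exact ⟨M, Q'', c'', hden.homeomorphic.trans hhom, hrim', hcomp⟩

end FacetComplex

namespace FacetComplex

variable {d : ℕ} {K L : Finset (Finset ℕ)}

/-- The edges of `K`. -/
def edges (K : Finset (Finset ℕ)) : Finset (Finset ℕ) := K.biUnion (Finset.powersetCard 2)

theorem mem_edges {e : Finset ℕ} : e ∈ edges K ↔ ∃ p q, p ≠ q ∧ Adj K p q ∧ e = {p, q} := by
  simp only [edges, Finset.mem_biUnion, Finset.mem_powersetCard, Finset.card_eq_two]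
  constructor
  · rintro ⟨X, hX, hs, p, q, hpq, rfl⟩
    exact ⟨p, q, hpq, ⟨X, hX, hs (by simp), hs (by simp)⟩, rfl⟩
  · rintro ⟨p, q, hpq, ⟨X, hX, hp, hq⟩, rfl⟩
    exact ⟨X, hX, by simp [Finset.insert_subset_iff, hp, hq], p, q, hpq, rfl⟩

theorem Adj.of_pair_eq {p q p' q' : ℕ} (h : Adj K p q) (he : ({p, q} : Finset ℕ) = {p', q'}) :
    Adj K p' q' := by
  obtain ⟨X, hX, hp, hq⟩ := h
  have hsub : ({p', q'} : Finset ℕ) ⊆ X := by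
    rw [← he]
    simp [Finset.insert_subset_iff, hp, hq]
  exact ⟨X, hX, hsub (by simp), hsub (by simp)⟩

theorem card_edges_of_adj {u : ℕ} {T : Finset ℕ} (hu : u ∉ T) (hT : ∀ p ∈ T, ¬ Adj K u p)
    (h : ∀ p q, p ≠ q → (Adj L p q ↔ Adj K p q ∨ (p = u ∧ q ∈ T) ∨ (q = u ∧ p ∈ T))) :
    (edges L).card = (edges K).card + T.card := by
  have hun : edges L = edges K ∪ T.image fun p => {u, p} := by
    ext e
    simp only [Finset.mem_union, mem_edges, Finset.mem_image]
    constructor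
    · rintro ⟨p, q, hpq, hadj, rfl⟩
      rcases (h p q hpq).1 hadj with h' | ⟨rfl, h'⟩ | ⟨rfl, h'⟩
      · exact Or.inl ⟨p, q, hpq, h', rfl⟩
      · exact Or.inr ⟨q, h', rfl⟩
      · exact Or.inr ⟨p, h', Finset.pair_comm _ _⟩
    · rintro (⟨p, q, hpq, hadj, rfl⟩ | ⟨p, hp, rfl⟩)
      · exact ⟨p, q, hpq, (h p q hpq).2 (Or.inl hadj), rfl⟩
      · have hup : u ≠ p := by rintro rfl; exact hu hp
        exact ⟨u, p, hup, (h u p hup).2 (Or.inr (Or.inl ⟨rfl, hp⟩)), rfl⟩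
  rw [hun, Finset.card_union_of_disjoint, Finset.card_image_of_injOn]
  · intro p hp q hq hpq
    have hpq : ({u, p} : Finset ℕ) = {u, q} := hpq
    have : p ∈ ({u, q} : Finset ℕ) := by rw [← hpq]; simp
    rcases Finset.mem_insert.1 this with rfl | this
    · exact absurd hp hu
    · exact Finset.mem_singleton.1 this
  · rw [Finset.disjoint_left]
    rintro e he he'
    obtain ⟨p, q, -, hadj, rfl⟩ := mem_edges.1 he
    obtain ⟨p', hp', he⟩ := Finset.mem_image.1 he'
    exact hT p' hp' (hadj.of_pair_eq he.symm)

theorem IsComplete.card_edges (h : IsComplete K) :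
    (edges K).card = (vertices K).card.choose 2 := by
  rw [← Finset.card_powersetCard]
  congr 1
  ext e
  rw [mem_edges, Finset.mem_powersetCard, Finset.card_eq_two]
  constructor
  · rintro ⟨p, q, hpq, hadj, rfl⟩
    refine ⟨?_, p, q, hpq, rfl⟩
    simp [Finset.insert_subset_iff, mem_vertices, hadj.left, hadj.right]
  · rintro ⟨hs, p, q, hpq, rfl⟩
    exact ⟨p, q, hpq, h p q (mem_vertices.1 (hs (by simp))) (mem_vertices.1 (hs (by simp))), rfl⟩

theorem IsPseudomanifold.card_vertices_stellar (hd : 4 ≤ d) (hK : IsPseudomanifold d K)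
    {X₀ : Finset ℕ} {u : ℕ} (hX₀ : X₀ ∈ K) (hu : ¬ Adj K u u) :
    (vertices (FacetComplex.stellar X₀ u K)).card = (vertices K).card + 1 := by
  have : vertices (FacetComplex.stellar X₀ u K) = insert u (vertices K) := by
    ext p
    rw [Finset.mem_insert, mem_vertices, mem_vertices, adj_stellar_of_mem (by omega) hK hX₀]
    constructor
    · rintro (h | ⟨h, -⟩ | ⟨h, -⟩)
      · exact Or.inr h
      · exact Or.inl h
      · exact Or.inl h
    · rintro (rfl | h)
      · simp
      · exact Or.inl h
  rw [this, Finset.card_insert_of_notMem (by rwa [mem_vertices])]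

theorem IsPseudomanifold.card_edges_stellar (hd : 4 ≤ d) (hK : IsPseudomanifold d K)
    {X₀ : Finset ℕ} {u : ℕ} (hX₀ : X₀ ∈ K) (hu : ¬ Adj K u u) :
    (edges (FacetComplex.stellar X₀ u K)).card = (edges K).card + d := by
  rw [card_edges_of_adj (K := K) (u := u) (T := X₀) (not_mem_of_not_adj hu hX₀)
    (fun p _ h => hu h.left), hK.card_eq X₀ hX₀]
  intro p q hpq
  rw [adj_stellar_of_mem (by omega) hK hX₀, Finset.mem_insert, Finset.mem_insert]
  constructor
  · rintro (h | ⟨h, h' | h'⟩ | ⟨h, h' | h'⟩)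
    · exact Or.inl h
    · exact absurd (h.trans h'.symm) hpq
    · exact Or.inr (Or.inl ⟨h, h'⟩)
    · exact absurd (h'.trans h.symm) hpq
    · exact Or.inr (Or.inr ⟨h, h'⟩)
  · rintro (h | ⟨h, h'⟩ | ⟨h, h'⟩)
    · exact Or.inl h
    · exact Or.inr (Or.inl ⟨h, Or.inr h'⟩)
    · exact Or.inr (Or.inr ⟨h, Or.inr h'⟩)

theorem IsRim.card_vertices {Q : Finset ℕ} {x y : ℕ} {l : List ℕ}
    (h : IsRim d Q ((x :: y :: l : List ℕ) : Cycle ℕ) K) :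
    (vertices K).card = d + l.length := by
  have : vertices K = Q ∪ (x :: y :: l).toFinset := by
    ext p
    rw [mem_vertices, Finset.mem_union, List.mem_toFinset]
    constructor
    · intro hp
      have := h.mem_or p hp
      rwa [Cycle.mem_coe_iff] at this
    · rintro (hp | hp)
      · exact (h.adj_of_mem (x := x) (by simp) hp).right
      · exact h.adj_of_mem_cycle hp
  rw [this, Finset.card_union_of_disjoint, List.toFinset_card_of_nodup]
  · have := h.card_add_two
    simp only [List.length_cons]
    omega
  · exact Cycle.nodup_coe_iff.1 h.nodup
  · rw [Finset.disjoint_left]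
    intro p hp hp'
    exact h.notMem (List.mem_toFinset.1 hp') hp

/-- The number of edges can be increased step by step. -/
theorem IsRim.exists_card_edges (hd : 4 ≤ d) {Q : Finset ℕ} {c : Cycle ℕ} (h : IsRim d Q c K)
    {k : ℕ} (hk : d + k ≤ (vertices K).card) :
    ∃ L, Homeomorphic K L ∧ IsPseudomanifold d L ∧ (vertices L).card = (vertices K).card + 1 ∧
      (edges L).card = (edges K).card + d + k := by
  obtain ⟨x, y, l, rfl⟩ := h.exists_eq_cons
  rw [h.card_vertices] at hk
  obtain ⟨z, hz⟩ := exists_not_adj_self K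
  have hK := h.isPseudomanifold
  have hc := h.chain
  rw [Cycle.chain_coe_cons, List.cons_append, List.isChain_cons_cons] at hc
  have hX₀ := hc.1
  obtain ⟨init, e, he⟩ : ∃ init e, y :: l.take k = init ++ [e] :=
    ⟨_, _, (List.dropLast_append_getLast (List.cons_ne_nil y _)).symm⟩
  obtain ⟨L, hL⟩ := h.exists_isFan hd hz (List.take_prefix k l) he
  have hadjs : ∀ p q, Adj (FacetComplex.stellar (insert x (insert y Q)) z K) p q ↔ _ := fun p q =>
    adj_stellar_of_mem (by omega) hK hX₀
  have hzv : ∀ p ∈ l, p ≠ z := by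
    rintro p hp rfl
    exact hz (h.adj_of_mem_cycle (by simp [hp]))
  have hz' : z ∉ l.take k := fun hh => hzv z (List.mem_of_mem_take hh) rfl
  have hnd := Cycle.nodup_coe_iff.1 h.nodup
  simp only [List.nodup_cons, List.mem_cons, not_or] at hnd
  have hzX : z ∉ insert x (insert y Q) := not_mem_of_not_adj hz hX₀
  refine ⟨L, (homeomorphic_stellar (by simp) hz hzX).trans hL.homeomorphic, hL.isPseudomanifold,
    ?_, ?_⟩
  · rw [← hK.card_vertices_stellar hd hX₀ hz]
    congr 1
    ext p
    rw [mem_vertices, mem_vertices, hL.adj]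
    constructor
    · rintro (hp | ⟨rfl, hp⟩ | ⟨rfl, hp⟩)
      · exact hp
      · exact absurd hp hz'
      · exact absurd hp hz'
    · exact Or.inl
  · rw [← hK.card_edges_stellar hd hX₀ hz, card_edges_of_adj
      (K := FacetComplex.stellar (insert x (insert y Q)) z K) (u := z) (T := (l.take k).toFinset)
      (by simpa using hz') ?_ fun p q _ => by
        rw [hL.adj, List.mem_toFinset, List.mem_toFinset]]
    · rw [List.toFinset_card_of_nodup (hnd.2.2.sublist (List.take_sublist _ _)), List.length_take,
        min_eq_left (by omega)]
    · intro p hp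
      replace hp := List.mem_of_mem_take (List.mem_toFinset.1 hp)
      rw [hadjs]
      rintro (hh | ⟨-, hh⟩ | ⟨hh, -⟩)
      · exact hz hh.left
      · simp only [Finset.mem_insert] at hh
        rcases hh with hh | rfl | rfl | hh
        · exact hzv p hp hh
        · exact hnd.1.2 hp
        · exact hnd.2.1 hp
        · exact h.notMem (x := p) (by simp [hp]) hh
      · exact hzv p hp hh

theorem exists_isRim_card_eq (hd : 4 ≤ d) (hK : IsPseudomanifold d K)
    (hc : StronglyConnected d K) : ∃ m₀, ∀ m, m₀ ≤ m → ∃ L Q c, Homeomorphic K L ∧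
      IsRim d Q c L ∧ IsComplete L ∧ (vertices L).card = d + m := by
  obtain ⟨L₀, Q₀, h₀, hQ₀, hhub⟩ := exists_isHub hd hK hc
  obtain ⟨c₀, hrim₀⟩ := hhub.exists_isRim hQ₀
  obtain ⟨L₁, Q₁, c₁, h₁, hrim₁, hcomp₁⟩ := hrim₀.exists_isComplete hd _ _ _ _ rfl
  obtain ⟨x, y, l, rfl⟩ := hrim₁.exists_eq_cons
  refine ⟨l.length, fun m hm => ?_⟩
  induction m, hm using Nat.le_induction with
  | base => exact ⟨L₁, Q₁, _, h₀.trans h₁, hrim₁, hcomp₁, hrim₁.card_vertices⟩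
  | succ m hm ih =>
    obtain ⟨L, Q, c, hhom, hrim, hcomp, hcard⟩ := ih
    obtain ⟨x, y, l, rfl⟩ := hrim.exists_eq_cons
    obtain ⟨z, hz⟩ := exists_not_adj_self L
    obtain ⟨M, hM, hadj, hrimM⟩ := hrim.exists_cone hd hz
    obtain ⟨q, hq⟩ : Q.Nonempty := Finset.card_pos.1 (by have := hrim.card_add_two; omega)
    refine ⟨M, _, _, hhom.trans hM, hrimM q hq, ?_, ?_⟩
    · intro p q hp hq
      rw [hadj] at hp hq ⊢
      have := hcomp p q
      clear * - hp hq this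
      tauto
    · have : vertices M = insert z (vertices L) := by
        ext p
        rw [Finset.mem_insert, mem_vertices, mem_vertices, hadj]
        clear * -
        tauto
      rw [this, Finset.card_insert_of_notMem (by rwa [mem_vertices]), hcard]
      rfl

theorem succ_choose_two (n : ℕ) : (n + 1).choose 2 = n.choose 2 + n := by
  rw [Nat.choose_succ_succ' n 1, Nat.choose_one_right, add_comm]

theorem choose_two_add (m d : ℕ) :
    (d + m).choose 2 + (d + 1).choose 2 = m.choose 2 + d * (d + m) := by
  induction m with
  | zero =>
    induction d with
    | zero => rfl
    | succ d ih =>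
      simp only [add_zero] at ih ⊢
      rw [succ_choose_two (d + 1), succ_choose_two d] at *
      simp only [Nat.choose_zero_succ] at *
      nlinarith
  | succ m ih => rw [← add_assoc, succ_choose_two (d + m), succ_choose_two m]; nlinarith

theorem exists_card_edges_eq (hd : 4 ≤ d) (hK : IsPseudomanifold d K)
    (hc : StronglyConnected d K) : ∃ γ, ∀ a b, γ ≤ b → b ≤ (a + 1).choose 2 →
      ∃ L, Homeomorphic K L ∧ IsPseudomanifold d L ∧ (vertices L).card = d + (a + 1) ∧
        (edges L).card + (d + 1).choose 2 = b + d * (d + (a + 1)) := by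
  obtain ⟨m₀, hm₀⟩ := exists_isRim_card_eq hd hK hc
  have key : ∀ m, m₀ + 1 ≤ m → ∀ b, m₀.choose 2 ≤ b → b ≤ m.choose 2 →
      ∃ L, Homeomorphic K L ∧ IsPseudomanifold d L ∧ (vertices L).card = d + m ∧
        (edges L).card + (d + 1).choose 2 = b + d * (d + m) := by
    have step : ∀ m, m₀ ≤ m → ∀ b, m.choose 2 ≤ b → b ≤ (m + 1).choose 2 →
      ∃ L, Homeomorphic K L ∧ IsPseudomanifold d L ∧ (vertices L).card = d + (m + 1) ∧
        (edges L).card + (d + 1).choose 2 = b + d * (d + (m + 1)) := by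
      intro m hm b hb hb'
      obtain ⟨L, Q, c, hhom, hrim, hcomp, hcard⟩ := hm₀ m hm
      rw [succ_choose_two] at hb'
      obtain ⟨k, rfl⟩ := Nat.exists_eq_add_of_le hb
      obtain ⟨M, hM, hPM, hv, he⟩ := hrim.exists_card_edges hd (k := k) (by omega)
      refine ⟨M, hhom.trans hM, hPM, by rw [hv, hcard]; rfl, ?_⟩
      rw [he, hcomp.card_edges, hcard]
      have := choose_two_add m d
      rw [show d * (d + (m + 1)) = d * (d + m) + d by ring]
      omega
    intro m hm
    induction m, hm using Nat.le_induction with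
    | base => exact step m₀ le_rfl
    | succ m hm ih =>
      intro b hb hb'
      rcases le_total (m.choose 2) b with hmb | hmb
      · exact step m (by omega) b hmb hb'
      · obtain ⟨L, hhom, hPM, hv, he⟩ := ih b hb hmb
        obtain ⟨z, hz⟩ := exists_not_adj_self L
        obtain ⟨X, hX⟩ := hPM.nonempty
        have hX0 : X.Nonempty := Finset.card_pos.1 (by rw [hPM.card_eq X hX]; omega)
        refine ⟨FacetComplex.stellar X z L, hhom.trans (homeomorphic_stellar hX0 hz
          (not_mem_of_not_adj hz hX)), hPM.stellar hX0 hz, ?_, ?_⟩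
        · rw [hPM.card_vertices_stellar hd hX hz, hv]; rfl
        · rw [hPM.card_edges_stellar hd hX hz, show d * (d + (m + 1)) = d * (d + m) + d by ring]
          omega
  refine ⟨m₀.choose 2 + 1, fun a b hb hb' => key (a + 1) ?_ b (by omega) hb'⟩
  by_contra! hlt
  have := Nat.choose_le_choose 2 (show a + 1 ≤ m₀ by omega)
  omega

end FacetComplex

namespace PreAbstractSimplicialComplex

theorem mem_realization {V : Type*} [DecidableEq V] [Fintype V]
    {Δ : PreAbstractSimplicialComplex V} {p : V → ℝ} :
    p ∈ Δ.realization ↔ (∀ v, 0 ≤ p v) ∧ ∃ σ ∈ Δ.faces, (∀ v, v ∉ σ → p v = 0) ∧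
      ∑ v ∈ σ, p v = 1 := by
  have key : ∀ σ : Finset V, convexHull ℝ ((fun v : V => (Pi.single v 1 : V → ℝ)) '' (σ : Set V)) =
      {p | (∀ v, 0 ≤ p v) ∧ (∀ v, v ∉ σ → p v = 0) ∧ ∑ v ∈ σ, p v = 1} := by
    intro σ
    refine Set.Subset.antisymm (convexHull_min ?_ ?_) ?_
    · rintro _ ⟨v, hv, rfl⟩
      refine ⟨fun w => ?_, fun w hw => ?_, ?_⟩
      · by_cases h : w = v
        · subst h; simp
        · simp [h]
      · have : w ≠ v := by rintro rfl; exact hw hv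
        simp [this]
      · simp only [Pi.single_apply]
        rw [Finset.sum_ite_eq']
        simp [Finset.mem_coe.1 hv]
    · rintro p ⟨hp0, hp1, hp2⟩ q ⟨hq0, hq1, hq2⟩ a b ha hb hab
      refine ⟨fun v => ?_, fun v hv => ?_, ?_⟩
      · simp only [Pi.add_apply, Pi.smul_apply, smul_eq_mul]
        have := mul_nonneg ha (hp0 v)
        have := mul_nonneg hb (hq0 v)
        linarith
      · simp [hp1 v hv, hq1 v hv]
      · simp only [Pi.add_apply, Pi.smul_apply, smul_eq_mul, Finset.sum_add_distrib,
          ← Finset.mul_sum, hp2, hq2]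
        linarith
    · rintro p ⟨hp0, hp1, hp2⟩
      have hp : p = ∑ v ∈ σ, p v • (Pi.single v 1 : V → ℝ) := by
        ext w
        simp only [Finset.sum_apply, Pi.smul_apply, smul_eq_mul, Pi.single_apply, mul_ite, mul_one,
          mul_zero, Finset.sum_ite_eq]
        split_ifs with h
        · rfl
        · exact hp1 w h
      rw [hp]
      exact (convex_convexHull ℝ _).sum_mem (fun v _ => hp0 v) hp2
        fun v hv => subset_convexHull ℝ _ ⟨v, hv, rfl⟩
  simp only [realization, Set.mem_iUnion, key, Set.mem_ofPred_eq, exists_prop]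
  constructor
  · rintro ⟨σ, hσ, h0, h1, h2⟩
    exact ⟨h0, σ, hσ, h1, h2⟩
  · rintro ⟨h0, σ, hσ, h1, h2⟩
    exact ⟨σ, hσ, h0, h1, h2⟩

theorem fNumber_zero {V : Type*} (Δ : PreAbstractSimplicialComplex V) : Δ.fNumber 0 = 1 := by
  rw [fNumber, Set.ncard_eq_one]
  refine ⟨∅, ?_⟩
  ext σ
  simp only [facesOfCard, allFaces, Set.mem_insert_iff, Set.mem_ofPred_eq, Finset.card_eq_zero,
    Set.mem_singleton_iff]
  constructor
  · exact fun h => h.2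
  · exact fun h => ⟨Or.inl h, h⟩

theorem gNumber_one {V : Type*} (Δ : PreAbstractSimplicialComplex V) (h : 1 ≤ Δ.rank) :
    Δ.gNumber 1 = Δ.fNumber 1 - Δ.rank - 1 := by
  obtain ⟨r, hr⟩ : ∃ r, Δ.rank = r + 1 := ⟨_, (Nat.sub_add_cancel h).symm⟩
  simp [gNumber, hNumber, Finset.sum_range_succ, fNumber_zero, hr, Nat.choose_succ_self_right]
  ring

theorem gNumber_two {V : Type*} (Δ : PreAbstractSimplicialComplex V) (h : 2 ≤ Δ.rank) :
    Δ.gNumber 2 = Δ.fNumber 2 - Δ.rank * Δ.fNumber 1 + (Δ.rank + 1).choose 2 := by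
  obtain ⟨r, hr⟩ : ∃ r, Δ.rank = r + 2 := ⟨_, (Nat.sub_add_cancel h).symm⟩
  have h1 : (r + 2).choose r = (r + 1).choose 2 + (r + 1) := by
    rw [← FacetComplex.succ_choose_two]
    exact Nat.choose_symm_add
  have h2 : (r + 2 + 1).choose 2 = (r + 1).choose 2 + (r + 1) + (r + 2) := by
    rw [FacetComplex.succ_choose_two, FacetComplex.succ_choose_two]
  simp [gNumber, hNumber, Finset.sum_range_succ, fNumber_zero, hr, h1, h2,
    Nat.choose_succ_self_right]
  ring

end PreAbstractSimplicialComplex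

namespace FacetComplex

variable {d : ℕ} {K : Finset (Finset ℕ)}

/-- The faces of `Δ` are the nonempty subsets of the members of `K`, up to the renaming `ι` of
the vertices. -/
structure IsFacetFamily {n : ℕ} (ι : Fin n ↪ ℕ) (Δ : PreAbstractSimplicialComplex (Fin n))
    (K : Finset (Finset ℕ)) : Prop where
  mem_faces_iff : ∀ σ, σ ∈ Δ.faces ↔ σ.Nonempty ∧ ∃ X ∈ K, σ.map ι ⊆ X
  mem_range : ∀ X ∈ K, ∀ v ∈ X, v ∈ Set.range ι

theorem IsFacetFamily.exists_map_eq {n : ℕ} {ι : Fin n ↪ ℕ}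
    {Δ : PreAbstractSimplicialComplex (Fin n)} (h : IsFacetFamily ι Δ K) {X Y : Finset ℕ}
    (hX : X ∈ K) (hY : Y ⊆ X) : ∃ σ : Finset (Fin n), σ.map ι = Y := by
  refine ⟨Finset.univ.filter fun i => ι i ∈ Y, ?_⟩
  ext v
  simp only [Finset.mem_map, Finset.mem_filter, Finset.mem_univ, true_and]
  constructor
  · rintro ⟨i, hi, rfl⟩
    exact hi
  · intro hv
    obtain ⟨i, rfl⟩ := h.mem_range X hX v (hY hv)
    exact ⟨i, hv, rfl⟩

/-- The coordinates of a point of `ℝⁿ` in `ℝ^ℕ` after renaming. -/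
noncomputable def rename {n : ℕ} (ι : Fin n ↪ ℕ) (p : Fin n → ℝ) (m : ℕ) : ℝ :=
  ∑ i, if ι i = m then p i else 0

theorem rename_apply {n : ℕ} (ι : Fin n ↪ ℕ) (p : Fin n → ℝ) (i : Fin n) :
    rename ι p (ι i) = p i := by
  simp [rename, ι.injective.eq_iff]

theorem rename_of_notMem {n : ℕ} (ι : Fin n ↪ ℕ) (p : Fin n → ℝ) {m : ℕ}
    (hm : m ∉ Set.range ι) : rename ι p m = 0 := by
  refine Finset.sum_eq_zero fun i _ => if_neg ?_
  rintro rfl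
  exact hm ⟨i, rfl⟩

theorem continuous_rename {n : ℕ} (ι : Fin n ↪ ℕ) : Continuous (rename ι) := by
  refine continuous_pi fun m => continuous_finsetSum _ fun i _ => ?_
  split_ifs
  · exact continuous_apply i
  · exact continuous_const

theorem IsFacetFamily.rename_mem {n : ℕ} {ι : Fin n ↪ ℕ}
    {Δ : PreAbstractSimplicialComplex (Fin n)} (h : IsFacetFamily ι Δ K) {p : Fin n → ℝ}
    (hp : p ∈ Δ.realization) : rename ι p ∈ geometric K := by
  obtain ⟨h0, σ, hσ, h1, h2⟩ := PreAbstractSimplicialComplex.mem_realization.1 hp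
  obtain ⟨-, X, hX, hs⟩ := (h.mem_faces_iff σ).1 hσ
  have hz : ∀ v, v ∉ σ.map ι → rename ι p v = 0 := by
    intro v hv
    by_cases hr : v ∈ Set.range ι
    · obtain ⟨i, rfl⟩ := hr
      rw [rename_apply]
      exact h1 i fun hi => hv (Finset.mem_map_of_mem ι hi)
    · exact rename_of_notMem ι _ hr
  refine ⟨fun v => ?_, X, hX, fun v hv => hz v fun hh => hv (hs hh), ?_⟩
  · by_cases hr : v ∈ Set.range ι
    · obtain ⟨i, rfl⟩ := hr
      rw [rename_apply]
      exact h0 i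
    · rw [rename_of_notMem ι _ hr]
  · rw [← Finset.sum_subset hs fun v _ hv => hz v hv, Finset.sum_map]
    simpa [rename_apply] using h2

theorem IsFacetFamily.comp_mem {n : ℕ} {ι : Fin n ↪ ℕ}
    {Δ : PreAbstractSimplicialComplex (Fin n)} (h : IsFacetFamily ι Δ K) {q : ℕ → ℝ}
    (hq : q ∈ geometric K) : (fun i => q (ι i)) ∈ Δ.realization := by
  obtain ⟨h0, X, hX, h1, h2⟩ := hq
  obtain ⟨σ, hσ⟩ := h.exists_map_eq hX subset_rfl
  refine PreAbstractSimplicialComplex.mem_realization.2 ⟨fun i => h0 _, σ, ?_, fun i hi => ?_, ?_⟩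
  · refine (h.mem_faces_iff σ).2 ⟨?_, X, hX, hσ.subset⟩
    rw [Finset.nonempty_iff_ne_empty]
    rintro rfl
    rw [← hσ] at h2
    simp at h2
  · refine h1 _ fun hh => hi ?_
    rwa [← hσ, Finset.mem_map' ι] at hh
  · rw [← hσ, Finset.sum_map] at h2
    exact h2

theorem IsFacetFamily.rename_comp {n : ℕ} {ι : Fin n ↪ ℕ}
    {Δ : PreAbstractSimplicialComplex (Fin n)} (h : IsFacetFamily ι Δ K) {q : ℕ → ℝ}
    (hq : q ∈ geometric K) : (rename ι fun i => q (ι i)) = q := by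
  obtain ⟨h0, X, hX, h1, h2⟩ := hq
  ext v
  by_cases hr : v ∈ Set.range ι
  · obtain ⟨i, rfl⟩ := hr
    exact rename_apply ι _ i
  · exact (rename_of_notMem ι _ hr).trans (h1 v fun hv => hr (h.mem_range X hX v hv)).symm

/-- Renaming the vertices does not change the realization. -/
noncomputable def IsFacetFamily.homeomorph {n : ℕ} {ι : Fin n ↪ ℕ}
    {Δ : PreAbstractSimplicialComplex (Fin n)} (h : IsFacetFamily ι Δ K) :
    Δ.realization ≃ₜ geometric K where
  toFun p := ⟨rename ι p.1, h.rename_mem p.2⟩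
  invFun q := ⟨fun i => q.1 (ι i), h.comp_mem q.2⟩
  left_inv _ := Subtype.ext (funext fun i => rename_apply ι _ i)
  right_inv q := Subtype.ext (h.rename_comp q.2)
  continuous_toFun := ((continuous_rename ι).comp continuous_subtype_val).subtype_mk _
  continuous_invFun :=
    ((show Continuous fun (q : ℕ → ℝ) (i : Fin n) => q (ι i) from
      continuous_pi fun i => continuous_apply (ι i)).comp continuous_subtype_val).subtype_mk _

theorem IsFacetFamily.rank_eq {n : ℕ} {ι : Fin n ↪ ℕ} {Δ : PreAbstractSimplicialComplex (Fin n)}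
    (h : IsFacetFamily ι Δ K) (hK : IsPseudomanifold d K) (hd : 1 ≤ d) : Δ.rank = d := by
  refine IsGreatest.csSup_eq ⟨?_, ?_⟩
  · obtain ⟨X, hX⟩ := hK.nonempty
    obtain ⟨σ, hσ⟩ := h.exists_map_eq hX subset_rfl
    have hc : σ.card = d := by rw [← Finset.card_map ι, hσ, hK.card_eq X hX]
    exact ⟨σ, (h.mem_faces_iff σ).2 ⟨Finset.card_pos.1 (by omega), X, hX, hσ.subset⟩, hc⟩
  · rintro _ ⟨σ, hσ, rfl⟩
    obtain ⟨-, X, hX, hs⟩ := (h.mem_faces_iff σ).1 hσ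
    rw [← Finset.card_map ι, ← hK.card_eq X hX]
    exact Finset.card_le_card hs

theorem IsFacetFamily.fNumber_two {n : ℕ} {ι : Fin n ↪ ℕ}
    {Δ : PreAbstractSimplicialComplex (Fin n)} (h : IsFacetFamily ι Δ K) :
    Δ.fNumber 2 = (edges K).card := by
  rw [PreAbstractSimplicialComplex.fNumber,
    ← Set.ncard_image_of_injective _ (Finset.map_injective ι), ← Set.ncard_coe_finset]
  congr 1
  ext e
  simp only [PreAbstractSimplicialComplex.facesOfCard, PreAbstractSimplicialComplex.allFaces,
    Set.mem_image, Set.mem_ofPred_eq, Set.mem_insert_iff, edges, Finset.coe_biUnion,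
    Set.mem_iUnion, Finset.mem_coe, Finset.mem_powersetCard, exists_prop]
  constructor
  · rintro ⟨σ, ⟨rfl | hσ, hc⟩, rfl⟩
    · simp at hc
    · obtain ⟨-, X, hX, hs⟩ := (h.mem_faces_iff σ).1 hσ
      exact ⟨X, hX, hs, by rw [Finset.card_map, hc]⟩
  · rintro ⟨X, hX, hs, hc⟩
    obtain ⟨σ, rfl⟩ := h.exists_map_eq hX hs
    rw [Finset.card_map] at hc
    exact ⟨σ, ⟨Or.inr ((h.mem_faces_iff σ).2 ⟨Finset.card_pos.1 (by omega), X, hX, hs⟩), hc⟩, rfl⟩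

theorem fNumber_one {n : ℕ} (Δ : AbstractSimplicialComplex (Fin n)) : Δ.fNumber 1 = n := by
  have : Δ.facesOfCard 1 = (fun i : Fin n => ({i} : Finset (Fin n))) '' Set.univ := by
    ext σ
    simp only [PreAbstractSimplicialComplex.facesOfCard, PreAbstractSimplicialComplex.allFaces,
      Set.mem_image, Set.mem_ofPred_eq, Set.mem_insert_iff, Finset.card_eq_one, Set.mem_univ,
      true_and]
    constructor
    · rintro ⟨-, i, rfl⟩
      exact ⟨i, rfl⟩
    · rintro ⟨i, rfl⟩
      exact ⟨Or.inr (Δ.singleton_mem i), i, rfl⟩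
  rw [PreAbstractSimplicialComplex.fNumber, this,
    Set.ncard_image_of_injective _ Finset.singleton_injective, Set.ncard_univ, Nat.card_fin]

/-- A family of facets gives a complex on the vertex set `Fin n`. -/
theorem exists_isFacetFamily {n : ℕ} (hn : (vertices K).card = n) :
    ∃ (ι : Fin n ↪ ℕ) (Δ : AbstractSimplicialComplex (Fin n)),
      IsFacetFamily ι Δ.toPreAbstractSimplicialComplex K ∧ ∀ i, Adj K (ι i) (ι i) := by
  obtain ⟨ι, hι⟩ : ∃ ι : Fin n ↪ ℕ, ∀ v, v ∈ vertices K ↔ v ∈ Set.range ι :=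
    ⟨((vertices K).orderEmbOfFin hn).toEmbedding, fun v => by
      have := Finset.range_orderEmbOfFin (vertices K) hn
      simp only [RelEmbedding.coe_toEmbedding]
      rw [this, Finset.mem_coe]⟩
  have hadj : ∀ i, Adj K (ι i) (ι i) := fun i => mem_vertices.1 ((hι _).2 ⟨i, rfl⟩)
  refine ⟨ι, ⟨⟨{σ | σ.Nonempty ∧ ∃ X ∈ K, σ.map ι ⊆ X}, ?_⟩, ?_⟩, ⟨fun σ => Iff.rfl, ?_⟩, hadj⟩
  · rintro σ ⟨hσ, X, hX, hs⟩
    exact ⟨hσ, fun τ hτ hne => ⟨hne, X, hX, (Finset.map_subset_map.2 hτ).trans hs⟩⟩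
  · intro i
    obtain ⟨X, hX, hi, -⟩ := hadj i
    exact ⟨Finset.singleton_nonempty i, X, hX, by simpa using hi⟩
  · intro X hX v hv
    exact (hι v).1 (mem_vertices.2 ⟨X, hX, hv, hv⟩)

theorem exists_isNeighborly {n : ℕ} (hn : (vertices K).card = n) (hc : IsComplete K) :
    ∃ Δ : AbstractSimplicialComplex (Fin n),
      Nonempty (Δ.realization ≃ₜ geometric K) ∧ IsNeighborly Δ 2 := by
  obtain ⟨ι, Δ, hΔ, hadj⟩ := exists_isFacetFamily hn
  refine ⟨Δ, ⟨hΔ.homeomorph⟩, fun s hs => ?_⟩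
  obtain ⟨i, j, -, rfl⟩ := Finset.card_eq_two.1 hs
  obtain ⟨X, hX, hi, hj⟩ := hc (ι i) (ι j) (hadj i) (hadj j)
  exact (hΔ.mem_faces_iff _).2 ⟨by simp, X, hX, by simp [Finset.insert_subset_iff, hi, hj]⟩

theorem exists_gNumber_eq (hd : 4 ≤ d) (hK : IsPseudomanifold d K) {n a b : ℕ}
    (hn : (vertices K).card = n) (ha : n = d + (a + 1))
    (hb : (edges K).card + (d + 1).choose 2 = b + d * n) :
    ∃ Δ : AbstractSimplicialComplex (Fin n), Nonempty (Δ.realization ≃ₜ geometric K) ∧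
      Δ.gNumber 1 = (a : ℤ) ∧ Δ.gNumber 2 = (b : ℤ) := by
  obtain ⟨ι, Δ, hΔ, hadj⟩ := exists_isFacetFamily hn
  have hr := hΔ.rank_eq hK (by omega)
  refine ⟨Δ, ⟨hΔ.homeomorph⟩, ?_, ?_⟩
  · rw [PreAbstractSimplicialComplex.gNumber_one _ (by omega), fNumber_one, hr, ha]
    push_cast
    ring
  · rw [PreAbstractSimplicialComplex.gNumber_two _ (by omega), fNumber_one, hr, hΔ.fNumber_two]
    have : ((edges K).card : ℤ) + (d + 1).choose 2 = b + d * n := by exact_mod_cast hb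
    linarith

end FacetComplex

namespace SimplicialHomology

variable {k : Type*} [Field k] {V : Type*} [LinearOrder V] {L : PreAbstractSimplicialComplex V}

theorem boundary_single (σ : Finset V) :
    boundary k V (Finsupp.single σ 1) =
      ∑ v ∈ σ, Finsupp.single (σ.erase v) ((-1) ^ (σ.filter (· < v)).card) := by
  simp [boundary]

theorem boundary_single_singleton (v : V) :
    boundary k V (Finsupp.single {v} 1) = Finsupp.single ∅ 1 := by
  rw [boundary_single, Finset.sum_singleton]
  simp [Finset.filter_singleton]

theorem boundary_single_pair {a b : V} (hab : a < b) :
    boundary k V (Finsupp.single {a, b} 1) = Finsupp.single {b} 1 - Finsupp.single {a} 1 := by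
  have h1 : ({a, b} : Finset V).filter (· < a) = ∅ := by
    ext x
    simp only [Finset.mem_filter, Finset.mem_insert, Finset.mem_singleton, Finset.notMem_empty,
      iff_false]
    rintro ⟨rfl | rfl, h⟩
    · exact lt_irrefl _ h
    · exact lt_asymm h hab
  have h2 : ({a, b} : Finset V).filter (· < b) = {a} := by
    ext x
    simp only [Finset.mem_filter, Finset.mem_insert, Finset.mem_singleton]
    constructor
    · rintro ⟨rfl | rfl, h⟩
      · rfl
      · exact absurd h (lt_irrefl _)
    · rintro rfl
      exact ⟨Or.inl rfl, hab⟩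
  have h3 : ({a, b} : Finset V).erase a = {b} := Finset.erase_insert (by simp [hab.ne])
  have h4 : ({a, b} : Finset V).erase b = {a} := by
    rw [Finset.pair_comm]
    exact Finset.erase_insert (by simp [hab.ne'])
  rw [boundary_single, Finset.sum_pair hab.ne, h1, h2, h3, h4]
  simp [sub_eq_add_neg]

/-- The projection of `Z` onto the subquotient. -/
def Subquotient.mk {C : Type*} [AddCommGroup C] [Module k C] (Z B : Submodule k C) :
    Z →ₗ[k] Subquotient Z B :=
  (B.submoduleOf Z).mkQ

theorem Subquotient.mk_eq_zero {C : Type*} [AddCommGroup C] [Module k C] {Z B : Submodule k C}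
    {x : Z} : Subquotient.mk Z B x = 0 ↔ (x : C) ∈ B :=
  Submodule.Quotient.mk_eq_zero (B.submoduleOf Z)

theorem Subquotient.mk_surjective {C : Type*} [AddCommGroup C] [Module k C] (Z B : Submodule k C) :
    Function.Surjective (Subquotient.mk Z B) :=
  Submodule.mkQ_surjective _

theorem subsingleton_of_cycles_eq_bot {j : ℕ} (h : cycles k L j = ⊥) :
    Subsingleton (reducedHomology k L j) := by
  have : Subsingleton (cycles k L j) := by rw [h]; infer_instance
  exact (Subquotient.mk_surjective _ _).subsingleton

theorem chains_eq_bot {V : Type*} {L : PreAbstractSimplicialComplex V} {j : ℕ} (h : L.facesOfCard j = ∅) : chains k L j = ⊥ := by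
  rw [chains, h, Finsupp.supported_empty]

theorem mem_boundaries_of_subsingleton {j : ℕ} (h : Subsingleton (reducedHomology k L j))
    {c : Finset V →₀ k} (hc : c ∈ cycles k L j) : c ∈ boundaries k L j := by
  exact Subquotient.mk_eq_zero.1 (h.elim (Subquotient.mk _ _ ⟨c, hc⟩) 0)

theorem single_sub_single_mem_cycles {v w : V} (hv : {v} ∈ L.faces) (hw : {w} ∈ L.faces) :
    (Finsupp.single {v} 1 - Finsupp.single {w} 1 : Finset V →₀ k) ∈ cycles k L 1 := by
  refine ⟨Submodule.sub_mem _ ?_ ?_, ?_⟩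
  · exact Finsupp.single_mem_supported _ _ ⟨Or.inr hv, by simp⟩
  · exact Finsupp.single_mem_supported _ _ ⟨Or.inr hw, by simp⟩
  · rw [SetLike.mem_coe, LinearMap.mem_ker, map_sub, boundary_single_singleton,
      boundary_single_singleton, sub_self]

theorem cycles_one_eq_bot {v : V} (h : ∀ w, {w} ∈ L.faces → w = v) : cycles k L 1 = ⊥ := by
  rw [eq_bot_iff]
  rintro c ⟨hc, hc'⟩
  have hsub : L.facesOfCard 1 ⊆ {{v}} := by
    rintro σ ⟨rfl | hσ, hcard⟩
    · simp at hcard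
    · obtain ⟨w, rfl⟩ := Finset.card_eq_one.1 hcard
      rw [h w hσ]
      rfl
  have hsupp : (c.support : Set (Finset V)) ⊆ {{v}} := ((Finsupp.mem_supported k c).1 hc).trans hsub
  have hcs : c = Finsupp.single {v} (c {v}) :=
    Finsupp.support_subset_singleton.1 (by exact_mod_cast hsupp)
  have h0 : c {v} = 0 := by
    rw [SetLike.mem_coe, LinearMap.mem_ker, hcs,
      show (Finsupp.single {v} (c {v}) : Finset V →₀ k) = c {v} • Finsupp.single {v} 1 by simp,
      map_smul, boundary_single_singleton] at hc'
    simpa using hc'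
  rw [Submodule.mem_bot, hcs, h0, Finsupp.single_zero]

theorem false_of_three_vertices (e : reducedHomology k L 1 ≃ₗ[k] k) (h : L.facesOfCard 2 = ∅)
    {v₁ v₂ v₃ : V} (h₁ : {v₁} ∈ L.faces) (h₂ : {v₂} ∈ L.faces) (h₃ : {v₃} ∈ L.faces)
    (h12 : v₁ ≠ v₂) (h13 : v₁ ≠ v₃) (h23 : v₂ ≠ v₃) : False := by
  have hb : boundaries k L 1 = ⊥ := by rw [boundaries, chains_eq_bot h, Submodule.map_bot]
  have hf : ∀ x : cycles k L 1, e (Subquotient.mk _ _ x) = 0 → x = 0 := by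
    intro x hx
    have h2 : x.1 ∈ boundaries k L 1 := Subquotient.mk_eq_zero.1 (e.map_eq_zero_iff.1 hx)
    rw [hb, Submodule.mem_bot] at h2
    exact Subtype.ext h2
  obtain ⟨f, hfe⟩ : ∃ f : cycles k L 1 →ₗ[k] k, ∀ x, f x = e (Subquotient.mk _ _ x) :=
    ⟨e.toLinearMap ∘ₗ Subquotient.mk _ _, fun _ => rfl⟩
  simp only [← hfe] at hf
  obtain ⟨x, hx⟩ : ∃ x : cycles k L 1, 
      x.1 = Finsupp.single {v₁} 1 - Finsupp.single {v₂} 1 :=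
    ⟨⟨_, single_sub_single_mem_cycles h₁ h₂⟩, rfl⟩
  obtain ⟨y, hy⟩ : ∃ y : cycles k L 1, 
      y.1 = Finsupp.single {v₁} 1 - Finsupp.single {v₃} 1 :=
    ⟨⟨_, single_sub_single_mem_cycles h₁ h₃⟩, rfl⟩
  have hxy : f y • x + (-f x) • y = 0 := hf _ (by
    rw [map_add, map_smul, map_smul, smul_eq_mul, smul_eq_mul]
    ring)
  have hx3 : f y * x.1 {v₃} + -f x * y.1 {v₃} = 0 := by
    have := congrArg (fun c : cycles k L 1 => c.1 {v₃}) hxy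
    simpa using this
  have hfx : f x = 0 := by
    simpa [hx, hy, Finsupp.single_apply, h13, h23] using hx3
  have hx0 := congrArg (fun c : cycles k L 1 => c.1 {v₂}) (hf x hfx)
  simp [hx, h12] at hx0

theorem prop_of_vertices (h : Subsingleton (reducedHomology k L 1)) {C : V → Prop}
    (hC : ∀ a b, a ≠ b → {a, b} ∈ L.faces → C a → C b) {v w : V} (hv : {v} ∈ L.faces)
    (hw : {w} ∈ L.faces) (hCv : C v) : C w := by
  classical
  let ε : (Finset V →₀ k) →ₗ[k] k :=
    Finsupp.lift k k (Finset V) fun σ => if ∃ a, C a ∧ σ = {a} then 1 else 0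
  have hε : ∀ a, ε (Finsupp.single {a} 1) = if C a then 1 else 0 := by
    intro a
    simp [ε]
  have hker : chains k L 2 ≤ LinearMap.ker (ε ∘ₗ boundary k V) := by
    rw [chains, Finsupp.supported_eq_span_single, Submodule.span_le]
    rintro _ ⟨σ, ⟨rfl | hσ, hc⟩, rfl⟩
    · simp at hc
    · obtain ⟨a, b, hab, rfl⟩ := Finset.card_eq_two.1 hc
      have hCab : C a ↔ C b := ⟨hC a b hab hσ, hC b a hab.symm (by rwa [Finset.pair_comm])⟩
      rw [SetLike.mem_coe, LinearMap.mem_ker, LinearMap.comp_apply]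
      rcases lt_or_gt_of_ne hab with hlt | hlt
      · rw [boundary_single_pair hlt, map_sub, hε, hε]
        simp [hCab]
      · rw [Finset.pair_comm, boundary_single_pair hlt, map_sub, hε, hε]
        simp [hCab]
  obtain ⟨c, hc, hcv⟩ := mem_boundaries_of_subsingleton h (single_sub_single_mem_cycles hv hw)
  have h0 : ε (Finsupp.single {v} 1 - Finsupp.single {w} 1) = 0 := by
    rw [← hcv]
    exact hker hc
  rw [map_sub, hε, hε, if_pos hCv] at h0
  by_contra hCw
  simp [hCw] at h0

end SimplicialHomology

namespace SimplicialHomology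

variable {k : Type*} [Field k] {d n : ℕ} {Δ : PreAbstractSimplicialComplex (Fin n)}

theorem singleton_mem_link {ρ : Finset (Fin n)} {v : Fin n} :
    {v} ∈ (Δ.link ρ).faces ↔ v ∉ ρ ∧ insert v ρ ∈ Δ.faces := by
  change ({v} : Finset (Fin n)).Nonempty ∧ Disjoint {v} ρ ∧ {v} ∪ ρ ∈ Δ.faces ↔ _
  rw [Finset.disjoint_singleton_left, Finset.singleton_union]
  simp

theorem card_le_rank {ρ : Finset (Fin n)} (hρ : ρ ∈ Δ.faces) : ρ.card ≤ Δ.rank := by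
  refine le_csSup ⟨n, ?_⟩ ⟨ρ, hρ, rfl⟩
  rintro _ ⟨σ, -, rfl⟩
  simpa using Finset.card_le_univ σ

theorem insert_mem_of_mem_link {ρ τ : Finset (Fin n)} {v : Fin n} (hτ : τ ∈ (Δ.link ρ).faces)
    (hv : v ∈ τ) : v ∉ ρ ∧ insert v ρ ∈ Δ.faces := by
  obtain ⟨hne, hd, hm⟩ := hτ
  refine ⟨Finset.disjoint_left.1 hd hv, (Δ.isRelLowerSet_faces hm).2 ?_ (Finset.insert_nonempty _ _)⟩
  exact Finset.insert_subset (Finset.mem_union_left _ hv) Finset.subset_union_right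

/-- A homology manifold without boundary. -/
structure IsClosedHomologyManifold (k : Type*) [Field k] (d : ℕ)
    (Δ : PreAbstractSimplicialComplex (Fin n)) : Prop where
  rank_eq : Δ.rank = d
  isHomologyManifold : IsHomologyManifold k Δ
  boundaryFaces_eq : boundaryFaces k Δ = ∅

namespace IsClosedHomologyManifold

theorem hasHomologyOfSphere (h : IsClosedHomologyManifold k d Δ) {ρ : Finset (Fin n)}
    (hρ : ρ ∈ Δ.faces) : HasHomologyOfSphere k (Δ.link ρ) (d - ρ.card) := by
  rw [← h.rank_eq]
  refine (h.isHomologyManifold ρ hρ).resolve_right fun hb => ?_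
  have : ρ ∈ boundaryFaces k Δ := ⟨hρ, hb _⟩
  rw [h.boundaryFaces_eq] at this
  exact this

theorem not_subsingleton (h : IsClosedHomologyManifold k d Δ) {ρ : Finset (Fin n)}
    (hρ : ρ ∈ Δ.faces) : ¬ Subsingleton (reducedHomology k (Δ.link ρ) (d - ρ.card)) := by
  intro hs
  obtain ⟨e⟩ := (h.hasHomologyOfSphere hρ).1
  have : Subsingleton k := e.symm.injective.subsingleton
  exact _root_.not_subsingleton k this

theorem exists_insert_mem (h : IsClosedHomologyManifold k d Δ) {ρ : Finset (Fin n)}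
    (hρ : ρ ∈ Δ.faces) (hc : ρ.card < d) : ∃ v, v ∉ ρ ∧ insert v ρ ∈ Δ.faces := by
  by_contra! hno
  refine h.not_subsingleton hρ (subsingleton_of_cycles_eq_bot ?_)
  rw [cycles, chains_eq_bot, bot_inf_eq]
  rw [Set.eq_empty_iff_forall_notMem]
  rintro τ ⟨rfl | hτ, hcard⟩
  · rw [Finset.card_empty] at hcard
    omega
  · obtain ⟨v, hv⟩ := hτ.1
    obtain ⟨h1, h2⟩ := insert_mem_of_mem_link hτ hv
    exact hno v h1 h2

theorem exists_facet (h : IsClosedHomologyManifold k d Δ) {ρ : Finset (Fin n)}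
    (hρ : ρ ∈ Δ.faces) : ∃ σ ∈ Δ.faces, σ.card = d ∧ ρ ⊆ σ := by
  have hle := card_le_rank hρ
  rw [h.rank_eq] at hle
  obtain ⟨m, hm⟩ := Nat.exists_eq_add_of_le hle
  induction m generalizing ρ with
  | zero => exact ⟨ρ, hρ, hm.symm, subset_rfl⟩
  | succ m ih =>
    obtain ⟨v, hv, hvρ⟩ := h.exists_insert_mem hρ (by omega)
    have hc := Finset.card_insert_of_notMem hv
    obtain ⟨σ, hσ, hcσ, hs⟩ := ih hvρ (by omega) (by omega)
    exact ⟨σ, hσ, hcσ, (Finset.subset_insert _ _).trans hs⟩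

theorem exists_insert_ne (h : IsClosedHomologyManifold k d Δ) {ρ : Finset (Fin n)}
    (hρ : ρ ∈ Δ.faces) (hc : ρ.card + 1 = d) (v : Fin n) :
    ∃ w, w ≠ v ∧ w ∉ ρ ∧ insert w ρ ∈ Δ.faces := by
  by_contra! hno
  refine h.not_subsingleton hρ ?_
  rw [show d - ρ.card = 1 by omega]
  refine subsingleton_of_cycles_eq_bot (cycles_one_eq_bot (v := v) fun w hw => ?_)
  obtain ⟨h1, h2⟩ := singleton_mem_link.1 hw
  by_contra hne
  exact hno w hne h1 h2

theorem eq_or_eq_of_insert_mem (h : IsClosedHomologyManifold k d Δ) {ρ : Finset (Fin n)}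
    (hρ : ρ ∈ Δ.faces) (hc : ρ.card + 1 = d) {v₁ v₂ v₃ : Fin n} (hn₁ : v₁ ∉ ρ) (hn₂ : v₂ ∉ ρ)
    (hn₃ : v₃ ∉ ρ) (h₁ : insert v₁ ρ ∈ Δ.faces) (h₂ : insert v₂ ρ ∈ Δ.faces)
    (h₃ : insert v₃ ρ ∈ Δ.faces) : v₁ = v₂ ∨ v₁ = v₃ ∨ v₂ = v₃ := by
  by_contra! hne
  obtain ⟨e⟩ := (h.hasHomologyOfSphere hρ).1
  rw [show d - ρ.card = 1 by omega] at e
  refine false_of_three_vertices e ?_ (singleton_mem_link.2 ⟨hn₁, h₁⟩)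
    (singleton_mem_link.2 ⟨hn₂, h₂⟩) (singleton_mem_link.2 ⟨hn₃, h₃⟩) hne.1 hne.2.1 hne.2.2
  rw [Set.eq_empty_iff_forall_notMem]
  rintro τ ⟨rfl | hτ, hcard⟩
  · simp at hcard
  · have h4 := card_le_rank hτ.2.2
    rw [Finset.card_union_of_disjoint hτ.2.1, h.rank_eq] at h4
    omega

theorem prop_of_insert_mem (h : IsClosedHomologyManifold k d Δ) {ρ : Finset (Fin n)}
    (hρ : ρ ∈ Δ.faces) (hc : ρ.card + 2 ≤ d) {C : Fin n → Prop}
    (hC : ∀ a b, a ∉ ρ → b ∉ ρ → insert a (insert b ρ) ∈ Δ.faces → C a → C b) {v w : Fin n}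
    (hvρ : v ∉ ρ) (hv : insert v ρ ∈ Δ.faces) (hwρ : w ∉ ρ) (hw : insert w ρ ∈ Δ.faces)
    (hCv : C v) : C w := by
  refine prop_of_vertices ((h.hasHomologyOfSphere hρ).2 1 (by omega)) (fun a b _ hab => ?_)
    (singleton_mem_link.2 ⟨hvρ, hv⟩) (singleton_mem_link.2 ⟨hwρ, hw⟩) hCv
  have := hab.2.2
  rw [Finset.insert_union, Finset.singleton_union] at this
  have hdis := Finset.disjoint_left.1 hab.2.1
  exact hC a b (hdis (by simp)) (hdis (by simp)) this

end IsClosedHomologyManifold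

end SimplicialHomology

namespace FacetComplex

open SimplicialHomology

variable {k : Type*} [Field k] {d n : ℕ} {Δ : PreAbstractSimplicialComplex (Fin n)}
  {K : Finset (Finset ℕ)}

theorem exists_isFacetFamily_of_isClosedHomologyManifold (h : IsClosedHomologyManifold k d Δ) :
    ∃ K, IsFacetFamily Fin.valEmbedding Δ K ∧ ∀ X ∈ K, X.card = d := by
  classical
  obtain ⟨K, hmem⟩ : ∃ K : Finset (Finset ℕ), ∀ X, X ∈ K ↔
      ∃ σ, (σ ∈ Δ.faces ∧ σ.card = d) ∧ σ.map Fin.valEmbedding = X :=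
    ⟨(Finset.univ.filter fun σ => σ ∈ Δ.faces ∧ σ.card = d).image (Finset.map Fin.valEmbedding),
      fun X => by simp⟩
  refine ⟨K, ⟨fun σ => ?_, fun X hX v hv => ?_⟩, fun X hX => ?_⟩
  · constructor
    · intro hσ
      obtain ⟨τ, hτ, hc, hs⟩ := h.exists_facet hσ
      exact ⟨(Δ.isRelLowerSet_faces hσ).1, _, (hmem _).2 ⟨τ, ⟨hτ, hc⟩, rfl⟩,
        Finset.map_subset_map.2 hs⟩
    · rintro ⟨hne, X, hX, hs⟩
      obtain ⟨τ, ⟨hτ, -⟩, rfl⟩ := (hmem _).1 hX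
      exact (Δ.isRelLowerSet_faces hτ).2 (Finset.map_subset_map.1 hs) hne
  · obtain ⟨τ, -, rfl⟩ := (hmem _).1 hX
    obtain ⟨i, -, rfl⟩ := Finset.mem_map.1 hv
    exact ⟨i, rfl⟩
  · obtain ⟨τ, ⟨-, hc⟩, rfl⟩ := (hmem _).1 hX
    rw [Finset.card_map, hc]

theorem IsFacetFamily.mem_faces {ι : Fin n ↪ ℕ} (hK : IsFacetFamily ι Δ K) {X : Finset ℕ}
    (hX : X ∈ K) {σ : Finset (Fin n)} (hs : σ.map ι ⊆ X) (hσ : 0 < σ.card) : σ ∈ Δ.faces :=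
  (hK.mem_faces_iff σ).2 ⟨Finset.card_pos.1 hσ, X, hX, hs⟩

theorem IsFacetFamily.exists_insert_eq {ι : Fin n ↪ ℕ} (hK : IsFacetFamily ι Δ K)
    (hcard : ∀ X ∈ K, X.card = d) {X : Finset ℕ} (hX : X ∈ K) {ρ : Finset (Fin n)}
    (hc : ρ.card + 1 = d) (hs : ρ.map ι ⊆ X) :
    ∃ v, v ∉ ρ ∧ insert v ρ ∈ Δ.faces ∧ X = (insert v ρ).map ι := by
  obtain ⟨a, ha, rfl⟩ := eq_insert_of_subset hs (by rw [hcard X hX, Finset.card_map, hc])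
  obtain ⟨v, rfl⟩ := hK.mem_range _ hX a (Finset.mem_insert_self _ _)
  have hv : v ∉ ρ := fun hv => ha (Finset.mem_map_of_mem ι hv)
  have e : insert (ι v) (ρ.map ι) = (insert v ρ).map ι := (Finset.map_insert _ _ _).symm
  exact ⟨v, hv, hK.mem_faces hX e.symm.subset (by simp [Finset.card_insert_of_notMem hv]), e⟩

theorem IsFacetFamily.mem_of_card_eq {ι : Fin n ↪ ℕ} (hK : IsFacetFamily ι Δ K)
    (hcard : ∀ X ∈ K, X.card = d) {σ : Finset (Fin n)} (hσ : σ ∈ Δ.faces) (hc : σ.card = d) :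
    σ.map ι ∈ K := by
  obtain ⟨-, X, hX, hs⟩ := (hK.mem_faces_iff σ).1 hσ
  rwa [Finset.eq_of_subset_of_card_le hs (by rw [hcard X hX, Finset.card_map, hc])]

theorem IsFacetFamily.isPseudomanifold (hd : 2 ≤ d) {ι : Fin n ↪ ℕ} (hK : IsFacetFamily ι Δ K)
    (hcard : ∀ X ∈ K, X.card = d) (hne : K.Nonempty) (h : IsClosedHomologyManifold k d Δ) :
    IsPseudomanifold d K where
  nonempty := hne
  card_eq := hcard
  exists_ne := by
    intro X hX s hs
    obtain ⟨ρ, hρ⟩ := hK.exists_map_eq hX (Finset.erase_subset s X)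
    have hcX := Finset.card_erase_add_one hs
    rw [← hρ, Finset.card_map, hcard X hX] at hcX
    have hρX : ρ.map ι ⊆ X := hρ ▸ Finset.erase_subset s X
    obtain ⟨v, hv, -, hXv⟩ := hK.exists_insert_eq hcard hX hcX hρX
    obtain ⟨w, hwv, hw, hwf⟩ := h.exists_insert_ne (hK.mem_faces hX hρX (by omega)) hcX v
    refine ⟨_, hK.mem_of_card_eq hcard hwf (by rw [Finset.card_insert_of_notMem hw, hcX]),
      fun he => ?_, ?_⟩
    · rw [hXv] at he
      have : w ∈ insert v ρ := Finset.map_injective ι he ▸ Finset.mem_insert_self w ρ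
      simp [hwv, hw] at this
    · rw [← hρ]
      exact Finset.map_subset_map.2 (Finset.subset_insert _ _)
  eq_or_eq := by
    intro S hS X hX Y hY W hW hSX hSY hSW
    obtain ⟨ρ, rfl⟩ := hK.exists_map_eq hX hSX
    rw [Finset.card_map] at hS
    obtain ⟨v₁, hv₁, hf₁, rfl⟩ := hK.exists_insert_eq hcard hX hS hSX
    obtain ⟨v₂, hv₂, hf₂, rfl⟩ := hK.exists_insert_eq hcard hY hS hSY
    obtain ⟨v₃, hv₃, hf₃, rfl⟩ := hK.exists_insert_eq hcard hW hS hSW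
    rcases h.eq_or_eq_of_insert_mem (hK.mem_faces hX hSX (by omega)) hS hv₁ hv₂ hv₃ hf₁ hf₂ hf₃
      with rfl | rfl | rfl <;> simp

theorem Linked.of_facetsAbove {Z Z' : Finset ℕ} (h : Z ⊆ Z') {X Y : Finset ℕ}
    (hXY : Linked d (facetsAbove Z' K) X Y) : Linked d (facetsAbove Z K) X Y := by
  have hsub : ∀ W, W ∈ facetsAbove Z' K → W ∈ facetsAbove Z K := fun W hW => by
    rw [mem_facetsAbove] at hW ⊢
    exact ⟨hW.1, h.trans hW.2⟩
  exact Relation.ReflTransGen.mono (fun _ _ hh => ⟨hsub _ hh.1, hsub _ hh.2.1, hh.2.2⟩) _ _ hXY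

theorem IsFacetFamily.stronglyConnected_facetsAbove {ι : Fin n ↪ ℕ} (hK : IsFacetFamily ι Δ K)
    (hcard : ∀ X ∈ K, X.card = d) (h : IsClosedHomologyManifold k d Δ) :
    ∀ (m : ℕ) (ρ : Finset (Fin n)), 0 < ρ.card → d ≤ ρ.card + 1 + m →
      StronglyConnected d (facetsAbove (ρ.map ι) K) := by
  intro m
  induction m with
  | zero =>
    intro ρ _ hc X hX Y hY
    refine Neighbors.linked ⟨_, (mem_facetsAbove.1 hX).2, (mem_facetsAbove.1 hY).2, ?_⟩ hX hY
    rwa [Finset.card_map]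
  | succ m ih =>
    intro ρ hρ hc X hX Y hY
    obtain ⟨hXK, hρX⟩ := mem_facetsAbove.1 hX
    obtain ⟨hYK, hρY⟩ := mem_facetsAbove.1 hY
    by_cases hc' : d ≤ ρ.card + 1
    · exact Neighbors.linked ⟨_, hρX, hρY, by rwa [Finset.card_map]⟩ hX hY
    · have hρf := hK.mem_faces hXK hρX hρ
      have hnew : ∀ Z ∈ K, ρ.map ι ⊆ Z → ∃ v, v ∉ ρ ∧ insert v ρ ∈ Δ.faces ∧
          (insert v ρ).map ι ⊆ Z := by
        intro Z hZ hs
        obtain ⟨σ, rfl⟩ := hK.exists_map_eq hZ subset_rfl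
        have hcσ := hcard _ hZ
        rw [Finset.card_map] at hcσ
        have hs' := Finset.map_subset_map.1 hs
        obtain ⟨v, hv, hvρ⟩ := Finset.exists_mem_notMem_of_card_lt_card
          (show ρ.card < σ.card by omega)
        have hsub : (insert v ρ).map ι ⊆ σ.map ι :=
          Finset.map_subset_map.2 (Finset.insert_subset hv hs')
        exact ⟨v, hvρ, hK.mem_faces hZ hsub (by simp [Finset.card_insert_of_notMem hvρ]), hsub⟩
      obtain ⟨v, hv, hvf, hvX⟩ := hnew X hXK hρX
      obtain ⟨w, hw, hwf, hwY⟩ := hnew Y hYK hρY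
      have hstep : ∀ a, a ∉ ρ → ∀ Z ∈ K, (insert a ρ).map ι ⊆ Z → ∀ W ∈ K,
          (insert a ρ).map ι ⊆ W → Linked d (facetsAbove (ρ.map ι) K) Z W := by
        intro a ha Z hZ hZs W hW hWs
        refine Linked.of_facetsAbove (Finset.map_subset_map.2 (Finset.subset_insert a ρ))
          (ih (insert a ρ) ?_ ?_ Z (mem_facetsAbove.2 ⟨hZ, hZs⟩) W (mem_facetsAbove.2 ⟨hW, hWs⟩))
        · rw [Finset.card_insert_of_notMem ha]; omega
        · rw [Finset.card_insert_of_notMem ha]; omega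
      have key := h.prop_of_insert_mem hρf (by omega)
        (C := fun a => ∀ Z ∈ K, (insert a ρ).map ι ⊆ Z →
          Linked d (facetsAbove (ρ.map ι) K) X Z) (fun a b _ hb hab hCa Z hZ hZs => by
          obtain ⟨-, W, hW, hWs⟩ := (hK.mem_faces_iff _).1 hab
          have hbW : (insert b ρ).map ι ⊆ W :=
            (Finset.map_subset_map.2 (Finset.subset_insert _ _)).trans hWs
          have haW : (insert a ρ).map ι ⊆ W := (Finset.map_subset_map.2
            (Finset.insert_subset_insert _ (Finset.subset_insert _ _))).trans hWs
          exact (hCa W hW haW).trans (hstep b hb W hW hbW Z hZ hZs)) hv hvf hw hwf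
        fun Z hZ hZs => hstep v hv X hXK hvX Z hZ hZs
      exact key Y hYK hwY

theorem single_mem_geometric {X : Finset ℕ} (hX : X ∈ K) {v : ℕ} (hv : v ∈ X) :
    (Pi.single v 1 : ℕ → ℝ) ∈ geometric K := by
  refine ⟨fun w => ?_, X, hX, fun w hw => ?_, ?_⟩
  · by_cases h : w = v
    · subst h; simp
    · simp [h]
  · have : w ≠ v := by rintro rfl; exact hw hv
    simp [this]
  · simp only [Pi.single_apply]
    rw [Finset.sum_ite_eq']
    simp [hv]

theorem isClosed_setOf_exists_facet (P : Finset ℕ → Prop) :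
    IsClosed {p : geometric K | ∃ Z ∈ K, P Z ∧ ∀ v, v ∉ Z → p.1 v = 0} := by
  have : {p : geometric K | ∃ Z ∈ K, P Z ∧ ∀ v, v ∉ Z → p.1 v = 0} =
      ⋃ Z ∈ {Z | Z ∈ K ∧ P Z}, ⋂ v, ⋂ (_ : v ∉ Z), {p : geometric K | p.1 v = 0} := by
    ext p
    simp only [Set.mem_ofPred_eq, Set.mem_iUnion, Set.mem_iInter, exists_prop, and_assoc]
  rw [this]
  refine Set.Finite.isClosed_biUnion (K.finite_toSet.subset fun Z hZ => hZ.1) fun Z _ =>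
    isClosed_iInter fun v => isClosed_iInter fun _ => ?_
  exact isClosed_eq ((continuous_apply v).comp continuous_subtype_val) continuous_const

/-- If the realization is connected and the stars of the vertices are strongly connected, then the
complex is strongly connected. -/
theorem stronglyConnected_of_connectedSpace [ConnectedSpace (geometric K)]
    (hne : ∀ X ∈ K, X.Nonempty)
    (h : ∀ v, ∀ X ∈ K, v ∈ X → ∀ Y ∈ K, v ∈ Y → Linked d K X Y) : StronglyConnected d K := by
  intro X hX Y hY
  have hcl := isClosed_setOf_exists_facet (K := K) (fun Z => Linked d K X Z)
  have hcl' := isClosed_setOf_exists_facet (K := K) (fun Z => ¬ Linked d K X Z)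
  have hcompl : {p : geometric K | ∃ Z ∈ K, Linked d K X Z ∧ ∀ v, v ∉ Z → p.1 v = 0} =
      {p : geometric K | ∃ Z ∈ K, ¬ Linked d K X Z ∧ ∀ v, v ∉ Z → p.1 v = 0}ᶜ := by
    ext p
    simp only [Set.mem_ofPred_eq, Set.mem_compl_iff]
    constructor
    · rintro ⟨Z, hZ, hXZ, hpZ⟩ ⟨Z', hZ', hXZ', hpZ'⟩
      obtain ⟨v, hv⟩ : ∃ v, p.1 v ≠ 0 := by
        by_contra! h0
        obtain ⟨-, W, -, -, hs⟩ := p.2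
        simp [h0] at hs
      have hvZ : v ∈ Z := by_contra fun hh => hv (hpZ v hh)
      have hvZ' : v ∈ Z' := by_contra fun hh => hv (hpZ' v hh)
      exact hXZ' (hXZ.trans (h v Z hZ hvZ Z' hZ' hvZ'))
    · intro hno
      obtain ⟨-, W, hW, hpW, -⟩ := p.2
      by_cases hXW : Linked d K X W
      · exact ⟨W, hW, hXW, hpW⟩
      · exact absurd ⟨W, hW, hXW, hpW⟩ hno
  have huniv := IsClopen.eq_univ (⟨hcl, hcompl ▸ hcl'.isOpen_compl⟩ : IsClopen
      {p : geometric K | ∃ Z ∈ K, Linked d K X Z ∧ ∀ v, v ∉ Z → p.1 v = 0}) (by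
    obtain ⟨v, hv⟩ := hne X hX
    refine ⟨⟨_, single_mem_geometric hX hv⟩, X, hX, Relation.ReflTransGen.refl, fun w hw => ?_⟩
    have : w ≠ v := by rintro rfl; exact hw hv
    simp [this])
  obtain ⟨y, hy⟩ := hne Y hY
  obtain ⟨Z, hZ, hXZ, hyZ⟩ : (⟨_, single_mem_geometric hY hy⟩ : geometric K) ∈
      {p : geometric K | ∃ Z ∈ K, Linked d K X Z ∧ ∀ v, v ∉ Z → p.1 v = 0} := huniv ▸ trivial
  have hyZ' : y ∈ Z := by
    by_contra hh
    simpa using hyZ y hh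
  exact hXZ.trans (h y Z hZ hyZ' Y hY hy)

/-- A connected homology manifold without boundary is a strongly connected pseudomanifold. -/
theorem exists_isPseudomanifold {M : Type*} [TopologicalSpace M] [ConnectedSpace M] (hd : 2 ≤ d)
    (hM : IsTriangulableHomologyManifoldWithoutBoundary k M d) :
    ∃ K, IsPseudomanifold d K ∧ StronglyConnected d K ∧ Nonempty (geometric K ≃ₜ M) := by
  obtain ⟨n, Δ, ⟨e⟩, hr, hm, hb⟩ := hM
  have h : IsClosedHomologyManifold k d Δ.toPreAbstractSimplicialComplex := ⟨hr, hm, hb⟩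
  obtain ⟨K, hK, hcard⟩ := exists_isFacetFamily_of_isClosedHomologyManifold h
  let e' : geometric K ≃ₜ M := hK.homeomorph.symm.trans e
  have : ConnectedSpace (geometric K) := e'.symm.surjective.connectedSpace e'.symm.continuous
  have hne : K.Nonempty := by
    obtain ⟨p⟩ := (inferInstance : Nonempty (geometric K))
    obtain ⟨-, X, hX, -⟩ := p.2
    exact ⟨X, hX⟩
  refine ⟨K, hK.isPseudomanifold hd hcard hne h, stronglyConnected_of_connectedSpace
    (fun X hX => Finset.card_pos.1 (by rw [hcard X hX]; omega)) ?_, ⟨e'⟩⟩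
  intro v X hX hvX Y hY hvY
  obtain ⟨i, rfl⟩ := hK.mem_range X hX v hvX
  have key := hK.stronglyConnected_facetsAbove hcard h d {i} (by simp) (by simp) X
    (mem_facetsAbove.2 ⟨hX, by simpa using hvX⟩) Y (mem_facetsAbove.2 ⟨hY, by simpa using hvY⟩)
  have hempty : facetsAbove ∅ K = K := by ext X; simp [mem_facetsAbove]
  have := Linked.of_facetsAbove (Finset.empty_subset _) key
  rwa [hempty] at this

end FacetComplex

theorem mainTheorem8 (k : Type*) [Field k] (M : Type*) [TopologicalSpace M] [ConnectedSpace M]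
    (d : ℕ) (hd : 4 ≤ d) (hM : IsTriangulableHomologyManifoldWithoutBoundary k M d) :
    (∃ γ : ℕ, ∀ a b : ℕ, γ ≤ b → b ≤ (a + 1).choose 2 →
      ∃ (n : ℕ) (Δ : AbstractSimplicialComplex (Fin n)),
        IsTriangulation Δ M ∧ Δ.gNumber 1 = (a : ℤ) ∧ Δ.gNumber 2 = (b : ℤ)) ∧
    (∃ N : ℕ, ∀ n : ℕ, N ≤ n →
      ∃ Δ : AbstractSimplicialComplex (Fin n), IsTriangulation Δ M ∧ IsNeighborly Δ 2) := by
  obtain ⟨K, hK, hc, ⟨e⟩⟩ := FacetComplex.exists_isPseudomanifold (by omega) hM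
  constructor
  · obtain ⟨γ, hγ⟩ := FacetComplex.exists_card_edges_eq hd hK hc
    refine ⟨γ, fun a b hb hb' => ?_⟩
    obtain ⟨L, ⟨f⟩, hL, hv, he⟩ := hγ a b hb hb'
    obtain ⟨Δ, ⟨g⟩, h1, h2⟩ := FacetComplex.exists_gNumber_eq hd hL hv rfl he
    exact ⟨_, Δ, ⟨(g.trans f.symm).trans e⟩, h1, h2⟩
  · obtain ⟨m₀, hm₀⟩ := FacetComplex.exists_isRim_card_eq hd hK hc
    refine ⟨d + m₀, fun n hn => ?_⟩
    obtain ⟨m, rfl⟩ := Nat.exists_eq_add_of_le hn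
    obtain ⟨L, Q, c, ⟨f⟩, -, hcomp, hv⟩ := hm₀ (m₀ + m) (by omega)
    obtain ⟨Δ, ⟨g⟩, h⟩ := FacetComplex.exists_isNeighborly
      (show (FacetComplex.vertices L).card = d + m₀ + m by rw [hv, add_assoc]) hcomp
    exact ⟨Δ, ⟨(g.trans f.symm).trans e⟩, h⟩
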